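/- Let $k$ be a commutative ring and $n\ge 0$. **Operads.** Let $A_\infty^{\mathrm{Col}}$ be the $\{\mathbf a,\mathbf m\}$-coloured DG operad over $k$, free as a graded operad on $\mu_i^{\mathbf a}\in A_\infty^{\mathrm{Col}}(\mathbf a^i;\mathbf a)$ and $\mu_i^{\mathbf m}\in A_\infty^{\mathrm{Col}}(\mathbf a^{i-1},\mathbf m;\mathbf m)$, $i\ge2$, of homological degree $i-2$, with (for compatible colours) $d\mu_i=-\sum_{p+s+q=i,\,2\le s<i}(-1)^{p+sq}\mu_{p+1+q}(1^{\otimes p}\otimes\mu_s\otimes 1^{\otimes q})$. Let $M_\infty^{\mathrm{Col}}$ be the DG $A_\infty^{\mathrm{Col}}$-bimodule, free as a graded bimodule on $f_i^{\mathbf a}$ (in $(\mathbf a^i;\mathbf a)$) and $f_i^{\mathbf m}$ (in $(\mathbf a^{i-1},\mathbf m;\mathbf m)$), $i\ge1$, of degree $i-1$, with $$df_i=\sum_{p+s+q=i,\ s\ge2}(-1)^{p+sq}f_{p+1+q}(1^{\otimes p}\otimes\mu_s\otimes1^{\otimes q})-\sum_{r\ge2,\ i_1+\dots+i_r=i}(-1)^{\sum_j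 (r-j)(i_j-1)}\mu_r(f_{i_1}\otimes\dots\otimes f_{i_r}).$$ Let $I$ be the DG ideal of $A_\infty^{\mathrm{Col}}$ generated by all $\mu_i^{\mathbf a}$, $i>2$, and let $q:M_\infty^{\mathrm{Col}}\to T$ be the quotient by the DG sub-bimodule generated by $I\cdot M_\infty^{\mathrm{Col}}$, $M_\infty^{\mathrm{Col}}\cdot I$ and all $f_i^{\mathbf a}$, $i>1$. **Multiplihedra.** The faces of $\mathcal J(n+1)$ are the painted planar trees with $n+1$ leaves: planar trees with a painted subtree that contains the root and no leaf, such that at each painted vertex the inputs are either all painted or all unpainted, and such that only vertices of the latter kind (the leaves of the painted subtree) may have a single input. A face $\sigma$ is a face of $\tau$ if $\tau$ arises from $\sigma$ by contracting inner unpainted edges, inner edges of the painted subtree, and corollas of leaves of the painted subtree. Vertices of $\mathcal J(n+1)$ are the painted binary trees. A painted tree with $n+1$ leaves is also read as an element of $M_\infty^{\mathrm{Col}}(\mathbf a^n,\mathbf m;\mathbf m)$: leaves of the painted subtree with $i$ inputs are $f_i$, all other vertices with $i$ inputs are $\mu_i$, and they are composed in planar prefix order. **Freehedra.** The faces of $\mathcal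 F_n$ are the nice $n$-expressions $s=s_l][s_{l+1}]\dots[s_k]\,|\,[s_0]\dots[s_{l-1}]$: the $s_i$ are nonempty subsets of $\{0,\dots,n\}$ with $\max s_i=\min s_{i+1}$, $|s_i|\ge2$ for $i\ne l$, $\min s_0=0$, $\max s_k=n$. The codimension is $k$ plus the number of elements of $\{0,\dots,n\}$ that occur in no $s_i$. The codimension one faces of $s$ are obtained by: dropping an interior element $x$ ($\min s_j<x<\max s_j$) of some $s_j$; replacing $[s_j]$, $j\neq l$, by $[s_j^{\le x}][s_j^{\ge x}]$ for an interior $x\in s_j$; replacing $s_l]$ by $s_l^{\le x}][s_l^{\ge x}]$ for $x\in s_l$, $x<\max s_l$; replacing $s_l]$ by $s_l^{\ge x}]$ and adding $[s_l^{\le x}]$ at the right end, for $x\in s_l$, $x>\min s_l$. A short tree is a finite sequence of branches, recorded by the numbers of leaves on the branches (the tree without branches is denoted $1$), and a forest is a sequence of short trees with at least one branch. The face $s$ is labelled by the forest-tree-forest triple $(F,T,G)=\big((\iota(s_k),\dots,\iota(s_{l+1})),\ \iota(s_l),\ (\iota(s_{l-1}),\dots,\iota(s_0))\big)$, where for $a_1<\dots<a_r$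 the tree $\iota(\{a_1,\dots,a_r\})$ has $r-1$ branches, the $j$-th from the right with $a_{j+1}-a_j$ leaves. The triple represents the element $e_s\in T(\mathbf a^n,\mathbf m;\mathbf m)$ that is the composite, from left to right, of the operations $\mu^{\mathbf m}_{r}(\dots,\mathrm{id}_{\mathbf m})$ for the trees of $F$, $f^{\mathbf m}_r(\dots,\mathrm{id}_{\mathbf m})$ for $T$, and $\mu^{\mathbf m}_r(\dots,\mathrm{id}_{\mathbf m})$ for the trees of $G$; here $r-1$ is the number of branches, and a branch with $b$ leaves contributes the $(b-1)$-fold product $(\mu_2^{\mathbf a})^{b-1}$ (followed by $f_1^{\mathbf a}$ on its inputs or output for the trees of $F$). **Claim.** (1) There is a unique map $\pi$ from the faces of $\mathcal J(n+1)$ to the faces of $\mathcal F_n$ such that - a vertex, i.e. a painted binary tree $B$, is sent to the face labelled $(F,1,G)$, where $G$ is the forest of the unpainted subtree $B'$ containing the right leaf and $F$ is the forest of $B\setminus B'$ ($B'$ replaced by a leaf, painting forgotten, single-input vertices removed). The forest of a binary tree is the sequence, from left to right, of one-branch trees with as many leaves as the successive subtrees that branch off the path from the root to the right leaf; - a face $\sigma$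 is sent to the smallest face of $\mathcal F_n$ that contains $\pi(v)$ for all vertices $v$ of $\sigma$. This $\pi$ is surjective and preserves the face relation. (2) There are orientations of the cells of $\mathcal J(n+1)$ and $\mathcal F_n$ (incidence numbers $\pm1$ exactly between a face and its codimension one faces, with $\partial^2=0$ and opposite signs at the two ends of each edge), for which $\sigma\mapsto\sigma$ and $s\mapsto e_s$ define isomorphisms of complexes $\Phi:C_*(\mathcal J(n+1);k)\to M_\infty^{\mathrm{Col}}(\mathbf a^n,\mathbf m;\mathbf m)$ and $\Psi:C_*(\mathcal F_n;k)\to T(\mathbf a^n,\mathbf m;\mathbf m)$. There is a unique map $\pi_*:C_*(\mathcal J(n+1);k)\to C_*(\mathcal F_n;k)$ induced by $\pi$ on cellular chains, i.e. a degree-preserving chain map with $\pi_*(v)=\pi(v)$ for every vertex $v$ and with $\pi_*(\sigma)$ supported on faces of $\pi(\sigma)$ for every face $\sigma$; and $$\Psi\circ\pi_*=q\circ\Phi ,$$ so that $\pi$ induces the quotient map of bimodules $M_\infty^{\mathrm{Col}}\to T$ in the components $(\mathbf a^n,\mathbf m;\mathbf m)$. -/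

import Mathlib

/-! ### Colours and trees -/

/-- The two colours: `a` (algebra) and `m` (module). -/
inductive Color : Type
  | a
  | m

mutual
  /-- Planar trees with edges coloured by `a`, `m` and a possible painting.

  `CTree false c`: unpainted trees with output colour `c`. Every vertex has at least two inputs; a
  vertex with `n` inputs and output colour `c` is the operation `μ_n^c`, whose inputs have the
  colours `a, …, a, c`. These trees form the basis of the free operad underlying `A_∞^Col`.

  `CTree true c`: painted trees with output colour `c`. A vertex `half` is a leaf of the painted
  subtree: its output is painted, its `n ≥ 1` inputs are not; it is the operation `f_n^c`. A painted
  `node` has at least two inputs, all of them painted; it is `μ_n^c` acting from the left.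
  These trees form the basis of the free bimodule underlying `M_∞^Col`.

  The colours of all edges are determined by the shape of the tree and its output colour. In
  particular `CTree true .m` with `n` leaves is the set of painted planar trees with `n` leaves, as
  labels for the faces of the multiplihedron `J(n)` sitting at `(a^(n-1), m; m)`. -/
  inductive CTree : Bool → Color → Type
    | leaf {c : Color} : CTree false c
    | node {p : Bool} {c : Color} (t : CTree p .a) (ts : CForest p c) : CTree p c
    | half {c : Color} (ts : CForest false c) : CTree true c

  /-- Nonempty sequences of trees with output colours `a, …, a, c`. -/
  inductive CForest : Bool → Color → Type
    | last {p : Bool} {c : Color} (t : CTree p c) : CForest p c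
    | cons {p : Bool} {c : Color} (t : CTree p .a) (ts : CForest p c) : CForest p c
end

namespace CForest

/-- Number of trees in the sequence. -/
def length {p : Bool} {c : Color} : CForest p c → ℕ
  | .last _ => 1
  | .cons _ ts => ts.length + 1

/-- Concatenation. -/
def append {p : Bool} {c : Color} : CForest p .a → CForest p c → CForest p c
  | .last t, r => .cons t r
  | .cons t ts, r => .cons t (ts.append r)

/-- All ways to cut a sequence into two nonempty consecutive parts. -/
def splits {p : Bool} {c : Color} : CForest p c → List (CForest p .a × CForest p c)
  | .last _ => []
  | .cons t ts => (.last t, ts) :: ts.splits.map (fun y => (.cons t y.1, y.2))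

/-- All ways to cut a sequence into consecutive nonempty blocks; the last block is listed
separately. -/
def blocks {p : Bool} {c : Color} : CForest p c → List (List (CForest p .a) × CForest p c)
  | .last t => [([], .last t)]
  | .cons t ts => ts.blocks.flatMap fun y =>
      [(.last t :: y.1, y.2),
        match y.1 with
        | [] => ([], .cons t y.2)
        | x :: bs => (.cons t x :: bs, y.2)]

end CForest

mutual
  /-- Number of leaves. -/
  def CTree.leaves {p : Bool} {c : Color} : CTree p c → ℕ
    | .leaf => 1
    | .node t ts => t.leaves + ts.leaves
    | .half ts => ts.leaves
  /-- Total number of leaves. -/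
  def CForest.leaves {p : Bool} {c : Color} : CForest p c → ℕ
    | .last t => t.leaves
    | .cons t ts => t.leaves + ts.leaves
end

mutual
  /-- Dimension of the cell labelled by a tree: `μ_n` contributes `n - 2` and `f_n` contributes
  `n - 1` (it is minus the cohomological degree). -/
  def CTree.dim {p : Bool} {c : Color} : CTree p c → ℕ
    | .leaf => 0
    | .node t ts => (ts.length - 1) + (t.dim + ts.dim)
    | .half ts => (ts.length - 1) + ts.dim
  /-- Total dimension. -/
  def CForest.dim {p : Bool} {c : Color} : CForest p c → ℕ
    | .last t => t.dim
    | .cons t ts => t.dim + ts.dim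
end

/-! ### The operad `A_∞^Col` and the bimodule `M_∞^Col` -/

/-- `CMod k false c` is `A_∞^Col(…; c)` and `CMod k true c` is `M_∞^Col(…; c)`, the direct sum being
taken over all arities. A basis vector `T` is the composite of its vertices, multiplied in the
planar prefix order (first the root, then the subtrees from left to right). -/
abbrev CMod (k : Type*) [CommRing k] (p : Bool) (c : Color) : Type _ := CTree p c →₀ k

/-- Sums of pure tensors `x_1 ⊗ … ⊗ x_r`, `r ≥ 1`, with `x_i` in colour `a` for `i < r` and `x_r` in
colour `c`. -/
abbrev CTensor (k : Type*) [CommRing k] (p : Bool) (c : Color) : Type _ := CForest p c →₀ k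

section Composition

mutual
  /-- Full composition of a tree with a sequence of trees, one for each leaf, together with the
  exponent of the Koszul sign that brings the vertices into prefix order. For `(p, q)` equal to
  `(false, false)`, `(false, true)`, `(true, false)` this is the operadic composition, the left
  action and the right action. It is undefined if the numbers of leaves and trees differ. -/
  def CTree.comp {p q : Bool} {c : Color} : CTree p c → CForest q c → Option (ℕ × CTree (p || q) c)
    | .leaf, .last x => some (0, x)
    | .leaf, .cons _ _ => none
    | .node t ts, g =>
        match g.splits.find? (fun y => y.1.length == t.leaves) with
        | none => none
        | some y =>
          match t.comp y.1, ts.comp y.2 with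
          | some u, some v => some (u.1 + v.1 + ts.dim * y.1.dim, .node u.2 v.2)
          | _, _ => none
    | .half ts, g =>
        match q, g with
        | true, _ => none
        | false, g =>
          match ts.comp g with
          | some v => some (v.1, .half v.2)
          | none => none
  /-- The same for a sequence of trees. -/
  def CForest.comp {p q : Bool} {c : Color} :
      CForest p c → CForest q c → Option (ℕ × CForest (p || q) c)
    | .last t, g =>
        match t.comp g with
        | some u => some (u.1, .last u.2)
        | none => none
    | .cons t ts, g =>
        match g.splits.find? (fun y => y.1.length == t.leaves) with
        | none => none
        | some y =>
          match t.comp y.1, ts.comp y.2 with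
          | some u, some v => some (u.1 + v.1 + ts.dim * y.1.dim, .cons u.2 v.2)
          | _, _ => none
end

end Composition

noncomputable section

/-- Bilinear extension of the composition, extended by zero where it is undefined. -/
def compL {k : Type*} [CommRing k] {p q : Bool} {c : Color} (x : CMod k p c) (g : CTensor k q c) :
    CMod k (p || q) c :=
  x.sum fun t α => g.sum fun ts β =>
    match t.comp ts with
    | some u => Finsupp.single u.2 ((-1) ^ u.1 * α * β)
    | none => 0

/-- A tensor word of length one. -/
def tensorLast {k : Type*} [CommRing k] {p : Bool} {c : Color} (x : CMod k p c) : CTensor k p c :=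
  x.mapDomain CForest.last

/-- The tensor `x ⊗ g`. -/
def tensorCons {k : Type*} [CommRing k] {p : Bool} {c : Color} (x : CMod k p .a)
    (g : CTensor k p c) : CTensor k p c :=
  x.sum fun t α => g.sum fun ts β => Finsupp.single (.cons t ts) (α * β)

/-! ### The differential -/

/-- All ways to replace `s ≥ 2` consecutive trees `t_(p+1), …, t_(p+s)` in `t_1, …, t_n` by the one
tree `μ_s(t_(p+1), …, t_(p+s))`. An entry is `(s, e, forest)` with
`e = p + s q + s (dim t_1 + … + dim t_p)`, where `q = n - p - s`; the last summand is the Koszul sign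
for moving `μ_s` past `t_1, …, t_p`. -/
def CForest.merges {p : Bool} {c : Color} : CForest p c → List (ℕ × ℕ × CForest p c)
  | .last _ => []
  | .cons t ts =>
      (ts.length + 1, 0, .last (.node t ts)) ::
        (ts.splits.map (fun y =>
            (y.1.length + 1, (y.1.length + 1) * y.2.length, .cons (.node t y.1) y.2)) ++
          ts.merges.map (fun y => (y.1, y.2.1 + 1 + y.1 * t.dim, .cons t y.2.2)))

/-- The vector `μ_r(t_1, …, t_r)` for `r ≥ 2`, and `0` for `r = 1`. -/
def CForest.join (k : Type*) [CommRing k] {p : Bool} {c : Color} : CForest p c → CMod k p c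
  | .last _ => 0
  | .cons t ts => Finsupp.single (.node t ts) 1

/-- The sequence `f(B_1), …, f(B_r)` for a sequence of blocks. -/
def paintBlocks {c : Color} (bs : List (CForest false .a)) (b : CForest false c) : CForest true c :=
  bs.foldr (fun x g => .cons (.half x) g) (.last (.half b))

/-- The exponent of the sign of `μ_r(f_(i_1)(B_1), …, f_(i_r)(B_r))`: the sum over `j` of
`(r - j) (i_j - 1)`, plus the Koszul sign for moving each `f_(i_l)` past all `B_j`, `j < l`. -/
def blocksSign {c : Color} : List (CForest false .a) → CForest false c → ℕ
  | [], _ => 0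
  | x :: bs, b =>
      (bs.length + 1) * (x.length - 1)
        + x.dim * ((bs.map fun y => y.length - 1).sum + (b.length - 1))
        + blocksSign bs b

mutual
  /-- The differential on basis vectors: the derivation with
  `d μ_n = - ∑ (-1)^(p+sq) μ_(p+1+q)(1^p ⊗ μ_s ⊗ 1^q)`, over `p + s + q = n`, `2 ≤ s < n`, and
  `d f_n = ∑ (-1)^(p+sq) f_(p+1+q)(1^p ⊗ μ_s ⊗ 1^q) - ∑ (-1)^σ μ_r(f_(i_1) ⊗ … ⊗ f_(i_r))`, over
  `p + s + q = n`, `2 ≤ s`, and `i_1 + … + i_r = n`, `2 ≤ r`, with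
  `σ = (r-1)(i_1 - 1) + (r-2)(i_2 - 1) + … + (i_(r-1) - 1)`. -/
  def CTree.d (k : Type*) [CommRing k] {p : Bool} {c : Color} : CTree p c → CMod k p c
    | .leaf => 0
    | .node t ts =>
        - ((CForest.cons t ts).merges.map (fun y => ((-1 : k) ^ y.2.1) • y.2.2.join k)).sum
        + ((-1 : k) ^ (ts.length + 1)) •
          (Finsupp.mapDomain (fun t' => CTree.node t' ts) (t.d k)
            + ((-1 : k) ^ t.dim) • Finsupp.mapDomain (fun ts' => CTree.node t ts') (ts.d k))
    | .half ts =>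
        (ts.merges.map (fun y => Finsupp.single (CTree.half y.2.2) ((-1 : k) ^ y.2.1))).sum
        - (ts.blocks.map (fun y =>
            ((-1 : k) ^ blocksSign y.1 y.2) • (paintBlocks y.1 y.2).join k)).sum
        + ((-1 : k) ^ (ts.length - 1)) • Finsupp.mapDomain CTree.half (ts.d k)
  /-- The differential of a tensor product of trees. -/
  def CForest.d (k : Type*) [CommRing k] {p : Bool} {c : Color} : CForest p c → CTensor k p c
    | .last t => Finsupp.mapDomain CForest.last (t.d k)
    | .cons t ts =>
        Finsupp.mapDomain (fun t' => CForest.cons t' ts) (t.d k)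
          + ((-1 : k) ^ t.dim) • Finsupp.mapDomain (fun ts' => CForest.cons t ts') (ts.d k)
end

/-- The differential of `A_∞^Col` and of `M_∞^Col`. -/
def dL (k : Type*) [CommRing k] (p : Bool) (c : Color) : CMod k p c →ₗ[k] CMod k p c :=
  Finsupp.linearCombination k (CTree.d k)

/-! ### The quotient `T` -/

/-- Sequence of `n + 1` leaves. -/
def leavesForest (c : Color) : ℕ → CForest false c
  | 0 => .last .leaf
  | n + 1 => .cons .leaf (leavesForest c n)

/-- The generator `μ_(n+2)^c`. -/
def muGen (k : Type*) [CommRing k] (c : Color) (n : ℕ) : CMod k false c :=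
  Finsupp.single (.node .leaf (leavesForest c n)) 1

/-- The generator `f_(n+1)^c`. -/
def fGen (k : Type*) [CommRing k] (c : Color) (n : ℕ) : CMod k true c :=
  Finsupp.single (.half (leavesForest c n)) 1

/-- Pure tensors `x_1 ⊗ … ⊗ x_r` with at least one entry in the given submodules. -/
inductive HasEntryIn {k : Type*} [CommRing k] {p : Bool} (N : ∀ c, Submodule k (CMod k p c)) :
    ∀ {c : Color}, CTensor k p c → Prop
  | last {c : Color} (x : CMod k p c) (hx : x ∈ N c) : HasEntryIn N (tensorLast x)
  | head {c : Color} (x : CMod k p .a) (g : CTensor k p c) (hx : x ∈ N .a) :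
      HasEntryIn N (tensorCons x g)
  | tail {c : Color} (x : CMod k p .a) (g : CTensor k p c) (hg : HasEntryIn N g) :
      HasEntryIn N (tensorCons x g)

/-- DG ideals of the operad `A_∞^Col`. -/
structure IsDGIdeal {k : Type*} [CommRing k] (I : ∀ c, Submodule k (CMod k false c)) : Prop where
  d_mem : ∀ c, ∀ x ∈ I c, dL k false c x ∈ I c
  comp_mem_left : ∀ c, ∀ x ∈ I c, ∀ g : CTensor k false c, compL x g ∈ I c
  comp_mem_right : ∀ c, ∀ x : CMod k false c, ∀ g : CTensor k false c,
    HasEntryIn I g → compL x g ∈ I c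

/-- DG sub-bimodules of the `A_∞^Col`-bimodule `M_∞^Col`. -/
structure IsDGSubbimodule {k : Type*} [CommRing k] (N : ∀ c, Submodule k (CMod k true c)) :
    Prop where
  d_mem : ∀ c, ∀ x ∈ N c, dL k true c x ∈ N c
  right_mem : ∀ c, ∀ x ∈ N c, ∀ g : CTensor k false c, compL x g ∈ N c
  left_mem : ∀ c, ∀ x : CMod k false c, ∀ g : CTensor k true c, HasEntryIn N g → compL x g ∈ N c

/-- The DG ideal of `A_∞^Col` generated by all `μ_i^a` with `i > 2`, so that `Ω = A_∞^Col / I`. -/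
def idealOmega (k : Type*) [CommRing k] (c : Color) : Submodule k (CMod k false c) :=
  ⨅ (I : ∀ c, Submodule k (CMod k false c)) (_ : IsDGIdeal I)
    (_ : ∀ i, 2 < i + 2 → muGen k .a i ∈ I .a), I c

/-- The families of submodules whose quotient kills `I · M_∞^Col`, `M_∞^Col · I` and all `f_i^a` with
`i > 1`. -/
structure KillsRelations {k : Type*} [CommRing k] (N : ∀ c, Submodule k (CMod k true c)) :
    Prop where
  ideal_left : ∀ c, ∀ x ∈ idealOmega k c, ∀ g : CTensor k true c, compL x g ∈ N c
  ideal_right : ∀ c, ∀ x : CMod k true c, ∀ g : CTensor k false c,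
    HasEntryIn (idealOmega k) g → compL x g ∈ N c
  fGen_mem : ∀ i, 1 < i + 1 → fGen k .a i ∈ N .a

/-- The smallest DG sub-bimodule containing `I · M_∞^Col`, `M_∞^Col · I` and all `f_i^a`, `i > 1`. -/
def relT (k : Type*) [CommRing k] (c : Color) : Submodule k (CMod k true c) :=
  ⨅ (N : ∀ c, Submodule k (CMod k true c)) (_ : IsDGSubbimodule N) (_ : KillsRelations N), N c

theorem HasEntryIn.mono {k : Type*} [CommRing k] {p : Bool} {N N' : ∀ c, Submodule k (CMod k p c)}
    (h : ∀ c, N c ≤ N' c) {c : Color} {g : CTensor k p c} (hg : HasEntryIn N g) :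
    HasEntryIn N' g := by
  induction hg with
  | last x hx => exact .last x (h _ hx)
  | head x g hx => exact .head x g (h _ hx)
  | tail x g _ ih => exact .tail x g ih

theorem relT_le {k : Type*} [CommRing k] {N : ∀ c, Submodule k (CMod k true c)}
    (hN : IsDGSubbimodule N) (hK : KillsRelations N) (c : Color) : relT k c ≤ N c := by
  intro x hx
  simp only [relT, Submodule.mem_iInf] at hx
  exact hx N hN hK

theorem mem_relT {k : Type*} [CommRing k] {c : Color} {x : CMod k true c}
    (h : ∀ N : ∀ c, Submodule k (CMod k true c), IsDGSubbimodule N → KillsRelations N → x ∈ N c) :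
    x ∈ relT k c := by
  simpa only [relT, Submodule.mem_iInf] using h

/-- The kernel of the quotient map is a DG sub-bimodule. -/
theorem relT_isDGSubbimodule (k : Type*) [CommRing k] : IsDGSubbimodule (relT k) where
  d_mem c x hx := mem_relT fun _ hN hK => hN.d_mem c x (relT_le hN hK c hx)
  right_mem c x hx g := mem_relT fun _ hN hK => hN.right_mem c x (relT_le hN hK c hx) g
  left_mem c x g hg := mem_relT fun _ hN hK => hN.left_mem c x g (hg.mono (relT_le hN hK))

/-- The quotient by `relT` is killed by `I` on both sides, so it is a bimodule over `Ω`. -/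
theorem relT_killsRelations (k : Type*) [CommRing k] : KillsRelations (relT k) where
  ideal_left c x hx g := mem_relT fun _ _ hK => hK.ideal_left c x hx g
  ideal_right c x g hg := mem_relT fun _ _ hK => hK.ideal_right c x g hg
  fGen_mem i hi := mem_relT fun _ _ hK => hK.fGen_mem i hi

theorem relT_le_comap (k : Type*) [CommRing k] (c : Color) :
    relT k c ≤ (relT k c).comap (dL k true c) :=
  fun x hx => (relT_isDGSubbimodule k).d_mem c x hx

/-- The bimodule `T`, in output colour `c`, the direct sum being taken over all arities. -/
abbrev TQuot (k : Type*) [CommRing k] (c : Color) : Type _ := CMod k true c ⧸ relT k c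

/-- The quotient map of bimodules `M_∞^Col → T`. -/
def quotT (k : Type*) [CommRing k] (c : Color) : CMod k true c →ₗ[k] TQuot k c :=
  (relT k c).mkQ

/-- The differential of `T`. -/
def dT (k : Type*) [CommRing k] (c : Color) : TQuot k c →ₗ[k] TQuot k c :=
  (relT k c).mapQ (relT k c) (dL k true c) (relT_le_comap k c)

/-- The component `M_∞^Col(a^n, m; m)`. -/
def Mcomp (k : Type*) [CommRing k] (n : ℕ) : Submodule k (CMod k true .m) :=
  Finsupp.supported k k {t | t.leaves = n + 1}

/-- The component `T(a^n, m; m)`. -/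
def Tcomp (k : Type*) [CommRing k] (n : ℕ) : Submodule k (TQuot k .m) :=
  (Mcomp k n).map (quotT k .m)

/-! ### Face posets and cellular chains -/

/-- The faces of an abstract polytope with their dimensions; `facet σ τ` says that `σ` is a face of
`τ` of codimension one. -/
class FaceSystem (P : Type) where
  dim : P → ℕ
  facet : P → P → Prop

/-- `σ` is a face of `τ`. -/
def IsFaceOf {P : Type} [FaceSystem P] (σ τ : P) : Prop :=
  Relation.ReflTransGen FaceSystem.facet σ τ

/-- Orientations of all cells, recorded by the incidence numbers `inc σ τ = [σ : τ]`. Vertices carry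
the standard orientation, so that the two ends of an edge have opposite incidence numbers. -/
structure CellOrientation (P : Type) [FaceSystem P] where
  inc : P → P →₀ ℤ
  inc_facet : ∀ σ τ, FaceSystem.facet τ σ → inc σ τ = 1 ∨ inc σ τ = -1
  inc_of_not_facet : ∀ σ τ, ¬ FaceSystem.facet τ σ → inc σ τ = 0
  edge : ∀ σ, FaceSystem.dim σ = 1 → ((inc σ).sum fun _ z => z) = 0
  sq_zero : ∀ σ, ((inc σ).sum fun τ z => z • inc τ) = 0

/-- The boundary map of the cellular chain complex `C_*(P) = P →₀ k`. -/
def CellOrientation.boundary (k : Type*) [CommRing k] {P : Type} [FaceSystem P] (o : CellOrientation P) :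
    (P →₀ k) →ₗ[k] (P →₀ k) :=
  Finsupp.linearCombination k fun σ => (o.inc σ).mapRange (fun z : ℤ => (z : k)) (by simp)

/-- `φ` is the map of cellular chains induced by a cellular projection that sends each face `σ` onto
the face `π σ`: a chain map of degree zero, given by `π` on vertices, which sends the cell `σ` to a
chain on the closed cell `π σ`. -/
structure IsInducedMap {k : Type*} [CommRing k] {P Q : Type} [FaceSystem P] [FaceSystem Q]
    (oP : CellOrientation P) (oQ : CellOrientation Q) (π : P → Q) (φ : (P →₀ k) →ₗ[k] (Q →₀ k)) :
    Prop where
  chain_map : ∀ x, φ (oP.boundary k x) = oQ.boundary k (φ x)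
  vertex : ∀ v, FaceSystem.dim v = 0 → φ (Finsupp.single v 1) = Finsupp.single (π v) 1
  carried : ∀ σ τ, φ (Finsupp.single σ 1) τ ≠ 0 →
    IsFaceOf τ (π σ) ∧ FaceSystem.dim τ = FaceSystem.dim σ

/-! ### Multiplihedra -/

/-- Contract the edge between a vertex and one of its inputs, seen on the sequence of inputs: one
entry `μ_s(x_1, …, x_s)` is replaced by `x_1, …, x_s`. -/
inductive Flatten {p : Bool} : ∀ {c : Color}, CForest p c → CForest p c → Prop
  | last {c : Color} (t : CTree p .a) (ts : CForest p c) :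
      Flatten (.last (.node t ts)) (.cons t ts)
  | head {c : Color} (t : CTree p .a) (ts : CForest p .a) (r : CForest p c) :
      Flatten (.cons (.node t ts) r) (.cons t (ts.append r))
  | tail {c : Color} (t : CTree p .a) (r r' : CForest p c) (h : Flatten r r') :
      Flatten (.cons t r) (.cons t r')

/-- `Unpaint g x`: all entries of `g` are painted leaves `f(B_1), …, f(B_r)`, and `x` is the
concatenation of `B_1, …, B_r`. -/
inductive Unpaint : ∀ {c : Color}, CForest true c → CForest false c → Prop
  | last {c : Color} (x : CForest false c) : Unpaint (.last (.half x)) x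
  | cons {c : Color} (x : CForest false .a) (g : CForest true c) (y : CForest false c)
      (h : Unpaint g y) : Unpaint (.cons (.half x) g) (x.append y)

mutual
  /-- One admissible contraction. -/
  inductive Contract : ∀ {p : Bool} {c : Color}, CTree p c → CTree p c → Prop
    /-- Contract an inner unpainted edge, or an edge inner to the painted subtree, between two
    vertices of the same kind. -/
    | edge {p : Bool} {c : Color} (t t' : CTree p .a) (ts ts' : CForest p c)
        (h : Flatten (.cons t ts) (.cons t' ts')) : Contract (.node t ts) (.node t' ts')
    /-- Contract an inner unpainted edge below a leaf of the painted subtree. -/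
    | halfEdge {c : Color} (ts ts' : CForest false c) (h : Flatten ts ts') :
        Contract (.half ts) (.half ts')
    /-- Contract a corolla of painted leaves. -/
    | corolla {c : Color} (t : CTree true .a) (ts : CForest true c) (x : CForest false c)
        (h : Unpaint (.cons t ts) x) : Contract (.node t ts) (.half x)
    /-- A contraction inside a subtree. -/
    | inNode {p : Bool} {c : Color} (t t' : CTree p .a) (ts ts' : CForest p c)
        (h : ContractIn (.cons t ts) (.cons t' ts')) : Contract (.node t ts) (.node t' ts')
    /-- A contraction inside a subtree. -/
    | inHalf {c : Color} (ts ts' : CForest false c) (h : ContractIn ts ts') :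
        Contract (.half ts) (.half ts')
  /-- One admissible contraction inside one of the trees of a sequence. -/
  inductive ContractIn : ∀ {p : Bool} {c : Color}, CForest p c → CForest p c → Prop
    | last {p : Bool} {c : Color} (t t' : CTree p c) (h : Contract t t') :
        ContractIn (.last t) (.last t')
    | head {p : Bool} {c : Color} (t t' : CTree p .a) (ts : CForest p c) (h : Contract t t') :
        ContractIn (.cons t ts) (.cons t' ts)
    | tail {p : Bool} {c : Color} (t : CTree p .a) (ts ts' : CForest p c) (h : ContractIn ts ts') :
        ContractIn (.cons t ts) (.cons t ts')
end

/-- The faces of the multiplihedron `J(n)`: painted planar trees with `n` leaves. -/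
def Multiplihedron (n : ℕ) : Type := {t : CTree true .m // t.leaves = n}

instance (n : ℕ) : FaceSystem (Multiplihedron n) where
  dim σ := σ.1.dim
  facet σ τ := Contract σ.1 τ.1

/-! ### Freehedra -/

/-- An expression `s_l] [s_(l+1)] … [s_k] | [s_0] … [s_(l-1)]`, with `left = [s_(l+1), …, s_k]`,
`mid = s_l`, `right = [s_0, …, s_(l-1)]`. -/
structure Expression where
  left : List (Finset ℕ)
  mid : Finset ℕ
  right : List (Finset ℕ)

/-- `max s = min s'`. -/
def Linked (s s' : Finset ℕ) : Prop :=
  ∃ x, IsGreatest (s : Set ℕ) x ∧ IsLeast (s' : Set ℕ) x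

/-- Nice `n`-expressions. -/
structure Expression.IsNice (n : ℕ) (s : Expression) : Prop where
  subset : ∀ u ∈ s.right ++ s.mid :: s.left, u ⊆ Finset.range (n + 1)
  nonempty : ∀ u ∈ s.right ++ s.mid :: s.left, u.Nonempty
  linked : List.IsChain Linked (s.right ++ s.mid :: s.left)
  card : ∀ u ∈ s.right ++ s.left, 2 ≤ u.card
  min_eq : ∀ u ∈ (s.right ++ s.mid :: s.left).head?, IsLeast (u : Set ℕ) 0
  max_eq : ∀ u ∈ (s.right ++ s.mid :: s.left).getLast?, IsGreatest (u : Set ℕ) n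

/-- `x` is an element of `s` strictly between `min s` and `max s`. -/
def IsInner (x : ℕ) (s : Finset ℕ) : Prop := x ∈ s ∧ (∃ a ∈ s, a < x) ∧ ∃ b ∈ s, x < b

/-- The elements of `s` that are at most `x`. -/
def lower (s : Finset ℕ) (x : ℕ) : Finset ℕ := s.filter (· ≤ x)

/-- The elements of `s` that are at least `x`. -/
def upper (s : Finset ℕ) (x : ℕ) : Finset ℕ := s.filter (x ≤ ·)

/-- The face transformations of expressions: drops, inner breaks and the two outer breaks. -/
inductive FaceMove : Expression → Expression → Prop
  | dropMid (L R : List (Finset ℕ)) (m : Finset ℕ) (x : ℕ) (h : IsInner x m) :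
      FaceMove ⟨L, m, R⟩ ⟨L, m.erase x, R⟩
  | dropLeft (L₁ L₂ R : List (Finset ℕ)) (m s : Finset ℕ) (x : ℕ) (h : IsInner x s) :
      FaceMove ⟨L₁ ++ s :: L₂, m, R⟩ ⟨L₁ ++ s.erase x :: L₂, m, R⟩
  | dropRight (L R₁ R₂ : List (Finset ℕ)) (m s : Finset ℕ) (x : ℕ) (h : IsInner x s) :
      FaceMove ⟨L, m, R₁ ++ s :: R₂⟩ ⟨L, m, R₁ ++ s.erase x :: R₂⟩
  | breakLeft (L₁ L₂ R : List (Finset ℕ)) (m s : Finset ℕ) (x : ℕ) (h : IsInner x s) :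
      FaceMove ⟨L₁ ++ s :: L₂, m, R⟩ ⟨L₁ ++ lower s x :: upper s x :: L₂, m, R⟩
  | breakRight (L R₁ R₂ : List (Finset ℕ)) (m s : Finset ℕ) (x : ℕ) (h : IsInner x s) :
      FaceMove ⟨L, m, R₁ ++ s :: R₂⟩ ⟨L, m, R₁ ++ lower s x :: upper s x :: R₂⟩
  | rightOuter (L R : List (Finset ℕ)) (m : Finset ℕ) (x : ℕ) (hx : x ∈ m) (h : ∃ b ∈ m, x < b) :
      FaceMove ⟨L, m, R⟩ ⟨upper m x :: L, lower m x, R⟩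
  | leftOuter (L R : List (Finset ℕ)) (m : Finset ℕ) (x : ℕ) (hx : x ∈ m) (h : ∃ a ∈ m, a < x) :
      FaceMove ⟨L, m, R⟩ ⟨L, upper m x, R ++ [lower m x]⟩

/-- The faces of the freehedron `F_n`. -/
def Freehedron (n : ℕ) : Type := {s : Expression // s.IsNice n}

/-- The codimension of a face is the number of breaks (one less than the number of stretches) plus
the number of elements of `{0, …, n}` that are not present. -/
instance (n : ℕ) : FaceSystem (Freehedron n) where
  dim s := n - (s.1.left.length + s.1.right.length +
    (Finset.range (n + 1) \ (s.1.right ++ s.1.mid :: s.1.left).foldr (· ∪ ·) ∅).card)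
  facet s' s := FaceMove s.1 s'.1

/-! ### Forest-tree-forest triples -/

/-- Triples `(F, T, G)`. A short tree is the list of the numbers of leaves on its branches, from left
to right; a short forest is a list of short trees. The tree without branches is `1`. -/
structure Triple where
  left : List (List ℕ)
  mid : List ℕ
  right : List (List ℕ)

/-- Successive differences of a list. -/
def gaps : List ℕ → List ℕ
  | x :: y :: l => (y - x) :: gaps (y :: l)
  | _ => []

/-- The short tree of a stretch `a_1 < … < a_r`: it has `r - 1` branches, and the `j`-th branch from
the right has `a_(j+1) - a_j` leaves. -/
def stretchTree (s : Finset ℕ) : List ℕ := (gaps (s.sort (· ≤ ·))).reverse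

/-- The triple that labels a face of the freehedron. -/
def Freehedron.toTriple {n : ℕ} (s : Freehedron n) : Triple where
  left := (s.1.left.map stretchTree).reverse
  mid := stretchTree s.1.mid
  right := (s.1.right.map stretchTree).reverse

/-- The iterated product `μ_2(… μ_2(μ_2(id, id), id) …, id)` of `j + 1` inputs of colour `a`. -/
def comb : ℕ → CTree false .a
  | 0 => .leaf
  | j + 1 => .node (comb j) (.last .leaf)

/-- The inputs of a vertex for a short tree: products of `b` inputs for each branch with `b` leaves,
followed by the last input `u`. -/
def branchInputs (bs : List ℕ) (u : CTree false .m) : CForest false .m :=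
  bs.foldr (fun b g => .cons (comb (b - 1)) g) (.last u)

/-- The same with painted inputs. -/
def paintedBranchInputs (bs : List ℕ) (u : CTree true .m) : CForest true .m :=
  bs.foldr (fun b g => .cons (.half (.last (comb (b - 1)))) g) (.last u)

/-- The composite of the operations `μ^m_r(…, id_m)` for the trees of the right forest. -/
def rightTree : List (List ℕ) → CTree false .m
  | [] => .leaf
  | [] :: G => rightTree G
  | (b :: bs) :: G => .node (comb (b - 1)) (branchInputs bs (rightTree G))

/-- The composite of the operations `μ^m_r(…, id_m)` for the trees of the left forest, applied to
`w`. -/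
def leftTree (w : CTree true .m) : List (List ℕ) → CTree true .m
  | [] => w
  | [] :: F => leftTree w F
  | (b :: bs) :: F =>
      .node (.half (.last (comb (b - 1)))) (paintedBranchInputs bs (leftTree w F))

/-- The composite operation that represents the basis vector `(F, T, G)` of `T(a^n, m; m)`. -/
def Triple.toTree (τ : Triple) : CTree true .m :=
  leftTree (.half (branchInputs τ.mid (rightTree τ.right))) τ.left

/-! ### The projection on vertices -/

/-- The last tree of a sequence. -/
def CForest.lastTree {p : Bool} {c : Color} : CForest p c → CTree p c
  | .last t => t
  | .cons _ ts => ts.lastTree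

mutual
  /-- Forget the painting; single-input vertices disappear. -/
  def CTree.forget {c : Color} : CTree true c → CTree false c
    | .node t ts => .node t.forget ts.forget
    | .half (.last t) => t
    | .half (.cons t ts) => .node t ts
  /-- Forget the painting in a sequence of trees. -/
  def CForest.forget {c : Color} : CForest true c → CForest false c
    | .last t => .last t.forget
    | .cons t ts => .cons t.forget ts.forget
end

mutual
  /-- The unpainted subtree `T'` of a painted tree that contains the right leaf. -/
  def CTree.unpaintedPart {c : Color} : CTree true c → CTree false c
    | .node _ ts => ts.unpaintedPart
    | .half ts => ts.lastTree
  /-- The unpainted subtree of the last tree. -/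
  def CForest.unpaintedPart {c : Color} : CForest true c → CTree false c
    | .last t => t.unpaintedPart
    | .cons _ ts => ts.unpaintedPart
end

/-- Replace the last tree of a sequence by a leaf. -/
def CForest.cutLast {c : Color} : CForest false c → CForest false c
  | .last _ => .last .leaf
  | .cons t ts => .cons t ts.cutLast

mutual
  /-- The tree `T \ T'` with the painting forgotten: `T'` is replaced by a leaf. -/
  def CTree.complement {c : Color} : CTree true c → CTree false c
    | .node t ts => .node t.forget ts.complement
    | .half (.last _) => .leaf
    | .half (.cons t ts) => .node t ts.cutLast
  /-- The same for the last tree of a sequence. -/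
  def CForest.complement {c : Color} : CForest true c → CForest false c
    | .last t => .last t.complement
    | .cons t ts => .cons t.forget ts.complement
end

mutual
  /-- The forest of an unpainted binary tree. On the path from the root to the right leaf, every
  branch `t` that is met gives a tree with one branch, which has as many leaves as `t`; these
  trees are arranged from left to right, the one next to the right leaf being the rightmost. On a
  general tree, every vertex of the path gives one tree, with one branch for each input off the
  path. -/
  def CTree.toForest {c : Color} : CTree false c → List (List ℕ)
    | .leaf => []
    | .node t ts => (t.leaves :: ts.branchLeaves) :: ts.toForest
  /-- The forest of the last tree of a sequence. -/
  def CForest.toForest {c : Color} : CForest false c → List (List ℕ)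
    | .last t => t.toForest
    | .cons _ ts => ts.toForest
  /-- The numbers of leaves of all trees of a sequence except the last. -/
  def CForest.branchLeaves {c : Color} : CForest false c → List ℕ
    | .last _ => []
    | .cons t ts => t.leaves :: ts.branchLeaves
end

/-- The triple `(F, 1, G)` of a painted binary tree `T`: `G` is formed from the unpainted subtree
`T'` that contains the right leaf, `F` from `T \ T'`. -/
def vertexTriple (t : CTree true .m) : Triple where
  left := t.complement.toForest
  mid := []
  right := t.unpaintedPart.toForest

/-- `π` is the map of faces determined by the projection on vertices: it sends a vertex, that is, a
painted binary tree, to the face labelled by its triple `(F, 1, G)`, and it sends any face `σ` to the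
smallest face that contains the images of all vertices of `σ`. -/
structure IsProjection {n : ℕ} (π : Multiplihedron (n + 1) → Freehedron n) : Prop where
  vertex : ∀ v : Multiplihedron (n + 1), FaceSystem.dim v = 0 →
    (π v).toTriple = vertexTriple v.1
  contains : ∀ v σ : Multiplihedron (n + 1), FaceSystem.dim v = 0 → IsFaceOf v σ →
    IsFaceOf (π v) (π σ)
  smallest : ∀ (σ : Multiplihedron (n + 1)) (τ : Freehedron n),
    (∀ v : Multiplihedron (n + 1), FaceSystem.dim v = 0 → IsFaceOf v σ → IsFaceOf (π v) τ) →
      IsFaceOf (π σ) τ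

end

/-!
Everything rests on the *spine* of a painted tree, the path from the root to the right leaf: all
inputs off this path have colour `a`, and the spine `t.spine : Spine p` remembers only how many
leaves they have. The dimension of a tree is the dimension of its spine plus the total dimension
`t.offDim` of the inputs off the path (`CTree.dim_eq_spine`).

**The quotient `T`.** The reduction `redT` sends a tree to its spine if `offDim` vanishes and to
zero otherwise. It intertwines the differential with an explicit differential `Spine.DL`
(`redT_dL`): an input of dimension one has two boundary faces, which have the same number of leaves
and opposite signs. The kernels of `redT` and of its analogue in colour `a` form a DG sub-bimodule
that kills the relations (`redKer`), hence `relT k .m ≤ ker redT` (`relT_le_ker_redT`). Conversely,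
`μ_2^a` is associative and commutes with `f_1^a` modulo the relations, because of `d μ_3^a` and
`d f_2^a`; so every tree is congruent to zero or to the standard tree `Spine.toTree` of its spine
(`sub_toTree_redT_mem`). This gives `relT_eq_ker_redT`, and the component `T(a^n, m; m)` has the
spines with `n + 1` leaves as a basis.

**Orientations.** After conjugation with a sign, the differential of a tree becomes a bar
differential `CTree.barD` whose square is zero by coassociativity of deconcatenation. All its terms
are different, and they are the trees that can be contracted to the given one
(`CTree.isSignedIndicator_d`). So the differential of `M_∞` is an orientation of the multiplihedron.
For the freehedron, spines are nice expressions in another notation (`faceEquiv`,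
`Freehedron.toTree_toTriple`), face moves are the terms of `Spine.D` (`Spine.isSignedIndicator_D`,
`facet_faceEquiv`), and `Spine.DL` gives an orientation.

**The projection.** `proj` sends a tree to the face of its spine. A contraction of trees gives a
face relation between the spines (`Contract.isFace`), and every face of the spine of a tree is the
spine of a face of the tree (`CTree.exists_contract_of_isFace`). In terms of expressions, being a
face means that there are fewer elements and more breaks and that the distinguished stretch is
smaller. All of this is visible on the vertices (`Spine.isFace_of_vertices`), so that a face of the
freehedron is the smallest one containing its vertices, and `proj` is the projection.

**Cellular chains.** The induced map is `redT` read in the two cellular complexes. It is the only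
one (`IsInducedMap.eq`): by induction on the dimension of a cell `σ`, the difference of two such
maps on `σ` is a cycle and a multiple of the single cell `π σ`, and a cell of positive dimension has
a facet, so that the multiple is zero.
-/

noncomputable section

/-! ### Linear algebra of free modules -/

theorem neg_one_pow_congr_even {k : Type*} [CommRing k] {a b : ℕ} (h : Even a ↔ Even b) :
    (-1 : k) ^ a = (-1) ^ b := by
  by_cases ha : Even a
  · rw [ha.neg_one_pow, (h.1 ha).neg_one_pow]
  · rw [(Nat.not_even_iff_odd.1 ha).neg_one_pow,
      (Nat.not_even_iff_odd.1 (fun hb => ha (h.2 hb))).neg_one_pow]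

theorem even_iff_of_natCast_eq {a b : ℕ} (h : (a : ZMod 2) = b) : Even a ↔ Even b := by
  rw [← ZMod.natCast_eq_zero_iff_even, ← ZMod.natCast_eq_zero_iff_even, h]

theorem natCast_eq_of_even_iff {a b : ℕ} (h : Even a ↔ Even b) : (a : ZMod 2) = b := by
  rw [ZMod.natCast_eq_natCast_iff']
  simp only [Nat.even_iff] at h
  omega

theorem LinearMap.eq_of_mem_supported {k X M : Type*} [CommRing k] [AddCommGroup M] [Module k M]
    {s : Set X} {f g : (X →₀ k) →ₗ[k] M}
    (h : ∀ x ∈ s, f (Finsupp.single x 1) = g (Finsupp.single x 1)) {v : X →₀ k}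
    (hv : v ∈ Finsupp.supported k k s) : f v = g v := by
  rw [Finsupp.supported_eq_span_single] at hv
  refine LinearMap.eqOn_span (f := f) (g := g) ?_ hv
  rintro _ ⟨x, hx, rfl⟩
  exact h x hx

/-- Conjugation by the signs `(-1) ^ e x` on basis vectors. -/
def signTwist {k X : Type*} [CommRing k] (e : X → ℕ) : (X →₀ k) →ₗ[k] (X →₀ k) :=
  Finsupp.linearCombination k fun x => Finsupp.single x ((-1) ^ e x)

@[simp] theorem signTwist_single {k X : Type*} [CommRing k] (e : X → ℕ) (x : X) (a : k) :
    signTwist e (Finsupp.single x a) = (-1 : k) ^ e x • Finsupp.single x a := by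
  simp [signTwist, mul_comm, -Finsupp.single_mul]

theorem LinearMap.ext_single_one {k X M : Type*} [CommRing k] [AddCommGroup M] [Module k M]
    {f g : (X →₀ k) →ₗ[k] M}
    (h : ∀ x, f (Finsupp.single x 1) = g (Finsupp.single x 1)) : f = g :=
  Finsupp.lhom_ext' fun x => LinearMap.ext_ring (h x)

theorem neg_one_pow_mul_self {k : Type*} [CommRing k] (n : ℕ) : (-1 : k) ^ n * (-1) ^ n = 1 := by
  rw [← pow_add]; exact Even.neg_one_pow ⟨n, rfl⟩

theorem signTwist_apply {k X : Type*} [CommRing k] (e : X → ℕ) (v : X →₀ k) (x : X) :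
    signTwist e v x = (-1) ^ e x * v x := by
  classical
  induction v using Finsupp.induction_linear with
  | zero => simp
  | add f g hf hg => simp [hf, hg, mul_add]
  | single y a =>
    by_cases h : y = x
    · subst h; simp
    · simp [h]

theorem signTwist_signTwist {k X : Type*} [CommRing k] (e : X → ℕ) (v : X →₀ k) :
    signTwist e (signTwist e v) = v := by
  ext x
  rw [signTwist_apply, signTwist_apply, ← mul_assoc, neg_one_pow_mul_self, one_mul]

theorem signTwist_mapDomain {k X Y : Type*} [CommRing k] (f : X → Y) (e₁ : X → ℕ) (e₂ : Y → ℕ)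
    (C : ℕ) {s : Set X} (h : ∀ x ∈ s, (Even (e₂ (f x)) ↔ Even (e₁ x + C))) {v : X →₀ k}
    (hv : v ∈ Finsupp.supported k k s) :
    signTwist e₂ (v.mapDomain f) = (-1 : k) ^ C • (signTwist e₁ v).mapDomain f := by
  refine LinearMap.eq_of_mem_supported
    (f := (signTwist e₂).comp (Finsupp.lmapDomain k k f))
    (g := (-1 : k) ^ C • (Finsupp.lmapDomain k k f).comp (signTwist e₁)) (fun x hx => ?_) hv
  simp [Finsupp.mapDomain_single, ← pow_add, neg_one_pow_congr_even (k := k) (h x hx),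
    add_comm]

/-- The bilinear map with prescribed values on pairs of basis vectors. -/
def bilin {k X Y M : Type*} [CommRing k] [AddCommGroup M] [Module k M] (f : X → Y → M) :
    (X →₀ k) →ₗ[k] (Y →₀ k) →ₗ[k] M :=
  Finsupp.linearCombination k fun x => Finsupp.linearCombination k (f x)

@[simp] theorem bilin_single {k X Y M : Type*} [CommRing k] [AddCommGroup M] [Module k M]
    (f : X → Y → M) (x : X) (y : Y) (a b : k) :
    bilin f (Finsupp.single x a) (Finsupp.single y b) = a • b • f x y := by
  simp [bilin]

/-! ### Lengths, dimensions and leaves of words -/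

/-- The concatenation of a sequence of blocks. -/
def CForest.flat {p : Bool} {c : Color} (bs : List (CForest p .a)) (b : CForest p c) :
    CForest p c :=
  bs.foldr CForest.append b

namespace CForest

theorem length_pos {p : Bool} {c : Color} (w : CForest p c) : 0 < w.length := by
  cases w <;> simp [length]

theorem length_append {p : Bool} {c : Color} :
    (x : CForest p .a) → (y : CForest p c) → (x.append y).length = x.length + y.length
  | .last t, y => by simp [append, length]; omega
  | .cons t ts, y => by simp [append, length, length_append ts y]; omega

theorem dim_append {p : Bool} {c : Color} :
    (x : CForest p .a) → (y : CForest p c) → (x.append y).dim = x.dim + y.dim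
  | .last t, y => by simp [append, dim]
  | .cons t ts, y => by simp [append, dim, dim_append ts y]; omega

theorem leaves_append {p : Bool} {c : Color} :
    (x : CForest p .a) → (y : CForest p c) → (x.append y).leaves = x.leaves + y.leaves
  | .last t, y => by simp [append, leaves]
  | .cons t ts, y => by simp [append, leaves, leaves_append ts y]; omega

theorem mem_splits {p : Bool} {c : Color} :
    (w : CForest p c) → {y : CForest p .a × CForest p c} →
      (y ∈ w.splits ↔ y.1.append y.2 = w)
  | .last t, (.last u, y) => by simp [splits, append]
  | .last t, (.cons u us, y) => by simp [splits, append]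
  | .cons t ts, (.last u, y) => by
      simp [splits, append, Prod.ext_iff]
  | .cons t ts, (.cons u us, y) => by
      have := mem_splits ts (y := (us, y))
      simp [splits, append, Prod.ext_iff] at this ⊢
      grind

end CForest

mutual
  /-- The exponent of the sign between a prefix ordered composite and the corresponding element of
  the bar construction, in which the differential has no signs but those of the Koszul rule. -/
  def CTree.eps {p : Bool} {c : Color} : CTree p c → ℕ
    | .leaf => 0
    | .node t ts => t.eps + ts.eps + ts.length * t.dim
    | .half ts => ts.eps
  /-- The same for words. -/
  def CForest.eps {p : Bool} {c : Color} : CForest p c → ℕ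
    | .last t => t.eps
    | .cons t ts => t.eps + ts.eps + ts.length * t.dim
end

namespace CForest

theorem eps_append {p : Bool} {c : Color} :
    (x : CForest p .a) → (y : CForest p c) →
      (x.append y).eps = x.eps + y.eps + y.length * x.dim
  | .last t, y => by simp [append, eps, dim]
  | .cons t ts, y => by
      simp [append, eps, eps_append ts y, length_append, dim]; ring

/-- What it means to be obtained by merging `s` consecutive trees. -/
theorem merges_spec {p : Bool} {c : Color} :
    (w : CForest p c) → ∀ y ∈ w.merges, y.1 + y.2.2.length = w.length + 1 ∧ 2 ≤ y.1 ∧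
      y.2.2.dim + 2 = w.dim + y.1 ∧ y.2.2.leaves = w.leaves
  | .last t => by simp [merges]
  | .cons t ts => by
      intro y hy
      simp only [merges, List.mem_cons, List.mem_append, List.mem_map] at hy
      have hpos := length_pos ts
      rcases hy with rfl | ⟨z, hz, rfl⟩ | ⟨z, hz, rfl⟩
      · simp [length, dim, leaves, CTree.dim, CTree.leaves]; omega
      · rw [mem_splits] at hz
        subst hz
        have := length_pos z.1
        simp [length, dim, leaves, CTree.dim, CTree.leaves, length_append, dim_append,
          leaves_append]
        omega
      · have := merges_spec ts z hz
        simp [length, dim, leaves]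
        omega

theorem flat_cons {p : Bool} {c : Color} (x : CForest p .a) (bs : List (CForest p .a))
    (b : CForest p c) : flat (x :: bs) b = x.append (flat bs b) := rfl

theorem flat_nil {p : Bool} {c : Color} (b : CForest p c) : flat [] b = b := rfl

theorem mem_blocks {p : Bool} {c : Color} :
    (w : CForest p c) → {y : List (CForest p .a) × CForest p c} →
      (y ∈ w.blocks ↔ flat y.1 y.2 = w)
  | .last t, ([], y) => by simp [blocks, flat_nil]
  | .last t, (.last u :: bs, y) => by simp [blocks, flat_cons, append]
  | .last t, (.cons u us :: bs, y) => by simp [blocks, flat_cons, append]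
  | .cons t ts, ([], y) => by
      simp only [blocks, List.mem_flatMap, List.mem_cons, flat_nil, List.not_mem_nil, or_false,
        Prod.ext_iff]
      constructor
      · rintro ⟨⟨bs, z⟩, hz, h | h⟩
        · simp at h
        · cases bs with
          | nil =>
            have := (mem_blocks ts).1 hz
            simp only [flat_nil] at this
            simp only [this, true_and] at h
            exact h
          | cons x bs => simp at h
      · rintro rfl
        exact ⟨([], ts), (mem_blocks ts).2 rfl, .inr (by simp)⟩
  | .cons t ts, (.last u :: bs, y) => by
      simp only [blocks, List.mem_flatMap, List.mem_cons, List.not_mem_nil, or_false,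
        Prod.ext_iff, flat_cons, append, CForest.cons.injEq]
      constructor
      · rintro ⟨⟨bs', z⟩, hz, h | h⟩
        · have := (mem_blocks ts).1 hz
          simp_all
        · cases bs' <;> simp at h
      · rintro ⟨rfl, h⟩
        exact ⟨(bs, y), (mem_blocks ts).2 h, .inl (by simp)⟩
  | .cons t ts, (.cons u us :: bs, y) => by
      simp only [blocks, List.mem_flatMap, List.mem_cons, List.not_mem_nil, or_false,
        Prod.ext_iff, flat_cons, append, CForest.cons.injEq]
      constructor
      · rintro ⟨⟨bs', z⟩, hz, h | h⟩
        · simp at h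
        · have := (mem_blocks ts).1 hz
          cases bs' <;> simp_all [flat_cons]
      · rintro ⟨rfl, h⟩
        exact ⟨(us :: bs, y), (mem_blocks ts).2 h, .inr (by simp)⟩

end CForest

theorem paintBlocks_cons {c : Color} (x : CForest false .a) (bs : List (CForest false .a))
    (b : CForest false c) :
    paintBlocks (x :: bs) b = .cons (.half x) (paintBlocks bs b) := rfl

theorem paintBlocks_nil {c : Color} (b : CForest false c) :
    paintBlocks [] b = .last (.half b) := rfl

theorem length_paintBlocks {c : Color} (bs : List (CForest false .a)) (b : CForest false c) :
    (paintBlocks bs b).length = bs.length + 1 := by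
  induction bs with
  | nil => rfl
  | cons x bs ih => simp [paintBlocks_cons, CForest.length, ih]

theorem leaves_paintBlocks {c : Color} (bs : List (CForest false .a)) (b : CForest false c) :
    (paintBlocks bs b).leaves = (CForest.flat bs b).leaves := by
  induction bs with
  | nil => simp [paintBlocks_nil, CForest.flat_nil, CForest.leaves, CTree.leaves]
  | cons x bs ih =>
    simp [paintBlocks_cons, CForest.leaves, CTree.leaves, ih, CForest.flat_cons,
      CForest.leaves_append]

theorem length_flat {c : Color} (bs : List (CForest false .a)) (b : CForest false c) :
    (CForest.flat bs b).length = (bs.map fun y => y.length - 1).sum + (b.length - 1) +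
      (bs.length + 1) := by
  induction bs with
  | nil => have := b.length_pos; simp [CForest.flat_nil]; omega
  | cons x bs ih =>
    have := x.length_pos
    simp [CForest.flat_cons, CForest.length_append, ih]
    omega

theorem dim_paintBlocks {c : Color} (bs : List (CForest false .a)) (b : CForest false c) :
    (paintBlocks bs b).dim + (bs.length + 1) =
      (CForest.flat bs b).dim + (CForest.flat bs b).length := by
  induction bs with
  | nil =>
    have := b.length_pos
    simp [paintBlocks_nil, CForest.flat_nil, CForest.dim, CTree.dim]
    omega
  | cons x bs ih =>
    have := x.length_pos
    simp [paintBlocks_cons, CForest.dim, CTree.dim, CForest.flat_cons,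
      CForest.dim_append, CForest.length_append]
    omega

/-- The sign in `f ↦ μ(f, …, f)` becomes trivial in the bar construction. -/
theorem even_blocksSign {c : Color} (bs : List (CForest false .a)) (b : CForest false c) :
    Even (blocksSign bs b + (CForest.flat bs b).eps) ↔ Even (paintBlocks bs b).eps := by
  induction bs with
  | nil => simp [blocksSign, paintBlocks_nil, CForest.flat_nil, CForest.eps, CTree.eps]
  | cons x bs ih =>
    obtain ⟨l, hl⟩ := Nat.exists_eq_succ_of_ne_zero x.length_pos.ne'
    simp only [blocksSign, paintBlocks_cons, CForest.flat_cons, CForest.eps, CTree.eps,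
      CForest.eps_append, length_flat, hl, CTree.dim, length_paintBlocks, Nat.succ_sub_one]
    generalize (bs.map fun y => y.length - 1).sum + (b.length - 1) = m
    have h₂ : (2 : ZMod 2) = 0 := rfl
    have ih' := natCast_eq_of_even_iff ih
    apply even_iff_of_natCast_eq
    push_cast at ih' ⊢
    linear_combination ih' + (x.dim * m : ZMod 2) * h₂

/-! ### The differential in bar form -/

section

variable {k : Type*} [CommRing k]

/-- Linear extension of `μ_r(t_1, …, t_r)`, zero on words of length one. -/
def joinL {p : Bool} {c : Color} : CTensor k p c →ₗ[k] CMod k p c :=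
  Finsupp.linearCombination k (CForest.join k)

/-- Linear extension of `f_r(t_1, …, t_r)`. -/
def halfL {c : Color} : CTensor k false c →ₗ[k] CMod k true c :=
  Finsupp.lmapDomain k k CTree.half

/-- Bilinear extension of adding a letter to a word. -/
def consL {p : Bool} {c : Color} : CMod k p .a →ₗ[k] CTensor k p c →ₗ[k] CTensor k p c :=
  bilin fun t ts => Finsupp.single (.cons t ts) 1

/-- Words of length one. -/
def lastL {p : Bool} {c : Color} : CMod k p c →ₗ[k] CTensor k p c :=
  Finsupp.lmapDomain k k CForest.last

@[simp] theorem joinL_single {p : Bool} {c : Color} (w : CForest p c) (a : k) :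
    joinL (Finsupp.single w a) = a • w.join k := by simp [joinL]

@[simp] theorem halfL_single {c : Color} (w : CForest false c) (a : k) :
    halfL (Finsupp.single w a) = Finsupp.single (.half w) a := by
  simp [halfL, Finsupp.mapDomain_single]

@[simp] theorem lastL_single {p : Bool} {c : Color} (t : CTree p c) (a : k) :
    lastL (Finsupp.single t a) = Finsupp.single (.last t) a := by
  simp [lastL, Finsupp.mapDomain_single]

@[simp] theorem consL_single {p : Bool} {c : Color} (t : CTree p .a) (ts : CForest p c) (a b : k) :
    consL (Finsupp.single t a) (Finsupp.single ts b) = a • b • Finsupp.single (.cons t ts) 1 := by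
  simp [consL]

theorem mapDomain_cons_left {p : Bool} {c : Color} (ts : CForest p c) (x : CMod k p .a) :
    x.mapDomain (fun t => CForest.cons t ts) = consL x (Finsupp.single ts 1) := by
  refine LinearMap.congr_fun (f := Finsupp.lmapDomain k k fun t => CForest.cons t ts)
    (g := consL.flip (Finsupp.single ts 1)) (LinearMap.ext_single_one fun t => ?_) x
  simp [Finsupp.mapDomain_single]

theorem mapDomain_cons_right {p : Bool} {c : Color} (t : CTree p .a) (x : CTensor k p c) :
    x.mapDomain (fun ts => CForest.cons t ts) = consL (Finsupp.single t 1) x := by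
  refine LinearMap.congr_fun (f := Finsupp.lmapDomain k k fun ts => CForest.cons t ts)
    (g := consL (Finsupp.single t 1)) (LinearMap.ext_single_one fun ts => ?_) x
  simp [Finsupp.mapDomain_single]

theorem mapDomain_half {c : Color} (x : CTensor k false c) :
    x.mapDomain CTree.half = halfL x := rfl

theorem signTwist_joinL {p : Bool} {c : Color} (x : CTensor k p c) :
    signTwist CTree.eps (joinL x) = joinL (signTwist CForest.eps x) := by
  refine LinearMap.congr_fun (f := (signTwist CTree.eps).comp joinL)
    (g := joinL.comp (signTwist CForest.eps)) (LinearMap.ext_single_one fun w => ?_) x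
  cases w <;> simp [CForest.join, CTree.eps, CForest.eps]

theorem signTwist_halfL {c : Color} (x : CTensor k false c) :
    signTwist CTree.eps (halfL x) = halfL (signTwist CForest.eps x) := by
  refine LinearMap.congr_fun (f := (signTwist CTree.eps).comp halfL)
    (g := halfL.comp (signTwist CForest.eps)) (LinearMap.ext_single_one fun w => ?_) x
  simp [CTree.eps]

/-- The signed sum of all mergings of a word. -/
def CForest.mergeSum (k : Type*) [CommRing k] {p : Bool} {c : Color} (w : CForest p c) :
    CTensor k p c :=
  (w.merges.map fun y => Finsupp.single y.2.2 ((-1) ^ y.2.1)).sum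

/-- The signed sum of all paintings of a word. -/
def CForest.paintSum (k : Type*) [CommRing k] {c : Color} (w : CForest false c) :
    CTensor k true c :=
  (w.blocks.map fun y => Finsupp.single (paintBlocks y.1 y.2) ((-1) ^ blocksSign y.1 y.2)).sum

theorem CForest.d_eq_mergeSum_node {p : Bool} {c : Color} (t : CTree p .a) (ts : CForest p c) :
    (CTree.node t ts).d k = - joinL ((CForest.cons t ts).mergeSum k)
      + (-1 : k) ^ (ts.length + 1) • joinL ((CForest.cons t ts).d k) := by
  have h1 : ∀ x : CMod k p .a, x.mapDomain (fun t' => CTree.node t' ts) =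
      joinL (x.mapDomain (fun t => CForest.cons t ts)) := by
    intro x
    refine LinearMap.congr_fun (f := Finsupp.lmapDomain k k fun t => CTree.node t ts)
      (g := joinL.comp (Finsupp.lmapDomain k k fun t => CForest.cons t ts))
      (LinearMap.ext_single_one fun t => ?_) x
    simp [Finsupp.mapDomain_single, CForest.join]
  have h2 : ∀ x : CTensor k p c, x.mapDomain (fun ts' => CTree.node t ts') =
      joinL (x.mapDomain (fun ts => CForest.cons t ts)) := by
    intro x
    refine LinearMap.congr_fun (f := Finsupp.lmapDomain k k fun ts => CTree.node t ts)
      (g := joinL.comp (Finsupp.lmapDomain k k fun ts => CForest.cons t ts))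
      (LinearMap.ext_single_one fun t => ?_) x
    simp [Finsupp.mapDomain_single, CForest.join]
  rw [CTree.d, CForest.d, h1, h2, CForest.mergeSum, map_list_sum, List.map_map, map_add, map_smul]
  simp [Function.comp_def]

theorem CForest.d_eq_mergeSum_half {c : Color} (ts : CForest false c) :
    (CTree.half ts).d k = halfL (ts.mergeSum k) - joinL (ts.paintSum k)
      + (-1 : k) ^ (ts.length - 1) • halfL (ts.d k) := by
  rw [CTree.d, CForest.mergeSum, CForest.paintSum, map_list_sum, map_list_sum, List.map_map,
    List.map_map, mapDomain_half]
  simp [Function.comp_def]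

/-! #### Homogeneity -/

theorem joinL_mem {p : Bool} {c : Color} {x : CTensor k p c} {m l : ℕ}
    (hx : x ∈ Finsupp.supported k k
      {w : CForest p c | w.dim + w.length = m + 2 ∧ w.leaves = l}) :
    joinL x ∈ Finsupp.supported k k {t : CTree p c | t.dim = m ∧ t.leaves = l} := by
  rw [Finsupp.supported_eq_span_single] at hx
  induction hx using Submodule.span_induction with
  | mem y hy =>
    obtain ⟨w, ⟨h1, h2⟩, rfl⟩ := hy
    cases w with
    | last t => simp [CForest.join]
    | cons t ts =>
      have := ts.length_pos
      simp only [joinL_single, CForest.join, one_smul]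
      refine Finsupp.single_mem_supported _ _ ⟨?_, ?_⟩
      · simp [CForest.dim, CForest.length, CTree.dim] at h1 ⊢; omega
      · simpa [CForest.leaves, CTree.leaves] using h2
  | zero => simp
  | add y z _ _ hy hz => rw [map_add]; exact add_mem hy hz
  | smul a y _ hy => rw [map_smul]; exact Submodule.smul_mem _ _ hy

theorem mapDomain_mem_supported {X Y : Type*} {f : X → Y} {s : Set X} {t : Set Y}
    (h : ∀ x ∈ s, f x ∈ t) {v : X →₀ k} (hv : v ∈ Finsupp.supported k k s) :
    v.mapDomain f ∈ Finsupp.supported k k t := by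
  rw [Finsupp.supported_eq_span_single] at hv
  induction hv using Submodule.span_induction with
  | mem y hy =>
    obtain ⟨w, hw, rfl⟩ := hy
    rw [Finsupp.mapDomain_single]
    exact Finsupp.single_mem_supported _ _ (h w hw)
  | zero => simp
  | add y z _ _ hy hz => rw [Finsupp.mapDomain_add]; exact add_mem hy hz
  | smul a y _ hy => rw [Finsupp.mapDomain_smul]; exact Submodule.smul_mem _ _ hy

theorem list_sum_mem_supported {X Y : Type*} {s : Set X} {l : List Y} {f : Y → (X →₀ k)}
    (h : ∀ y ∈ l, f y ∈ Finsupp.supported k k s) :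
    (l.map f).sum ∈ Finsupp.supported k k s := by
  induction l with
  | nil => simp
  | cons y l ih =>
    simp only [List.map_cons, List.sum_cons]
    exact add_mem (h y (by simp)) (ih fun z hz => h z (by simp [hz]))

theorem mergeSum_mem {p : Bool} {c : Color} (w : CForest p c) :
    w.mergeSum k ∈ Finsupp.supported k k
      {v : CForest p c | v.dim + v.length + 1 = w.dim + w.length ∧ v.leaves = w.leaves} := by
  refine list_sum_mem_supported fun y hy => Finsupp.single_mem_supported _ _ ?_
  have := w.merges_spec y hy
  constructor
  · omega
  · exact this.2.2.2

mutual
  /-- The differential lowers the dimension by one and keeps the number of leaves. -/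
  theorem CTree.d_mem (k : Type*) [CommRing k] {p : Bool} {c : Color} : (t : CTree p c) →
      t.d k ∈ Finsupp.supported k k {u : CTree p c | u.dim + 1 = t.dim ∧ u.leaves = t.leaves}
    | .leaf => by rw [CTree.d]; exact zero_mem _
    | .node t ts => by
      have hd : (CForest.cons t ts).d k ∈ Finsupp.supported k k {u : CForest p c |
          u.dim + 1 = (CForest.cons t ts).dim ∧ u.length = (CForest.cons t ts).length ∧
          u.leaves = (CForest.cons t ts).leaves} := by
        rw [CForest.d]
        refine add_mem ?_ (Submodule.smul_mem _ _ ?_)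
        · refine mapDomain_mem_supported ?_ (CTree.d_mem k t)
          rintro u ⟨h1, h2⟩
          simp [CForest.dim, CForest.length, CForest.leaves]; omega
        · refine mapDomain_mem_supported ?_ (CForest.d_mem k ts)
          rintro u ⟨h1, h2, h3⟩
          simp [CForest.dim, CForest.length, CForest.leaves]; omega
      have hpos := ts.length_pos
      by_cases hdim : (CTree.node t ts).dim = 0
      · have h0 : ts.length = 1 ∧ t.dim = 0 ∧ ts.dim = 0 := by
          simp [CTree.dim] at hdim; omega
        have hm : ∀ y ∈ (CForest.cons t ts).merges, y.2.2.join k = 0 := by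
          intro y hy
          have h1 := (CForest.cons t ts).merges_spec y hy
          have h2 := y.2.2.length_pos
          generalize y.2.2 = w at h1 h2 ⊢
          cases w with
          | last u => rfl
          | cons u us =>
            have := us.length_pos
            simp [CForest.length] at h1; omega
        have hd0 : (CForest.cons t ts).d k = 0 := by
          ext u
          by_contra hu
          have := ((Finsupp.mem_supported _ _).1 hd) (Finsupp.mem_support_iff.2 hu)
          simp [CForest.dim] at this; omega
        rw [CForest.d_eq_mergeSum_node, hd0, CForest.mergeSum, map_list_sum, List.map_map]
        rw [List.sum_eq_zero]
        · simp
        · intro z hz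
          obtain ⟨y, hy, rfl⟩ := List.mem_map.1 hz
          simp [hm y hy]
      · rw [CForest.d_eq_mergeSum_node]
        have key : ∀ x : CTensor k p c, x ∈ Finsupp.supported k k {u : CForest p c |
            u.dim + u.length + 1 = (CForest.cons t ts).dim + (CForest.cons t ts).length ∧
              u.leaves = (CForest.cons t ts).leaves} →
            joinL x ∈ Finsupp.supported k k {u : CTree p c |
              u.dim + 1 = (CTree.node t ts).dim ∧ u.leaves = (CTree.node t ts).leaves} := by
          intro x hx
          refine Finsupp.supported_mono ?_ (joinL_mem (m := (CTree.node t ts).dim - 1)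
            (l := (CTree.node t ts).leaves) (Finsupp.supported_mono ?_ hx))
          · rintro u ⟨h1, h2⟩
            exact ⟨by omega, h2⟩
          · rintro u ⟨h1, h2⟩
            refine ⟨?_, by simpa [CForest.leaves, CTree.leaves] using h2⟩
            simp [CForest.dim, CForest.length, CTree.dim] at h1 hdim ⊢
            omega
        refine add_mem (neg_mem (key _ (mergeSum_mem _))) (Submodule.smul_mem _ _ (key _ ?_))
        refine Finsupp.supported_mono ?_ hd
        rintro u ⟨h1, h2, h3⟩
        exact ⟨by omega, h3⟩
    | .half ts => by
      have hpos := ts.length_pos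
      have key : ∀ x : CTensor k false c, x ∈ Finsupp.supported k k {u : CForest false c |
          u.dim + u.length + 1 = ts.dim + ts.length ∧ u.leaves = ts.leaves} →
          halfL x ∈ Finsupp.supported k k {u : CTree true c |
            u.dim + 1 = (CTree.half ts).dim ∧ u.leaves = (CTree.half ts).leaves} := by
        intro x hx
        refine mapDomain_mem_supported ?_ hx
        rintro u ⟨h1, h2⟩
        have := u.length_pos
        refine ⟨?_, by simpa [CTree.leaves] using h2⟩
        simp [CTree.dim]
        omega
      rw [CForest.d_eq_mergeSum_half]
      refine add_mem (sub_mem (key _ (mergeSum_mem _)) ?_) (Submodule.smul_mem _ _ (key _ ?_))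
      · rw [CForest.paintSum, map_list_sum, List.map_map]
        refine list_sum_mem_supported fun y hy => ?_
        have h1 := length_paintBlocks y.1 y.2
        have h2 := dim_paintBlocks y.1 y.2
        have h3 := leaves_paintBlocks y.1 y.2
        rw [(CForest.mem_blocks ts).1 hy] at h2 h3
        simp only [Function.comp_apply, joinL_single]
        refine Submodule.smul_mem _ _ ?_
        generalize paintBlocks y.1 y.2 = w at h1 h2 h3 ⊢
        cases w with
        | last u => exact zero_mem _
        | cons u us =>
          have := us.length_pos
          refine Finsupp.single_mem_supported _ _ ⟨?_, ?_⟩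
          · simp [CForest.length, CForest.dim, CTree.dim] at h1 h2 ⊢; omega
          · simpa [CForest.leaves, CTree.leaves] using h3
      · refine Finsupp.supported_mono ?_ (CForest.d_mem k ts)
        rintro u ⟨h1, h2, h3⟩
        exact ⟨by omega, h3⟩
  theorem CForest.d_mem (k : Type*) [CommRing k] {p : Bool} {c : Color} : (w : CForest p c) →
      w.d k ∈ Finsupp.supported k k
        {u : CForest p c | u.dim + 1 = w.dim ∧ u.length = w.length ∧ u.leaves = w.leaves}
    | .last t => by
      rw [CForest.d]
      refine mapDomain_mem_supported ?_ (CTree.d_mem k t)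
      rintro u ⟨h1, h2⟩
      simp [CForest.dim, CForest.length, CForest.leaves]; omega
    | .cons t ts => by
      rw [CForest.d]
      refine add_mem ?_ (Submodule.smul_mem _ _ ?_)
      · refine mapDomain_mem_supported ?_ (CTree.d_mem k t)
        rintro u ⟨h1, h2⟩
        simp [CForest.dim, CForest.length, CForest.leaves]; omega
      · refine mapDomain_mem_supported ?_ (CForest.d_mem k ts)
        rintro u ⟨h1, h2, h3⟩
        simp [CForest.dim, CForest.length, CForest.leaves]; omega
end

end

section

variable {k : Type*} [CommRing k]

/-- The differential of a tree in bar form. -/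
def CTree.barD (k : Type*) [CommRing k] {p : Bool} {c : Color} (t : CTree p c) : CMod k p c :=
  (-1 : k) ^ t.eps • signTwist CTree.eps (t.d k)

/-- The part of the bar differential of a word that merges consecutive letters. -/
def CForest.barMerge (k : Type*) [CommRing k] {p : Bool} {c : Color} (w : CForest p c) :
    CTensor k p c :=
  (-1 : k) ^ w.eps • signTwist CForest.eps (w.mergeSum k)

/-- The part of the bar differential of a word that acts on its letters. -/
def CForest.barInner (k : Type*) [CommRing k] {p : Bool} {c : Color} (w : CForest p c) :
    CTensor k p c :=
  (-1 : k) ^ (w.eps + w.length + 1) • signTwist CForest.eps (w.d k)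

/-- The bar differential of a word: the coderivation whose components are the differential of
trees and the formation of a new vertex. -/
def CForest.barD (k : Type*) [CommRing k] {p : Bool} {c : Color} (w : CForest p c) :
    CTensor k p c :=
  w.barMerge k + w.barInner k

/-- The sum of all words `μ(t, y_1) · y_2` over the cuts `y_1 · y_2` of a word. -/
def CForest.nest (k : Type*) [CommRing k] {p : Bool} {c : Color} (t : CTree p .a)
    (w : CForest p c) : CTensor k p c :=
  (w.splits.map fun y => Finsupp.single (CForest.cons (.node t y.1) y.2) (1 : k)).sum

/-- The sum of all words `f(B_1) ⋯ f(B_r)`, over all cuts of a word into blocks. -/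
def CForest.paint (k : Type*) [CommRing k] {c : Color} (w : CForest false c) : CTensor k true c :=
  (w.blocks.map fun y => Finsupp.single (paintBlocks y.1 y.2) (1 : k)).sum

theorem CForest.barMerge_last {p : Bool} {c : Color} (t : CTree p c) :
    (CForest.last t).barMerge k = 0 := by
  simp [barMerge, mergeSum, merges]

theorem CForest.barInner_last {p : Bool} {c : Color} (t : CTree p c) :
    (CForest.last t).barInner k = lastL (t.barD k) := by
  rw [barInner, CForest.d, signTwist_mapDomain CForest.last CTree.eps CForest.eps 0
    (by simp [CForest.eps]) (CTree.d_mem k t), CTree.barD, map_smul, lastL]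
  simp [eps, length, pow_succ, Finsupp.lmapDomain_apply]

theorem CForest.barD_last {p : Bool} {c : Color} (t : CTree p c) :
    (CForest.last t).barD k = lastL (t.barD k) := by
  rw [barD, barMerge_last, barInner_last, zero_add]

theorem list_sum_map_congr {X M : Type*} [AddCommMonoid M] {l : List X} {f g : X → M}
    (h : ∀ x ∈ l, f x = g x) : (l.map f).sum = (l.map g).sum := by
  rw [List.map_congr_left h]

theorem CForest.barMerge_cons {p : Bool} {c : Color} (t : CTree p .a) (ts : CForest p c) :
    (CForest.cons t ts).barMerge k = lastL (Finsupp.single (.node t ts) 1) + nest k t ts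
      + (-1 : k) ^ (t.dim + 1) • consL (Finsupp.single t 1) (ts.barMerge k) := by
  have h₂ : (2 : ZMod 2) = 0 := rfl
  have e : ∀ w : CForest p c, w.barMerge k = (w.merges.map fun y =>
      (-1 : k) ^ (w.eps + y.2.1 + y.2.2.eps) • Finsupp.single y.2.2 1).sum := by
    intro w
    rw [barMerge, mergeSum, map_list_sum, List.smul_sum, List.map_map, List.map_map]
    refine list_sum_map_congr fun y hy => ?_
    rw [Function.comp_apply, Function.comp_apply, signTwist_single, smul_smul, ← pow_add,
      ← Finsupp.smul_single_one _ ((-1 : k) ^ y.2.1), smul_smul, ← pow_add,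
      neg_one_pow_congr_even (k := k)]
    apply even_iff_of_natCast_eq
    push_cast; ring
  rw [e, e, merges, List.map_cons, List.sum_cons, List.map_append, List.sum_append, List.map_map,
    List.map_map, map_list_sum, List.smul_sum, List.map_map, List.map_map, nest, ← add_assoc]
  congr 1
  · congr 1
    · simp only [lastL_single]
      rw [Even.neg_one_pow, one_smul]
      simp [eps, CTree.eps]
    · refine list_sum_map_congr fun y hy => ?_
      rw [mem_splits] at hy
      subst hy
      obtain ⟨l, hl⟩ := Nat.exists_eq_succ_of_ne_zero y.1.length_pos.ne'
      simp only [Function.comp_apply]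
      rw [Even.neg_one_pow, one_smul]
      rw [← ZMod.natCast_eq_zero_iff_even]
      simp only [eps, CTree.eps, eps_append, length_append, hl, CTree.dim, Nat.succ_sub_one]
      push_cast
      linear_combination (t.eps + y.1.eps + y.2.eps + l * t.dim + t.dim + y.2.length * t.dim +
        y.2.length * y.1.dim + l * y.2.length + y.2.length : ZMod 2) * h₂
  · refine list_sum_map_congr fun y hy => ?_
    simp only [Function.comp_apply, map_smul, consL_single, one_smul, smul_smul, ← pow_add]
    rw [neg_one_pow_congr_even (k := k)]
    have h1 := (ts.merges_spec y hy).1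
    have h1' := congrArg (Nat.cast (R := ZMod 2)) h1
    push_cast at h1'
    apply even_iff_of_natCast_eq
    simp only [eps]
    push_cast
    linear_combination (t.eps + ts.length * t.dim : ZMod 2) * h₂ + (t.dim : ZMod 2) * h1'

theorem CForest.barInner_cons {p : Bool} {c : Color} (t : CTree p .a) (ts : CForest p c) :
    (CForest.cons t ts).barInner k = consL (t.barD k) (Finsupp.single ts 1)
      + (-1 : k) ^ (t.dim + 1) • consL (Finsupp.single t 1) (ts.barInner k) := by
  have h₂ : (2 : ZMod 2) = 0 := rfl
  rw [barInner, CForest.d, map_add, map_smul,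
    signTwist_mapDomain (fun t => CForest.cons t ts) CTree.eps CForest.eps
      (ts.eps + ts.length * (t.dim + 1)) _ (CTree.d_mem k t),
    signTwist_mapDomain (fun ts => CForest.cons t ts) CForest.eps CForest.eps
      (t.eps + ts.length * t.dim) _ (CForest.d_mem k ts),
    mapDomain_cons_left, mapDomain_cons_right, CTree.barD, barInner]
  · simp only [map_smul, smul_add, smul_smul, ← pow_add, LinearMap.smul_apply]
    congr 2
    · apply neg_one_pow_congr_even
      apply even_iff_of_natCast_eq
      simp only [eps, length]
      push_cast
      linear_combination (ts.eps + ts.length * t.dim + ts.length + 1 : ZMod 2) * h₂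
    · apply neg_one_pow_congr_even
      apply even_iff_of_natCast_eq
      simp only [eps, length]
      push_cast
      linear_combination (t.eps + ts.length * t.dim : ZMod 2) * h₂
  · rintro u ⟨h1, h2, h3⟩
    apply even_iff_of_natCast_eq
    simp only [eps, h2]
    push_cast
    ring
  · rintro u ⟨h1, h2⟩
    apply even_iff_of_natCast_eq
    simp only [eps, ← h1]
    push_cast
    linear_combination (-(ts.length : ZMod 2)) * h₂

theorem CForest.barD_cons {p : Bool} {c : Color} (t : CTree p .a) (ts : CForest p c) :
    (CForest.cons t ts).barD k = consL (t.barD k) (Finsupp.single ts 1)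
      + (-1 : k) ^ (t.dim + 1) • consL (Finsupp.single t 1) (ts.barD k)
      + nest k t ts + lastL (Finsupp.single (.node t ts) 1) := by
  rw [barD, barMerge_cons, barInner_cons, barD, map_add, smul_add]
  abel

theorem CTree.barD_leaf {c : Color} : (CTree.leaf : CTree false c).barD k = 0 := by
  simp [barD, CTree.d]

/-- The differential of `μ(w)` is minus the sum of `μ` over the bar differential of `w`. -/
theorem CTree.barD_node {p : Bool} {c : Color} (t : CTree p .a) (ts : CForest p c) :
    (CTree.node t ts).barD k = - joinL ((CForest.cons t ts).barD k) := by
  rw [barD, CForest.d_eq_mergeSum_node, CForest.barD, CForest.barMerge, CForest.barInner]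
  simp only [map_add, map_neg, map_smul, signTwist_joinL, smul_add, smul_neg, smul_smul, ← pow_add]
  simp only [CTree.eps, CForest.eps, CForest.length, neg_add_rev, ← neg_smul]
  rw [add_comm]
  congr 2
  ring

theorem CForest.paint_eq {c : Color} (w : CForest false c) :
    w.paint k = (-1 : k) ^ w.eps • signTwist CForest.eps (w.paintSum k) := by
  rw [paint, paintSum, map_list_sum, List.smul_sum, List.map_map, List.map_map]
  refine list_sum_map_congr fun y hy => ?_
  have h₂ : (2 : ZMod 2) = 0 := rfl
  have h := natCast_eq_of_even_iff (even_blocksSign y.1 y.2)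
  rw [(mem_blocks w).1 hy] at h
  push_cast at h
  rw [Function.comp_apply, Function.comp_apply, signTwist_single,
    ← Finsupp.smul_single_one _ ((-1 : k) ^ _), smul_smul, smul_smul, ← pow_add, ← pow_add,
    Even.neg_one_pow, one_smul]
  rw [← ZMod.natCast_eq_zero_iff_even]
  push_cast
  linear_combination h + ((paintBlocks y.1 y.2).eps : ZMod 2) * h₂

/-- The differential of `f(w)`: `f` is a morphism of bar constructions. -/
theorem CTree.barD_half {c : Color} (w : CForest false c) :
    (CTree.half w).barD k = halfL (w.barD k) - joinL (w.paint k) := by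
  rw [barD, CForest.d_eq_mergeSum_half, CForest.barD, CForest.barMerge, CForest.barInner,
    CForest.paint_eq]
  simp only [map_add, map_sub, map_smul, signTwist_joinL, signTwist_halfL, smul_add, smul_sub,
    smul_smul, ← pow_add]
  simp only [CTree.eps]
  have : (-1 : k) ^ (w.eps + (w.length - 1)) = (-1) ^ (w.eps + w.length + 1) := by
    obtain ⟨l, hl⟩ := Nat.exists_eq_succ_of_ne_zero w.length_pos.ne'
    apply neg_one_pow_congr_even
    simp only [hl, Nat.succ_sub_one, Nat.succ_eq_add_one, Nat.even_add_one, Nat.even_add]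
    tauto
  rw [this]
  abel

end

/-! ### Deconcatenation and the square of the differential -/

/-- The sum of a function over all cuts of a word into two nonempty words. -/
def CForest.cut {M : Type*} [AddCommMonoid M] {p : Bool} {c : Color} (w : CForest p c)
    (f : CForest p .a → CForest p c → M) : M :=
  (w.splits.map fun y => f y.1 y.2).sum

namespace CForest

section

variable {M : Type*} [AddCommMonoid M] {p : Bool} {c : Color}

theorem cut_last (t : CTree p c) (f : CForest p .a → CForest p c → M) :
    (CForest.last t).cut f = 0 := by simp [cut, splits]

theorem cut_cons (t : CTree p .a) (ts : CForest p c) (f : CForest p .a → CForest p c → M) :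
    (CForest.cons t ts).cut f = f (.last t) ts + ts.cut fun a b => f (.cons t a) b := by
  simp [cut, splits, Function.comp_def]

theorem cut_congr {w : CForest p c} {f g : CForest p .a → CForest p c → M}
    (h : ∀ a b, a.append b = w → f a b = g a b) : w.cut f = w.cut g :=
  list_sum_map_congr fun _ hy => h _ _ ((mem_splits w).1 hy)

theorem cut_add (w : CForest p c) (f g : CForest p .a → CForest p c → M) :
    (w.cut fun a b => f a b + g a b) = w.cut f + w.cut g := by
  simp [cut, List.sum_map_add]

theorem map_cut {M' : Type*} [AddCommMonoid M'] (φ : M →+ M') (w : CForest p c)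
    (f : CForest p .a → CForest p c → M) : φ (w.cut f) = w.cut fun a b => φ (f a b) := by
  simp [cut, map_list_sum, Function.comp_def]

/-- Deconcatenation is coassociative. -/
theorem cut_cut : (w : CForest p c) → (g : CForest p .a → CForest p .a → CForest p c → M) →
    (w.cut fun a b => b.cut fun x y => g a x y) = w.cut fun x y => x.cut fun a b => g a b y
  | .last t, g => by simp [cut_last]
  | .cons t ts, g => by
    simp only [cut_cons, cut_last, cut_add, zero_add, cut_cut ts fun a b c => g (.cons t a) b c]

theorem sum_blocks : (w : CForest p c) → (h : List (CForest p .a) × CForest p c → M) →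
    (w.blocks.map h).sum =
      h ([], w) + w.cut fun a b => (b.blocks.map fun y => h (a :: y.1, y.2)).sum
  | .last t, h => by simp [blocks, cut_last]
  | .cons t ts, h => by
    have e : ∀ (l : List (List (CForest p .a) × CForest p c))
        (f g : List (CForest p .a) × CForest p c → List (CForest p .a) × CForest p c),
        ((l.flatMap fun y => [f y, g y]).map h).sum = (l.map fun y => h (f y)).sum +
          (l.map fun y => h (g y)).sum := by
      intro l f g
      induction l with
      | nil => simp
      | cons y l ih => simp [ih]; abel
    rw [blocks, e, cut_cons]
    conv_lhs => arg 2; rw [sum_blocks ts]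
    abel

end

end CForest

section

variable {k : Type*} [CommRing k] {M : Type*} [AddCommGroup M] [Module k M] {p : Bool} {c : Color}

namespace CForest

theorem cut_smul (w : CForest p c) (s : k) (f : CForest p .a → CForest p c → M) :
    (w.cut fun a b => s • f a b) = s • w.cut f := by
  simp [cut, List.smul_sum, Function.comp_def]

theorem cut_neg (w : CForest p c) (f : CForest p .a → CForest p c → M) :
    (w.cut fun a b => - f a b) = - w.cut f := by
  simp [cut, List.sum_neg, Function.comp_def]

theorem cut_linearMap {M' : Type*} [AddCommGroup M'] [Module k M'] (φ : M →ₗ[k] M')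
    (w : CForest p c) (f : CForest p .a → CForest p c → M) :
    φ (w.cut f) = w.cut fun a b => φ (f a b) :=
  map_cut φ.toAddMonoidHom w f

end CForest

/-- The sum of a bilinear functional over all cuts of a word, as a linear map. -/
def cutL : (CTensor k p .a →ₗ[k] CTensor k p c →ₗ[k] M) →ₗ[k] CTensor k p c →ₗ[k] M :=
  LinearMap.flip (Finsupp.linearCombination k fun w : CForest p c =>
    w.cut fun a b => (LinearMap.applyₗ (Finsupp.single b 1)).comp
      (LinearMap.applyₗ (R := k) (M₂ := CTensor k p c →ₗ[k] M) (Finsupp.single a (1 : k))))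

theorem cutL_single (β : CTensor k p .a →ₗ[k] CTensor k p c →ₗ[k] M) (w : CForest p c) :
    cutL β (Finsupp.single w 1) =
      w.cut fun a b => β (Finsupp.single a 1) (Finsupp.single b 1) := by
  simp only [cutL, LinearMap.flip_apply, Finsupp.linearCombination_single, one_smul]
  exact CForest.map_cut (LinearMap.evalAddMonoidHom β) w _

theorem cutL_lastL (β : CTensor k p .a →ₗ[k] CTensor k p c →ₗ[k] M) (x : CMod k p c) :
    cutL β (lastL x) = 0 := by
  refine LinearMap.congr_fun (f := (cutL β).comp lastL) (g := 0)
    (LinearMap.ext_single_one fun t => ?_) x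
  simp [cutL_single, CForest.cut_last]

theorem cutL_consL_left (β : CTensor k p .a →ₗ[k] CTensor k p c →ₗ[k] M) (x : CMod k p .a)
    (w : CForest p c) :
    cutL β (consL x (Finsupp.single w 1)) = β (lastL x) (Finsupp.single w 1)
      + w.cut fun a b => β (consL x (Finsupp.single a 1)) (Finsupp.single b 1) := by
  have h : ∀ x : CMod k p .a,
      (w.cut fun a b => β (consL x (Finsupp.single a 1)) (Finsupp.single b 1)) =
      (w.cut fun a b => (β.flip (Finsupp.single b 1)).comp (consL.flip (Finsupp.single a 1))) x :=
    fun x => (CForest.map_cut (LinearMap.evalAddMonoidHom x) w fun a b =>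
      (β.flip (Finsupp.single b 1)).comp (consL.flip (Finsupp.single a 1))).symm
  rw [h]
  refine LinearMap.congr_fun (f := (cutL β).comp (consL.flip (Finsupp.single w 1)))
    (g := (β.flip (Finsupp.single w 1)).comp lastL + _) (LinearMap.ext_single_one fun t => ?_) x
  rw [LinearMap.add_apply, ← h]
  simp [cutL_single, CForest.cut_cons]

theorem cutL_consL_right (β : CTensor k p .a →ₗ[k] CTensor k p c →ₗ[k] M) (t : CTree p .a)
    (v : CTensor k p c) :
    cutL β (consL (Finsupp.single t 1) v) = β (Finsupp.single (.last t) 1) v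
      + cutL (β.comp (consL (Finsupp.single t 1))) v := by
  refine LinearMap.congr_fun (f := (cutL β).comp (consL (Finsupp.single t 1)))
    (g := β (Finsupp.single (.last t) 1) + cutL (β.comp (consL (Finsupp.single t 1))))
    (LinearMap.ext_single_one fun w => ?_) v
  simp [cutL_single, CForest.cut_cons]

/-- The bar differential of words, as a linear map. -/
def wordDL : CTensor k p c →ₗ[k] CTensor k p c := Finsupp.linearCombination k (CForest.barD k)

/-- The bar differential of trees, as a linear map. -/
def treeDL : CMod k p c →ₗ[k] CMod k p c := Finsupp.linearCombination k (CTree.barD k)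

@[simp] theorem wordDL_single (w : CForest p c) (a : k) :
    wordDL (Finsupp.single w a) = a • w.barD k := by simp [wordDL]

@[simp] theorem treeDL_single (t : CTree p c) (a : k) :
    treeDL (Finsupp.single t a) = a • t.barD k := by simp [treeDL]

theorem CForest.nest_eq (t : CTree p .a) (w : CForest p c) :
    nest k t w = w.cut fun a b => Finsupp.single (CForest.cons (.node t a) b) 1 := rfl

/-- The bar differential is a coderivation. -/
theorem CForest.cutL_barD : (w : CForest p c) →
    (β : CTensor k p .a →ₗ[k] CTensor k p c →ₗ[k] M) →
    cutL β (w.barD k) = w.cut fun a b => β (a.barD k) (Finsupp.single b 1)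
      + (-1 : k) ^ (a.dim + a.length) • β (Finsupp.single a 1) (b.barD k)
  | .last t, β => by rw [barD_last, cutL_lastL, cut_last]
  | .cons t ts, β => by
    have key : ∀ (a : CForest p .a) (b : CForest p c),
        β ((CForest.cons t a).barD k) (Finsupp.single b 1) =
          β (consL (t.barD k) (Finsupp.single a 1)) (Finsupp.single b 1)
          + (-1 : k) ^ (t.dim + 1) •
            β (consL (Finsupp.single t 1) (a.barD k)) (Finsupp.single b 1)
          + (a.cut fun x y => β (Finsupp.single (.cons (.node t x) y) 1) (Finsupp.single b 1))
          + β (Finsupp.single (.last (.node t a)) 1) (Finsupp.single b 1) := by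
      intro a b
      rw [barD_cons, map_add, map_add, map_add, map_smul, lastL_single, nest_eq,
        LinearMap.add_apply, LinearMap.add_apply, LinearMap.add_apply, LinearMap.smul_apply]
      congr 2
      exact cut_linearMap (β.flip (Finsupp.single b 1)) a _
    have sgn : ∀ a : CForest p .a, (-1 : k) ^ ((CForest.cons t a).dim + (CForest.cons t a).length)
        = (-1 : k) ^ (t.dim + 1) * (-1 : k) ^ (a.dim + a.length) := by
      intro a
      rw [← pow_add, dim, length]
      congr 1; ring
    have sgl : (-1 : k) ^ ((CForest.last t).dim + (CForest.last t).length)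
        = (-1 : k) ^ (t.dim + 1) := by rw [dim, length]
    rw [barD_cons, map_add, map_add, map_add, cutL_lastL, cutL_consL_left, map_smul,
      cutL_consL_right, cutL_barD ts, nest_eq, cut_linearMap, cut_cons]
    simp only [cutL_single, cut_cons, cut_add, barD_last, cut_cut, key, sgn, sgl, cut_smul, mul_smul,
      LinearMap.comp_apply, smul_add, consL_single, one_smul]
    abel

/-- The bilinear map `(x, w) ↦ ∑ μ(x, y_1) · y_2`. -/
def nestL : CMod k p .a →ₗ[k] CTensor k p c →ₗ[k] CTensor k p c :=
  cutL.comp ((LinearMap.llcomp k (CTensor k p .a) (CTensor k p .a)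
    (CTensor k p c →ₗ[k] CTensor k p c) (consL.comp joinL)).comp consL)

theorem nestL_apply (x : CMod k p .a) (v : CTensor k p c) :
    nestL x v = cutL (consL.comp (joinL.comp (consL x))) v := rfl

theorem nestL_single (t : CTree p .a) (w : CForest p c) :
    nestL (Finsupp.single t (1 : k)) (Finsupp.single w 1) = w.nest k t := by
  simp [nestL_apply, cutL_single, CForest.nest_eq, CForest.join]

theorem wordDL_lastL (x : CMod k p c) : wordDL (lastL x) = lastL (treeDL x) := by
  refine LinearMap.congr_fun (f := wordDL.comp lastL) (g := lastL.comp treeDL)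
    (LinearMap.ext_single_one fun t => ?_) x
  simp [CForest.barD_last]

theorem joinL_lastL (x : CMod k p c) : joinL (lastL x) = 0 := by
  refine LinearMap.congr_fun (f := joinL.comp lastL) (g := 0)
    (LinearMap.ext_single_one fun t => ?_) x
  simp [CForest.join]

theorem treeDL_joinL (v : CTensor k p c) : treeDL (joinL v) = - joinL (wordDL v) := by
  refine LinearMap.congr_fun (f := treeDL.comp joinL) (g := -(joinL.comp wordDL : CTensor k p c →ₗ[k] CMod k p c))
    (LinearMap.ext_single_one fun w => ?_) v
  cases w with
  | last t => simp [CForest.join, CForest.barD_last, joinL_lastL]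
  | cons t ts => simp [CForest.join, CTree.barD_node]

theorem wordDL_consL {m : ℕ} {x : CMod k p .a}
    (hx : x ∈ Finsupp.supported k k {t : CTree p .a | t.dim + 1 = m}) (v : CTensor k p c) :
    wordDL (consL x v) = consL (treeDL x) v + (-1 : k) ^ m • consL x (wordDL v) + nestL x v
      + lastL (joinL (consL x v)) := by
  have h : ∀ w : CForest p c, ∀ x : CMod k p .a,
      x ∈ Finsupp.supported k k {t : CTree p .a | t.dim + 1 = m} →
      wordDL (consL x (Finsupp.single w 1)) = consL (treeDL x) (Finsupp.single w 1)
        + (-1 : k) ^ m • consL x (wordDL (Finsupp.single w 1)) + nestL x (Finsupp.single w 1)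
        + lastL (joinL (consL x (Finsupp.single w 1))) := by
    intro w x hx
    refine LinearMap.eq_of_mem_supported (f := wordDL.comp (consL.flip (Finsupp.single w 1)))
      (g := (consL.flip (Finsupp.single w 1)).comp treeDL
        + (-1 : k) ^ m • consL.flip (wordDL (Finsupp.single w 1)) + nestL.flip (Finsupp.single w 1)
        + lastL.comp (joinL.comp (consL.flip (Finsupp.single w 1)))) (fun t ht => ?_) hx
    obtain rfl : t.dim + 1 = m := ht
    simp [CForest.barD_cons, nestL_single, CForest.join]
  refine LinearMap.congr_fun (f := wordDL.comp (consL x))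
    (g := consL (treeDL x) + (-1 : k) ^ m • (consL x).comp wordDL + nestL x
      + lastL.comp (joinL.comp (consL x))) (LinearMap.ext_single_one fun w => ?_) v
  exact h w x hx

theorem CTree.barD_mem (t : CTree p c) :
    t.barD k ∈ Finsupp.supported k k {u : CTree p c | u.dim + 1 = t.dim ∧ u.leaves = t.leaves} := by
  refine Submodule.smul_mem _ _ ?_
  have := CTree.d_mem k t
  rw [Finsupp.mem_supported] at this ⊢
  intro u hu
  refine this (Finsupp.mem_support_iff.2 fun h0 => ?_)
  have := Finsupp.mem_support_iff.1 hu
  rw [signTwist_apply, h0, mul_zero] at this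
  exact this rfl

theorem CForest.wordDL_barD_cons {t : CTree p .a} {ts : CForest p c}
    (ht : treeDL (t.barD k) = 0) (hts : wordDL (ts.barD k) = 0) :
    wordDL ((CForest.cons t ts).barD k) = 0 := by
  have h1 : wordDL (consL (t.barD k) (Finsupp.single ts 1)) =
      (-1 : k) ^ t.dim • consL (t.barD k) (ts.barD k) + nestL (t.barD k) (Finsupp.single ts 1)
        + lastL (joinL (consL (t.barD k) (Finsupp.single ts 1))) := by
    rw [wordDL_consL (m := t.dim) (Finsupp.supported_mono (fun u hu => hu.1) t.barD_mem), ht]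
    simp
  have h2 : wordDL (consL (Finsupp.single t (1 : k)) (ts.barD k)) =
      consL (t.barD k) (ts.barD k) + nestL (Finsupp.single t 1) (ts.barD k)
        + lastL (joinL (consL (Finsupp.single t 1) (ts.barD k))) := by
    rw [wordDL_consL (m := t.dim + 1) (Finsupp.single_mem_supported _ _ rfl), hts]
    simp
  have h4 : wordDL (lastL (Finsupp.single (CTree.node t ts) (1 : k))) =
      - lastL (joinL ((CForest.cons t ts).barD k)) := by
    rw [wordDL_lastL, treeDL_single, one_smul, CTree.barD_node, map_neg]
  have h3 : ∀ (a : CForest p .a) (b : CForest p c),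
      wordDL (Finsupp.single (CForest.cons (.node t a) b) (1 : k)) =
      - consL (joinL (consL (t.barD k) (Finsupp.single a 1))) (Finsupp.single b 1)
      - (-1 : k) ^ (t.dim + 1) •
          consL (joinL (consL (Finsupp.single t 1) (a.barD k))) (Finsupp.single b 1)
      - consL (joinL (a.nest k t)) (Finsupp.single b 1)
      - (-1 : k) ^ (t.dim + 1) • (-1 : k) ^ (a.dim + a.length) •
          consL (Finsupp.single (.node t a) 1) (b.barD k)
      + b.nest k (.node t a) + lastL (Finsupp.single (.node (.node t a) b) 1) := by
    intro a b
    have e : (-1 : k) ^ ((CTree.node t a).dim + 1) =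
        - ((-1 : k) ^ (t.dim + 1) * (-1 : k) ^ (a.dim + a.length)) := by
      obtain ⟨l, hl⟩ := Nat.exists_eq_succ_of_ne_zero a.length_pos.ne'
      rw [CTree.dim, hl, Nat.succ_sub_one, Nat.succ_eq_add_one]
      ring
    rw [wordDL_single, one_smul, barD_cons, CTree.barD_node, barD_cons, e, map_add, map_add,
      map_add, joinL_lastL, map_smul]
    simp only [map_neg, map_add, map_smul, LinearMap.neg_apply, LinearMap.add_apply,
      LinearMap.smul_apply, add_zero, neg_smul, mul_smul]
    abel
  have h5 : nestL (t.barD k) (Finsupp.single ts 1) = ts.cut fun a b =>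
      consL (joinL (consL (t.barD k) (Finsupp.single a 1))) (Finsupp.single b 1) := by
    rw [nestL_apply, cutL_single]; rfl
  have h6 : nestL (Finsupp.single t 1) (ts.barD k) = (ts.cut fun a b =>
      consL (joinL (consL (Finsupp.single t 1) (a.barD k))) (Finsupp.single b 1)) +
      ts.cut fun a b => (-1 : k) ^ (a.dim + a.length) •
          consL (Finsupp.single (.node t a) 1) (b.barD k) := by
    rw [nestL_apply, cutL_barD, cut_add]
    simp [join]
  have h7 : (ts.cut fun a b => consL (joinL (a.nest k t)) (Finsupp.single b 1)) =
      ts.cut fun a b => b.nest k (.node t a) := by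
    simp only [nest_eq]
    rw [cut_cut ts fun a x y => Finsupp.single (CForest.cons (.node (.node t a) x) y) (1 : k)]
    refine cut_congr fun a b _ => ?_
    rw [cut_linearMap]
    refine (cut_linearMap (consL.flip (Finsupp.single b (1 : k))) a _).trans ?_
    simp [join]
  have h8 : lastL (joinL (nest k t ts)) = ts.cut fun a b =>
      lastL (Finsupp.single (CTree.node (.node t a) b) (1 : k)) := by
    rw [nest_eq, cut_linearMap, cut_linearMap]
    simp [join]
  rw [barD_cons, map_add, map_add, map_add, h1, map_smul, h2, h4, barD_cons, map_add, map_add,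
    map_add, joinL_lastL, map_add, map_add, map_add, h8, nest_eq, cut_linearMap]
  simp only [h3, sub_eq_add_neg, cut_add, cut_neg, cut_smul, h7, h5, h6, pow_succ, map_smul,
    smul_add, mul_neg, mul_one, neg_smul, map_zero, map_neg]
  abel

theorem CForest.cut_length_lt {w : CForest p c} {a : CForest p .a} {b : CForest p c}
    (h : a.append b = w) : a.length < w.length ∧ b.length < w.length := by
  subst h
  have := a.length_pos
  have := b.length_pos
  rw [length_append]; omega

end

section

variable {k : Type*} [CommRing k] {M : Type*} [AddCommGroup M] [Module k M] {c : Color}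

theorem CForest.paint_eq_cut (w : CForest false c) :
    w.paint k = lastL (Finsupp.single (.half w) 1) + w.cut fun a b =>
      consL (Finsupp.single (.half a) 1) (b.paint k) := by
  rw [paint, sum_blocks]
  congr 1
  · simp [paintBlocks_nil]
  · refine cut_congr fun a b _ => ?_
    rw [paint, map_list_sum, List.map_map]
    refine list_sum_map_congr fun y _ => ?_
    simp [paintBlocks_cons]

/-- Linear extension of the sum over all paintings of a word. -/
def paintL : CTensor k false c →ₗ[k] CTensor k true c :=
  Finsupp.linearCombination k (CForest.paint k)

@[simp] theorem paintL_single (w : CForest false c) (a : k) :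
    paintL (Finsupp.single w a) = a • w.paint k := by simp [paintL]

/-- The bilinear map `(a, b) ↦ f(a) · paint b`. -/
def paintCons : CTensor k false .a →ₗ[k] CTensor k false c →ₗ[k] CTensor k true c :=
  (consL.compl₂ paintL).comp halfL

theorem paintCons_apply (x : CTensor k false .a) (v : CTensor k false c) :
    paintCons x v = consL (halfL x) (paintL v) := rfl

theorem paintL_eq_cutL (v : CTensor k false c) :
    paintL v = lastL (halfL v) + cutL (k := k) (M := CTensor k true c) paintCons v := by
  refine LinearMap.congr_fun (f := paintL)
    (g := lastL.comp halfL + cutL (k := k) (M := CTensor k true c) paintCons)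
    (LinearMap.ext_single_one fun w => ?_) v
  simp [cutL_single, CForest.paint_eq_cut w, paintCons_apply]

/-- The sum over all paintings is a morphism of coalgebras. -/
theorem CForest.cutL_paint (w : CForest false c)
    (β : CTensor k true .a →ₗ[k] CTensor k true c →ₗ[k] M) :
    cutL β (w.paint k) = w.cut fun a b => β (a.paint k) (b.paint k) := by
  have ih : ∀ (a : CForest false .a) (b : CForest false c), a.append b = w →
      ∀ β : CTensor k true .a →ₗ[k] CTensor k true c →ₗ[k] M,
      cutL β (b.paint k) = b.cut fun a b => β (a.paint k) (b.paint k) :=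
    fun a b hab β => CForest.cutL_paint b β
  have e : ∀ (a : CForest false .a) (b : CForest false c),
      β (a.paint k) (b.paint k) = β (Finsupp.single (.last (.half a)) 1) (b.paint k) +
        a.cut fun x y => β (consL (Finsupp.single (.half x) 1) (y.paint k)) (b.paint k) := by
    intro a b
    rw [paint_eq_cut a, map_add, LinearMap.add_apply, lastL_single]
    congr 1
    exact cut_linearMap (β.flip (b.paint k)) a _
  rw [paint_eq_cut w, map_add, cutL_lastL, zero_add, cut_linearMap]
  simp only [e, cut_add]
  rw [← cut_cut w fun a x y => β (consL (Finsupp.single (.half a) 1) (x.paint k)) (y.paint k),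
    ← cut_add]
  refine cut_congr fun a b hab => ?_
  rw [cutL_consL_right, ih a b hab]
  rfl
termination_by w.length
decreasing_by exact (CForest.cut_length_lt hab).2

/-- The sum over all paintings commutes with the bar differentials. -/
theorem CForest.paintL_barD (w : CForest false c) :
    paintL (w.barD k) = wordDL (w.paint k) := by
  have ih : ∀ (a : CForest false .a) (b : CForest false c), a.append b = w →
      paintL (b.barD k) = wordDL (b.paint k) :=
    fun a b hab => CForest.paintL_barD b
  have h1 : ∀ (a : CForest false .a) (b : CForest false c),
      wordDL (consL (Finsupp.single (.half a) (1 : k)) (b.paint k)) =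
      consL (halfL (a.barD k)) (b.paint k)
      - (a.cut fun x y => consL (joinL (consL (Finsupp.single (.half x) 1) (y.paint k)))
          (b.paint k))
      + (-1 : k) ^ (a.dim + a.length) • consL (Finsupp.single (.half a) 1) (wordDL (b.paint k))
      + (b.cut fun x y => consL (joinL (consL (Finsupp.single (.half a) 1) (x.paint k)))
          (y.paint k))
      + lastL (joinL (consL (Finsupp.single (.half a) 1) (b.paint k))) := by
    intro a b
    have e : (CTree.half a).dim + 1 = a.dim + a.length := by
      have := a.length_pos
      rw [CTree.dim]; omega
    rw [wordDL_consL (m := a.dim + a.length) (Finsupp.single_mem_supported _ _ e), nestL_apply,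
      cutL_paint, treeDL_single, one_smul, CTree.barD_half, map_sub, LinearMap.sub_apply]
    congr 4
    rw [paint_eq_cut a, map_add, joinL_lastL, zero_add, cut_linearMap]
    exact cut_linearMap (consL.flip (b.paint k)) a _
  rw [paintL_eq_cutL, cutL_barD, paint_eq_cut w, map_add, wordDL_lastL, treeDL_single, one_smul,
    CTree.barD_half, cut_linearMap]
  simp only [h1, sub_eq_add_neg, cut_add, cut_neg]
  rw [cut_cut w fun a x y => consL (joinL (consL (Finsupp.single (.half a) (1 : k)) (x.paint k)))
          (y.paint k)]
  have h2 : (w.cut fun a b => paintCons (a.barD k) (Finsupp.single b 1))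
      = w.cut fun a b => consL (halfL (a.barD k)) (b.paint k) := by simp [paintCons_apply]
  have h3 : (w.cut fun a b => (-1 : k) ^ (a.dim + a.length) •
      paintCons (Finsupp.single a 1) (b.barD k))
      = w.cut fun a b => (-1 : k) ^ (a.dim + a.length) •
        consL (Finsupp.single (.half a) 1) (wordDL (b.paint k)) := by
    refine cut_congr fun a b hab => ?_
    rw [← ih a b hab]
    simp [paintCons_apply]
  have h4 : lastL (joinL (w.paint k)) = w.cut fun a b =>
      lastL (joinL (consL (Finsupp.single (.half a) (1 : k)) (b.paint k))) := by
    rw [paint_eq_cut w, map_add, joinL_lastL, zero_add, cut_linearMap, cut_linearMap]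
  rw [h2, h3, map_add, map_neg, h4]
  abel
termination_by w.length
decreasing_by exact (CForest.cut_length_lt hab).2

theorem treeDL_halfL (v : CTensor k false c) :
    treeDL (halfL v) = halfL (wordDL v) - joinL (paintL v) := by
  refine LinearMap.congr_fun (f := treeDL.comp halfL)
    (g := halfL.comp wordDL - joinL.comp paintL) (LinearMap.ext_single_one fun w => ?_) v
  simp [CTree.barD_half]

end

mutual
  theorem CTree.treeDL_barD (k : Type*) [CommRing k] {p : Bool} {c : Color} :
      (t : CTree p c) → treeDL (t.barD k) = 0
    | .leaf => by rw [CTree.barD_leaf, map_zero]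
    | .node t ts => by
      rw [CTree.barD_node, map_neg, treeDL_joinL,
        CForest.wordDL_barD_cons (CTree.treeDL_barD k t) (CForest.wordDL_barD k ts)]
      simp
    | .half ts => by
      rw [CTree.barD_half, map_sub, treeDL_halfL, treeDL_joinL, CForest.wordDL_barD k ts,
        CForest.paintL_barD]
      simp
  theorem CForest.wordDL_barD (k : Type*) [CommRing k] {p : Bool} {c : Color} :
      (w : CForest p c) → wordDL (w.barD k) = 0
    | .last t => by rw [CForest.barD_last, wordDL_lastL, CTree.treeDL_barD k t, map_zero]
    | .cons t ts => CForest.wordDL_barD_cons (CTree.treeDL_barD k t) (CForest.wordDL_barD k ts)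
end

theorem CTree.d_eq_barD (k : Type*) [CommRing k] {p : Bool} {c : Color} (t : CTree p c) :
    t.d k = (-1 : k) ^ t.eps • signTwist CTree.eps (t.barD k) := by
  rw [CTree.barD, map_smul, signTwist_signTwist, smul_smul, neg_one_pow_mul_self, one_smul]

theorem dL_signTwist {k : Type*} [CommRing k] {p : Bool} {c : Color} (x : CMod k p c) :
    dL k p c (signTwist CTree.eps x) = signTwist CTree.eps (treeDL x) := by
  refine LinearMap.congr_fun (f := (dL k p c).comp (signTwist CTree.eps))
    (g := (signTwist CTree.eps).comp treeDL) (LinearMap.ext_single_one fun t => ?_) x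
  simp [dL, CTree.d_eq_barD, smul_smul, neg_one_pow_mul_self]

/-- The differential of `A_∞^Col` and `M_∞^Col` squares to zero. -/
theorem dL_d (k : Type*) [CommRing k] {p : Bool} {c : Color} (t : CTree p c) :
    dL k p c (t.d k) = 0 := by
  rw [CTree.d_eq_barD, map_smul, dL_signTwist, CTree.treeDL_barD, map_zero, smul_zero]

/-! ### Incidence numbers and contractions -/

/-- The coefficients of `v` are `±1` where `P` holds and `0` elsewhere. -/
def IsSignedIndicator {X : Type*} (P : X → Prop) (v : X →₀ ℤ) : Prop :=
  ∀ x, (P x → v x = 1 ∨ v x = -1) ∧ (¬ P x → v x = 0)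

namespace IsSignedIndicator

variable {X Y : Type*} {P Q : X → Prop} {v w : X →₀ ℤ}

theorem ne_zero_iff (h : IsSignedIndicator P v) {x : X} : v x ≠ 0 ↔ P x := by
  constructor
  · intro hx
    by_contra hP
    exact hx ((h x).2 hP)
  · intro hP
    rcases (h x).1 hP with h | h <;> simp [h]

theorem congr (h : IsSignedIndicator P v) (hPQ : ∀ x, P x ↔ Q x) : IsSignedIndicator Q v :=
  fun x => by rw [← hPQ]; exact h x

theorem neg (h : IsSignedIndicator P v) : IsSignedIndicator P (-v) := fun x => by
  have := h x
  simp only [Finsupp.neg_apply, neg_eq_zero]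
  exact ⟨fun hP => (this.1 hP).symm.imp (fun h => by simp [h]) (fun h => by simp [h]), this.2⟩

theorem smul (h : IsSignedIndicator P v) (n : ℕ) : IsSignedIndicator P ((-1 : ℤ) ^ n • v) := by
  rcases neg_one_pow_eq_or ℤ n with hn | hn
  · simpa [hn] using h
  · simpa [hn] using h.neg

theorem signTwist (h : IsSignedIndicator P v) (e : X → ℕ) :
    IsSignedIndicator P (signTwist e v) := fun x => by
  have := h x
  rw [signTwist_apply]
  rcases neg_one_pow_eq_or ℤ (e x) with hn | hn
  · simpa [hn] using this
  · rw [hn]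
    exact ⟨fun hP => (this.1 hP).symm.imp (fun h => by simp [h]) (fun h => by simp [h]),
      fun hP => by simp [this.2 hP]⟩

theorem add (h : IsSignedIndicator P v) (h' : IsSignedIndicator Q w)
    (hd : ∀ x, P x → ¬ Q x) : IsSignedIndicator (fun x => P x ∨ Q x) (v + w) := fun x => by
  have h1 := h x
  have h2 := h' x
  have h3 := hd x
  rw [Finsupp.add_apply]
  by_cases hP : P x
  · simp [hP, h2.2 (h3 hP), h1.1 hP]
  · by_cases hQ : Q x
    · simp [hQ, h1.2 hP, h2.1 hQ]
    · simp [hP, hQ, h1.2 hP, h2.2 hQ]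

theorem mapDomain (h : IsSignedIndicator P v) {f : X → Y} (hf : Function.Injective f) :
    IsSignedIndicator (fun y => ∃ x, P x ∧ y = f x) (v.mapDomain f) := fun y => by
  by_cases hy : y ∈ Set.range f
  · obtain ⟨x, rfl⟩ := hy
    rw [Finsupp.mapDomain_apply hf]
    refine ⟨fun ⟨z, hz, e⟩ => (h x).1 (hf e ▸ hz), fun hn => (h x).2 fun hP => hn ⟨x, hP, rfl⟩⟩
  · refine ⟨fun ⟨x, _, e⟩ => absurd ⟨x, e.symm⟩ hy, fun _ => ?_⟩
    exact Finsupp.mapDomain_of_notMem_range _ _ hy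

theorem single (x : X) : IsSignedIndicator (fun y => y = x) (Finsupp.single x 1) := fun y => by
  classical
  rw [Finsupp.single_apply]
  by_cases h : x = y
  · simp [h]
  · simp [h, Ne.symm h]

theorem zero : IsSignedIndicator (fun _ : X => False) 0 := fun x => by simp

theorem list_sum (l : List Y) (f : Y → X) (hl : l.Nodup)
    (hf : ∀ y ∈ l, ∀ z ∈ l, f y = f z → y = z) :
    IsSignedIndicator (fun x => ∃ y ∈ l, x = f y) (l.map fun y => Finsupp.single (f y) 1).sum := by
  induction l with
  | nil => simpa using zero
  | cons y l ih =>
    simp only [List.nodup_cons] at hl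
    rw [List.map_cons, List.sum_cons]
    refine congr (add (single (f y)) (ih hl.2 fun a ha b hb => hf a (by simp [ha]) b (by simp [hb]))
      ?_) (by simp)
    rintro _ rfl ⟨z, hz, e⟩
    exact hl.1 (hf y (by simp) z (by simp [hz]) e ▸ hz)

end IsSignedIndicator

section

variable {k : Type*} [CommRing k] {p : Bool} {c : Color}

theorem joinL_apply_node (v : CTensor k p c) (t : CTree p .a) (ts : CForest p c) :
    joinL v (.node t ts) = v (.cons t ts) := by
  classical
  refine LinearMap.congr_fun (f := (Finsupp.lapply (CTree.node t ts)).comp joinL)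
    (g := Finsupp.lapply (CForest.cons t ts)) (LinearMap.ext_single_one fun w => ?_) v
  cases w <;> simp [CForest.join, Finsupp.single_apply]

theorem joinL_apply_of_ne (v : CTensor k p c) {u : CTree p c} (h : ∀ t ts, u ≠ .node t ts) :
    joinL v u = 0 := by
  classical
  refine LinearMap.congr_fun (f := (Finsupp.lapply u).comp joinL)
    (g := 0) (LinearMap.ext_single_one fun w => ?_) v
  cases w with
  | last t => simp [CForest.join]
  | cons t ts => simp [CForest.join, (h t ts).symm]

end

theorem IsSignedIndicator.joinL {p : Bool} {c : Color} {P : CForest p c → Prop}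
    {v : CTensor ℤ p c} (h : IsSignedIndicator P v) :
    IsSignedIndicator (fun u => ∃ t ts, u = CTree.node t ts ∧ P (.cons t ts)) (joinL v) := by
  intro u
  by_cases hu : ∃ t ts, u = CTree.node t ts
  · obtain ⟨t, ts, rfl⟩ := hu
    rw [joinL_apply_node]
    have := h (.cons t ts)
    constructor
    · rintro ⟨t', ts', e, hP⟩
      obtain ⟨rfl, rfl⟩ := by simpa using e
      exact this.1 hP
    · exact fun hn => this.2 fun hP => hn ⟨t, ts, rfl, hP⟩
  · refine ⟨fun ⟨t, ts, e, _⟩ => absurd ⟨t, ts, e⟩ hu, fun _ => ?_⟩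
    exact joinL_apply_of_ne _ fun t ts e => hu ⟨t, ts, e⟩

/-- One admissible contraction in a word: of a letter into its letters, or inside a letter. -/
def WordContract {p : Bool} {c : Color} (w' w : CForest p c) : Prop :=
  Flatten w' w ∨ ContractIn w' w

theorem flatten_iff {p : Bool} {c : Color} {w w' : CForest p c} {t : CTree p .a} :
    Flatten w' (.cons t w) ↔ w' = .last (.node t w) ∨
      (∃ a b, a.append b = w ∧ w' = .cons (.node t a) b) ∨
      ∃ w'', Flatten w'' w ∧ w' = .cons t w'' := by
  constructor
  · intro h
    cases h with
    | last => exact .inl rfl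
    | head t ts r => exact .inr (.inl ⟨ts, r, rfl, rfl⟩)
    | tail t r r' h => exact .inr (.inr ⟨_, h, rfl⟩)
  · rintro (rfl | ⟨a, b, rfl, rfl⟩ | ⟨w'', h, rfl⟩)
    · exact .last t w
    · exact .head t a b
    · exact .tail t _ _ h

theorem not_flatten_last {p : Bool} {c : Color} {w' : CForest p c} {t : CTree p c} :
    ¬ Flatten w' (.last t) := by
  intro h
  cases h

theorem contractIn_cons_iff {p : Bool} {c : Color} {w w' : CForest p c} {t : CTree p .a} :
    ContractIn w' (.cons t w) ↔ (∃ t', Contract t' t ∧ w' = .cons t' w) ∨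
      ∃ w'', ContractIn w'' w ∧ w' = .cons t w'' := by
  constructor
  · intro h
    cases h with
    | head t t' ts h => exact .inl ⟨_, h, rfl⟩
    | tail t ts ts' h => exact .inr ⟨_, h, rfl⟩
  · rintro (⟨t', h, rfl⟩ | ⟨w'', h, rfl⟩)
    · exact .head _ _ _ h
    · exact .tail _ _ _ h

theorem wordContract_last_iff {p : Bool} {c : Color} {w' : CForest p c} {t : CTree p c} :
    WordContract w' (.last t) ↔ ∃ t', Contract t' t ∧ w' = .last t' := by
  constructor
  · rintro (h | h)
    · exact absurd h not_flatten_last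
    · cases h with
      | last t t' h => exact ⟨_, h, rfl⟩
  · rintro ⟨t', h, rfl⟩
    exact .inr (.last _ _ h)

theorem wordContract_cons_iff {p : Bool} {c : Color} {w w' : CForest p c} {t : CTree p .a} :
    WordContract w' (.cons t w) ↔ (((∃ t', Contract t' t ∧ w' = .cons t' w) ∨
      (∃ w'', WordContract w'' w ∧ w' = .cons t w'')) ∨
      (∃ a b, a.append b = w ∧ w' = .cons (.node t a) b)) ∨ w' = .last (.node t w) := by
  rw [WordContract, flatten_iff, contractIn_cons_iff]
  simp only [WordContract, or_and_right, exists_or]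
  simp only [or_assoc, or_comm, or_left_comm]

theorem contract_node_iff {p : Bool} {c : Color} {u : CTree p c} {t : CTree p .a}
    {ts : CForest p c} : Contract u (.node t ts) ↔
      ∃ t' ts', u = .node t' ts' ∧ WordContract (.cons t' ts') (.cons t ts) := by
  constructor
  · intro h
    cases h with
    | edge t t' ts ts' h => exact ⟨_, _, rfl, .inl h⟩
    | inNode t t' ts ts' h => exact ⟨_, _, rfl, .inr h⟩
  · rintro ⟨t', ts', rfl, h | h⟩
    · exact .edge _ _ _ _ h
    · exact .inNode _ _ _ _ h

theorem unpaint_iff {c : Color} {g : CForest true c} {x : CForest false c} :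
    Unpaint g x ↔ ∃ y ∈ x.blocks, g = paintBlocks y.1 y.2 := by
  constructor
  · intro h
    induction h with
    | last x => exact ⟨([], x), (CForest.mem_blocks x).2 rfl, rfl⟩
    | cons x g y h ih =>
      obtain ⟨⟨bs, b⟩, hz, rfl⟩ := ih
      refine ⟨(x :: bs, b), (CForest.mem_blocks _).2 ?_, rfl⟩
      rw [← (CForest.mem_blocks _).1 hz]
      rfl
  · rintro ⟨⟨bs, b⟩, hy, rfl⟩
    rw [CForest.mem_blocks] at hy
    subst hy
    induction bs with
    | nil => exact .last b
    | cons x bs ih => exact .cons x _ _ ih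

theorem contract_half_iff {c : Color} {u : CTree true c} {ts : CForest false c} :
    Contract u (.half ts) ↔ (∃ ts', u = .half ts' ∧ WordContract ts' ts) ∨
      ∃ t us, u = .node t us ∧ ∃ y ∈ ts.blocks, CForest.cons t us = paintBlocks y.1 y.2 := by
  constructor
  · intro h
    cases h with
    | halfEdge ts ts' h => exact .inl ⟨_, rfl, .inl h⟩
    | inHalf ts ts' h => exact .inl ⟨_, rfl, .inr h⟩
    | corolla t ts x h => exact .inr ⟨_, _, rfl, unpaint_iff.1 h⟩
  · rintro (⟨ts', rfl, h | h⟩ | ⟨t, us, rfl, h⟩)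
    · exact .halfEdge _ _ h
    · exact .inHalf _ _ h
    · exact .corolla _ _ _ (unpaint_iff.2 h)

theorem not_contract_leaf {c : Color} {u : CTree false c} : ¬ Contract u .leaf := by
  intro h
  cases h

theorem CForest.nodup_splits {p : Bool} {c : Color} : (w : CForest p c) → w.splits.Nodup
  | .last t => by simp [splits]
  | .cons t ts => by
    rw [splits, List.nodup_cons]
    refine ⟨by simp, (CForest.nodup_splits ts).map ?_⟩
    rintro ⟨a, b⟩ ⟨a', b'⟩ h
    simpa using h

theorem CForest.nodup_blocks {p : Bool} {c : Color} : (w : CForest p c) → w.blocks.Nodup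
  | .last t => by simp [blocks]
  | .cons t ts => by
    rw [blocks, List.nodup_flatMap]
    constructor
    · rintro ⟨l, b⟩ _
      cases l <;> simp
    · refine (CForest.nodup_blocks ts).imp ?_
      rintro ⟨l, b⟩ ⟨l', b'⟩ hne
      rw [Function.onFun, List.disjoint_left]
      cases l <;> cases l' <;> simp at hne ⊢ <;> tauto

theorem paintBlocks_injective {c : Color} : ∀ {bs bs' : List (CForest false .a)}
    {b b' : CForest false c}, paintBlocks bs b = paintBlocks bs' b' → bs = bs' ∧ b = b'
  | [], [], b, b', h => by simpa [paintBlocks_nil] using h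
  | [], x :: bs, b, b', h => by simp [paintBlocks_nil, paintBlocks_cons] at h
  | x :: bs, [], b, b', h => by simp [paintBlocks_nil, paintBlocks_cons] at h
  | x :: bs, x' :: bs', b, b', h => by
    simp only [paintBlocks_cons, CForest.cons.injEq, CTree.half.injEq] at h
    have := paintBlocks_injective h.2
    simp [h.1, this]

theorem CTree.leaves_pos {p : Bool} {c : Color} : (t : CTree p c) → 0 < t.leaves :=
  fun t => CTree.rec (motive_1 := fun _ _ t => 0 < t.leaves)
    (motive_2 := fun _ _ w => 0 < w.leaves) (by simp [CTree.leaves])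
    (fun t ts h1 h2 => by simp only [CTree.leaves]; omega)
    (fun ts h => by simpa [CTree.leaves] using h)
    (fun t h => by simpa [CForest.leaves] using h)
    (fun t ts h1 h2 => by simp only [CForest.leaves]; omega) t

theorem CForest.leaves_pos {p : Bool} {c : Color} : (w : CForest p c) → 0 < w.leaves
  | .last t => by simpa [leaves] using t.leaves_pos
  | .cons t ts => by have := t.leaves_pos; simp only [leaves]; omega

theorem isSignedIndicator_nest {p : Bool} {c : Color} (t : CTree p .a) (w : CForest p c) :
    IsSignedIndicator (fun w' => ∃ a b, a.append b = w ∧ w' = .cons (.node t a) b)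
      (w.nest ℤ t) := by
  refine (IsSignedIndicator.list_sum w.splits
    (fun y => CForest.cons (.node t y.1) y.2) w.nodup_splits ?_).congr ?_
  · rintro ⟨a, b⟩ _ ⟨a', b'⟩ _ h
    simpa using h
  · intro x
    constructor
    · rintro ⟨y, hy, rfl⟩
      exact ⟨_, _, (CForest.mem_splits w).1 hy, rfl⟩
    · rintro ⟨a, b, h, rfl⟩
      exact ⟨(a, b), (CForest.mem_splits w).2 h, rfl⟩

theorem isSignedIndicator_paint {c : Color} (w : CForest false c) :
    IsSignedIndicator (fun w' => ∃ y ∈ w.blocks, w' = paintBlocks y.1 y.2) (w.paint ℤ) :=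
  IsSignedIndicator.list_sum w.blocks (fun y => paintBlocks y.1 y.2) w.nodup_blocks
    fun _ _ _ _ h => Prod.ext_iff.2 (paintBlocks_injective h)

theorem IsSignedIndicator.dim_eq {p : Bool} {c : Color} {t : CTree p c}
    (ht : IsSignedIndicator (Contract · t) (t.barD ℤ)) {u : CTree p c} (h : Contract u t) :
    u.dim + 1 = t.dim ∧ u.leaves = t.leaves :=
  (Finsupp.mem_supported _ _).1 (CTree.barD_mem t) (Finsupp.mem_support_iff.2 (ht.ne_zero_iff.2 h))

theorem isSignedIndicator_barD_cons {p : Bool} {c : Color} {t : CTree p .a} {ts : CForest p c}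
    (ht : IsSignedIndicator (Contract · t) (t.barD ℤ))
    (hts : IsSignedIndicator (WordContract · ts) (ts.barD ℤ)) :
    IsSignedIndicator (WordContract · (.cons t ts)) ((CForest.cons t ts).barD ℤ) := by
  have key : ∀ a : CForest p .a, t ≠ .node t a := by
    intro a h
    have h1 := congrArg CTree.leaves h
    have h2 := a.leaves_pos
    simp only [CTree.leaves] at h1
    omega
  refine IsSignedIndicator.congr ?_ fun _ => wordContract_cons_iff.symm
  rw [CForest.barD_cons, ← mapDomain_cons_left, ← mapDomain_cons_right, lastL_single]
  refine ((((ht.mapDomain ?_).add ((hts.mapDomain ?_).smul _) ?_).add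
    (isSignedIndicator_nest t ts) ?_).add (IsSignedIndicator.single _) ?_)
  · intro a b h; simpa using h
  · intro a b h; simpa using h
  · rintro _ ⟨t', h, rfl⟩ ⟨w, _, e⟩
    obtain ⟨rfl, rfl⟩ := by simpa using e
    have := (ht.dim_eq h).1
    omega
  · rintro _ (⟨t', h, rfl⟩ | ⟨w, h, rfl⟩) ⟨a, b, rfl, e⟩
    · have h1 := congrArg CForest.length e
      have h2 := a.length_pos
      rw [CForest.length, CForest.length, CForest.length_append] at h1
      omega
    · exact key _ (CForest.cons.inj e).1
  · rintro _ ((⟨t', h, rfl⟩ | ⟨w, h, rfl⟩) | ⟨a, b, h, rfl⟩) e <;> simp at e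

mutual
  theorem CTree.isSignedIndicator_barD {p : Bool} {c : Color} : (t : CTree p c) →
      IsSignedIndicator (Contract · t) (t.barD ℤ)
    | .leaf => by
      rw [CTree.barD_leaf]
      exact IsSignedIndicator.zero.congr fun _ => (iff_false_intro not_contract_leaf).symm
    | .node t ts => by
      rw [CTree.barD_node]
      exact (isSignedIndicator_barD_cons t.isSignedIndicator_barD
        ts.isSignedIndicator_barD).joinL.neg.congr fun _ => contract_node_iff.symm
    | .half ts => by
      rw [CTree.barD_half, sub_eq_add_neg]
      refine ((ts.isSignedIndicator_barD.mapDomain ?_).add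
        (isSignedIndicator_paint ts).joinL.neg ?_).congr fun _ => ?_
      · intro a b h; simpa using h
      · rintro _ ⟨x, _, rfl⟩ ⟨t, us, e, _⟩
        simp at e
      · rw [contract_half_iff]
        simp only [and_comm]
  theorem CForest.isSignedIndicator_barD {p : Bool} {c : Color} : (w : CForest p c) →
      IsSignedIndicator (WordContract · w) (w.barD ℤ)
    | .last t => by
      rw [CForest.barD_last]
      refine (t.isSignedIndicator_barD.mapDomain ?_).congr fun _ => wordContract_last_iff.symm
      intro a b h; simpa using h
    | .cons t ts =>
      isSignedIndicator_barD_cons t.isSignedIndicator_barD ts.isSignedIndicator_barD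
end

/-- The incidence number of two trees is `±1` if one is a contraction of the other, and vanishes
otherwise. -/
theorem CTree.isSignedIndicator_d {p : Bool} {c : Color} (t : CTree p c) :
    IsSignedIndicator (Contract · t) (t.d ℤ) := by
  rw [CTree.d_eq_barD]
  exact (t.isSignedIndicator_barD.signTwist _).smul _

theorem Contract.dim_eq {p : Bool} {c : Color} {u t : CTree p c} (h : Contract u t) :
    u.dim + 1 = t.dim := (t.isSignedIndicator_barD.dim_eq h).1

theorem Contract.leaves_eq {p : Bool} {c : Color} {u t : CTree p c} (h : Contract u t) :
    u.leaves = t.leaves := (t.isSignedIndicator_barD.dim_eq h).2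

/-! ### Change of rings and augmentation -/

/-- The change of coefficients from the integers. -/
def castL {X : Type*} (k : Type*) [CommRing k] : (X →₀ ℤ) →+ (X →₀ k) :=
  Finsupp.mapRange.addMonoidHom (Int.castAddHom k)

section

variable {k : Type*} [CommRing k]

theorem castL_apply {X : Type*} (v : X →₀ ℤ) (x : X) : castL k v x = (v x : k) := by
  simp [castL]

@[simp] theorem castL_single {X : Type*} (x : X) (a : ℤ) :
    castL k (Finsupp.single x a) = Finsupp.single x (a : k) := by
  simp [castL]

theorem castL_mapDomain {X Y : Type*} (f : X → Y) (v : X →₀ ℤ) :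
    castL k (v.mapDomain f) = (castL k v).mapDomain f := by
  have : (castL k).comp (Finsupp.mapDomain.addMonoidHom f) =
      (Finsupp.mapDomain.addMonoidHom f).comp (castL k : (X →₀ ℤ) →+ _) := by
    ext x : 2
    simp [Finsupp.mapDomain_single]
  exact DFunLike.congr_fun this v

theorem castL_smul {X : Type*} (n : ℕ) (v : X →₀ ℤ) :
    castL k ((-1 : ℤ) ^ n • v) = (-1 : k) ^ n • castL k v := by
  ext x
  simp [castL_apply]

theorem castL_join {p : Bool} {c : Color} (w : CForest p c) :
    castL k (w.join ℤ) = w.join k := by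
  cases w <;> simp [CForest.join]

end

mutual
  theorem CTree.castL_d (k : Type*) [CommRing k] {p : Bool} {c : Color} :
      (t : CTree p c) → castL k (t.d ℤ) = t.d k
    | .leaf => by simp [CTree.d]
    | .node t ts => by
      simp only [CTree.d, map_add, map_neg, map_list_sum, List.map_map, castL_smul,
        castL_mapDomain, CTree.castL_d k t, CForest.castL_d k ts, Function.comp_def, castL_join]
    | .half ts => by
      simp only [CTree.d, map_add, map_sub, map_list_sum, List.map_map, castL_smul,
        castL_mapDomain, CForest.castL_d k ts, Function.comp_def, castL_join, castL_single,
        Int.cast_pow, Int.cast_neg, Int.cast_one]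
  theorem CForest.castL_d (k : Type*) [CommRing k] {p : Bool} {c : Color} :
      (w : CForest p c) → castL k (w.d ℤ) = w.d k
    | .last t => by simp only [CForest.d, castL_mapDomain, CTree.castL_d k t]
    | .cons t ts => by
      simp only [CForest.d, map_add, castL_smul, castL_mapDomain, CTree.castL_d k t,
        CForest.castL_d k ts]
end

/-- The sum of the coefficients. -/
def coeffSum {k X : Type*} [CommRing k] : (X →₀ k) →ₗ[k] k :=
  Finsupp.linearCombination k fun _ => 1

@[simp] theorem coeffSum_single {k X : Type*} [CommRing k] (x : X) (a : k) :
    coeffSum (Finsupp.single x a) = a := by simp [coeffSum]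

theorem coeffSum_mapDomain {k X Y : Type*} [CommRing k] (f : X → Y) (v : X →₀ k) :
    coeffSum (v.mapDomain f) = coeffSum v := by
  simp [coeffSum, Finsupp.linearCombination_mapDomain, Function.comp_def]

theorem CTree.barD_eq_zero {k : Type*} [CommRing k] {p : Bool} {c : Color} {t : CTree p c}
    (h : t.dim = 0) : t.barD k = 0 := by
  ext u
  by_contra hu
  have := (Finsupp.mem_supported _ _).1 (CTree.barD_mem t) (Finsupp.mem_support_iff.2 hu)
  have := this.1
  omega

theorem coeffSum_joinL_consL {k : Type*} [CommRing k] {p : Bool} {c : Color} (x : CMod k p .a)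
    (w : CForest p c) : coeffSum (joinL (consL x (Finsupp.single w 1))) = coeffSum x := by
  refine LinearMap.congr_fun (M₃ := k)
    (f := coeffSum.comp (joinL.comp (consL.flip (Finsupp.single w 1))))
    (g := coeffSum) (LinearMap.ext_single_one fun t => ?_) x
  simp [CForest.join]

theorem coeffSum_joinL_consL_single {k : Type*} [CommRing k] {p : Bool} {c : Color}
    (t : CTree p .a) (v : CTensor k p c) :
    coeffSum (joinL (consL (Finsupp.single t 1) v)) = coeffSum v := by
  refine LinearMap.congr_fun (M₃ := k)
    (f := coeffSum.comp (joinL.comp (consL (Finsupp.single t 1))))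
    (g := coeffSum) (LinearMap.ext_single_one fun t => ?_) v
  simp [CForest.join]

theorem coeffSum_lastL {k : Type*} [CommRing k] {p : Bool} {c : Color} (x : CMod k p c) :
    coeffSum (lastL x) = coeffSum x := coeffSum_mapDomain _ _

theorem coeffSum_halfL {k : Type*} [CommRing k] {c : Color} (x : CTensor k false c) :
    coeffSum (halfL x) = coeffSum x := coeffSum_mapDomain _ _

/-- The two ends of an edge cancel. -/
theorem CTree.coeffSum_barD {k : Type*} [CommRing k] {p : Bool} {c : Color} : (t : CTree p c) →
    t.dim ≤ 1 → coeffSum (t.barD k) = 0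
  | .leaf, _ => by simp [CTree.barD_leaf]
  | .node t (.last u), h => by
    simp only [CTree.dim, CForest.dim, CForest.length] at h
    have h1 := CTree.coeffSum_barD (k := k) t (by omega)
    have h2 := CTree.coeffSum_barD (k := k) u (by omega)
    rw [CTree.barD_node, CForest.barD_cons, CForest.barD_last, CForest.nest_eq, CForest.cut_last]
    simp [coeffSum_joinL_consL, coeffSum_joinL_consL_single, coeffSum_lastL, h1, h2, CForest.join]
  | .node t (.cons u (.last v)), h => by
    simp only [CTree.dim, CForest.dim, CForest.length] at h
    rw [CTree.barD_node, CForest.barD_cons, CForest.barD_cons, CForest.barD_last, CForest.nest_eq,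
      CForest.nest_eq, CForest.cut_last, CForest.cut_cons, CForest.cut_last,
      CTree.barD_eq_zero (t := t) (by omega), CTree.barD_eq_zero (t := u) (by omega),
      CTree.barD_eq_zero (t := v) (by omega), show t.dim = 0 by omega]
    simp [CForest.join]
  | .node t (.cons u (.cons v w)), h => by
    have := w.length_pos
    simp only [CTree.dim, CForest.dim, CForest.length] at h
    omega
  | .half (.last t), h => by
    simp only [CTree.dim, CForest.dim, CForest.length] at h
    rw [CTree.barD_half, CForest.barD_last, CForest.paint_eq_cut, CForest.cut_last]
    simp [coeffSum_halfL, coeffSum_lastL, CForest.join,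
      CTree.coeffSum_barD (k := k) t (by omega)]
  | .half (.cons t (.last u)), h => by
    simp only [CTree.dim, CForest.dim, CForest.length] at h
    rw [CTree.barD_half, CForest.barD_cons, CForest.barD_last, CForest.paint_eq_cut,
      CForest.cut_cons, CForest.cut_last, CForest.nest_eq, CForest.cut_last, CForest.paint_eq_cut,
      CForest.cut_last, CTree.barD_eq_zero (t := t) (by omega),
      CTree.barD_eq_zero (t := u) (by omega)]
    simp [CForest.join]
  | .half (.cons t (.cons u w)), h => by
    have := w.length_pos
    simp only [CTree.dim, CForest.dim, CForest.length] at h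
    omega

mutual
  theorem CTree.eps_eq_zero {p : Bool} {c : Color} : (t : CTree p c) → t.dim = 0 → t.eps = 0
    | .leaf, _ => rfl
    | .node t ts, h => by
      simp only [CTree.dim] at h
      simp [CTree.eps, t.eps_eq_zero (by omega), ts.eps_eq_zero (by omega),
        show t.dim = 0 by omega]
    | .half ts, h => by
      simp only [CTree.dim] at h
      simp [CTree.eps, ts.eps_eq_zero (by omega)]
  theorem CForest.eps_eq_zero {p : Bool} {c : Color} : (w : CForest p c) → w.dim = 0 → w.eps = 0
    | .last t, h => t.eps_eq_zero h
    | .cons t ts, h => by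
      simp only [CForest.dim] at h
      simp [CForest.eps, t.eps_eq_zero (by omega), ts.eps_eq_zero (by omega),
        show t.dim = 0 by omega]
end

theorem CTree.coeffSum_d {k : Type*} [CommRing k] {p : Bool} {c : Color} {t : CTree p c}
    (h : t.dim ≤ 1) : coeffSum (t.d k) = 0 := by
  rw [CTree.d_eq_barD, map_smul]
  have : coeffSum (signTwist CTree.eps (t.barD k)) = coeffSum (t.barD k) := by
    refine LinearMap.eq_of_mem_supported (M := k) (f := coeffSum.comp (signTwist CTree.eps))
      (g := coeffSum) (fun u hu => ?_) t.barD_mem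
    have : u.eps = 0 := u.eps_eq_zero (by have := hu.1; omega)
    simp [this]
  rw [this, CTree.coeffSum_barD t h, smul_zero]

/-! ### Spines -/

/-- The path from the root to the right leaf of a tree. Every branch off this path is replaced by
its number of leaves; the branches at a vertex are listed from left to right. The first branch of
a vertex `μ` is listed separately, since `μ` has at least one. -/
inductive Spine : Bool → Type
  | leaf : Spine false
  | node {p : Bool} (b : ℕ) (bs : List ℕ) (u : Spine p) : Spine p
  | half (bs : List ℕ) (u : Spine false) : Spine true

namespace Spine

/-- Number of leaves, the right leaf excluded. -/
def total {p : Bool} : Spine p → ℕ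
  | .leaf => 0
  | .node b bs u => b + bs.sum + u.total
  | .half bs u => bs.sum + u.total

/-- Dimension of the corresponding face of the freehedron. -/
def dim {p : Bool} : Spine p → ℕ
  | .leaf => 0
  | .node _ bs u => bs.length + u.dim
  | .half bs u => bs.length + u.dim

/-- All branches have leaves. -/
def Pos {p : Bool} : Spine p → Prop
  | .leaf => True
  | .node b bs u => (0 < b ∧ ∀ x ∈ bs, 0 < x) ∧ u.Pos
  | .half bs u => (∀ x ∈ bs, 0 < x) ∧ u.Pos

end Spine

/-- The numbers of leaves of all trees of a word except the last. -/
def CForest.heads {p : Bool} {c : Color} : CForest p c → List ℕ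
  | .last _ => []
  | .cons t ts => t.leaves :: ts.heads

mutual
  /-- The spine of a tree. -/
  def CTree.spine {p : Bool} {c : Color} : CTree p c → Spine p
    | .leaf => .leaf
    | .node t ts => .node t.leaves ts.heads ts.spine
    | .half ts => .half ts.heads ts.spine
  /-- The spine of the last tree of a word. -/
  def CForest.spine {p : Bool} {c : Color} : CForest p c → Spine p
    | .last t => t.spine
    | .cons _ ts => ts.spine
end

mutual
  /-- The total dimension of the branches off the spine. -/
  def CTree.offDim {p : Bool} {c : Color} : CTree p c → ℕ
    | .leaf => 0
    | .node t ts => t.dim + ts.offDim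
    | .half ts => ts.offDim
  /-- The same for words, all letters but the last being off the spine. -/
  def CForest.offDim {p : Bool} {c : Color} : CForest p c → ℕ
    | .last t => t.offDim
    | .cons t ts => t.dim + ts.offDim
end

theorem CForest.length_heads {p : Bool} {c : Color} : (w : CForest p c) →
    w.heads.length + 1 = w.length
  | .last t => rfl
  | .cons t ts => by simp [heads, length, length_heads ts]

mutual
  theorem CTree.dim_eq_spine {p : Bool} {c : Color} : (t : CTree p c) →
      t.dim = t.spine.dim + t.offDim
    | .leaf => rfl
    | .node t ts => by
      have := ts.length_heads
      simp only [CTree.dim, CTree.spine, Spine.dim, CTree.offDim, ts.dim_eq_spine]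
      omega
    | .half ts => by
      have := ts.length_heads
      simp only [CTree.dim, CTree.spine, Spine.dim, CTree.offDim, ts.dim_eq_spine]
      omega
  theorem CForest.dim_eq_spine {p : Bool} {c : Color} : (w : CForest p c) →
      w.dim = w.spine.dim + w.offDim
    | .last t => t.dim_eq_spine
    | .cons t ts => by
      simp only [CForest.dim, CForest.spine, CForest.offDim, ts.dim_eq_spine]
      omega
end

mutual
  theorem CTree.leaves_eq_spine {p : Bool} {c : Color} : (t : CTree p c) →
      t.leaves = t.spine.total + 1
    | .leaf => rfl
    | .node t ts => by
      simp only [CTree.leaves, CTree.spine, Spine.total, ts.leaves_eq_spine]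
      omega
    | .half ts => by
      simp only [CTree.leaves, CTree.spine, Spine.total, ts.leaves_eq_spine]
  theorem CForest.leaves_eq_spine {p : Bool} {c : Color} : (w : CForest p c) →
      w.leaves = w.heads.sum + w.spine.total + 1
    | .last t => by
      simp [CForest.leaves, CForest.spine, CForest.heads, t.leaves_eq_spine]
    | .cons t ts => by
      simp only [CForest.leaves, CForest.spine, CForest.heads, ts.leaves_eq_spine, List.sum_cons]
      omega
end

theorem CForest.heads_pos {p : Bool} {c : Color} : (w : CForest p c) → ∀ x ∈ w.heads, 0 < x
  | .last t => by simp [heads]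
  | .cons t ts => by
    simp only [heads, List.mem_cons, forall_eq_or_imp]
    exact ⟨t.leaves_pos, ts.heads_pos⟩

mutual
  theorem CTree.spine_pos {p : Bool} {c : Color} : (t : CTree p c) → t.spine.Pos
    | .leaf => trivial
    | .node t ts => ⟨⟨t.leaves_pos, ts.heads_pos⟩, ts.spine_pos⟩
    | .half ts => ⟨ts.heads_pos, ts.spine_pos⟩
  theorem CForest.spine_pos {p : Bool} {c : Color} : (w : CForest p c) → w.spine.Pos
    | .last t => t.spine_pos
    | .cons _ ts => ts.spine_pos
end

mutual
  theorem CTree.eps_eq_zero_of_offDim {p : Bool} {c : Color} : (t : CTree p c) →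
      t.offDim = 0 → t.eps = 0
    | .leaf, _ => rfl
    | .node t ts, h => by
      simp only [CTree.offDim, Nat.add_eq_zero_iff] at h
      simp [CTree.eps, t.eps_eq_zero h.1, ts.eps_eq_zero_of_offDim h.2, h.1]
    | .half ts, h => ts.eps_eq_zero_of_offDim h
  theorem CForest.eps_eq_zero_of_offDim {p : Bool} {c : Color} : (w : CForest p c) →
      w.offDim = 0 → w.eps = 0
    | .last t, h => t.eps_eq_zero_of_offDim h
    | .cons t ts, h => by
      simp only [CForest.offDim, Nat.add_eq_zero_iff] at h
      simp [CForest.eps, t.eps_eq_zero h.1, ts.eps_eq_zero_of_offDim h.2, h.1]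
end

/-! ### The reduced differential -/

/-- `x` in dimension zero, and `0` in positive dimension. -/
def atZero {M : Type*} [Zero M] (n : ℕ) (x : M) : M :=
  match n with
  | 0 => x
  | _ + 1 => 0

@[simp] theorem atZero_zero {M : Type*} [Zero M] (x : M) : atZero 0 x = x := rfl

theorem atZero_pos {M : Type*} [Zero M] {n : ℕ} (h : 0 < n) (x : M) : atZero n x = 0 := by
  cases n with
  | zero => omega
  | succ n => rfl

theorem map_atZero {k M N : Type*} [CommRing k] [AddCommGroup M] [AddCommGroup N] [Module k M]
    [Module k N] (f : M →ₗ[k] N) (n : ℕ) (x : M) : f (atZero n x) = atZero n (f x) := by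
  cases n with
  | zero => rfl
  | succ n => exact map_zero f

theorem atZero_atZero {M : Type*} [Zero M] (m n : ℕ) (x : M) :
    atZero m (atZero n x) = atZero (m + n) x := by
  cases m with
  | zero => simp
  | succ m => rw [atZero_pos (by omega), atZero_pos (by omega)]

section

variable {k : Type*} [CommRing k] {p : Bool} {c : Color}

/-- The reduction of trees to spines: trees with branches of positive dimension are killed. -/
def redT : CMod k p c →ₗ[k] (Spine p →₀ k) :=
  Finsupp.linearCombination k fun t => atZero t.offDim (Finsupp.single t.spine 1)

/-- The reduction of words. -/
def redW : CTensor k p c →ₗ[k] (List ℕ × Spine p →₀ k) :=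
  Finsupp.linearCombination k fun w =>
    atZero w.offDim (Finsupp.single (w.heads, w.spine) 1)

theorem redT_single (t : CTree p c) : redT (Finsupp.single t (1 : k)) =
    atZero t.offDim (Finsupp.single t.spine 1) := by simp [redT]

theorem redW_single (w : CForest p c) : redW (Finsupp.single w (1 : k)) =
    atZero w.offDim (Finsupp.single (w.heads, w.spine) 1) := by simp [redW]

namespace Spine

/-- Adding a branch on the left. -/
def consL (b : ℕ) : (List ℕ × Spine p →₀ k) →ₗ[k] (List ℕ × Spine p →₀ k) :=
  Finsupp.lmapDomain k k fun y => (b :: y.1, y.2)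

/-- Words without branches. -/
def lastL : (Spine p →₀ k) →ₗ[k] (List ℕ × Spine p →₀ k) :=
  Finsupp.lmapDomain k k fun u => ([], u)

/-- The vertex `μ` with given branches, zero if there is no branch. -/
def join (k : Type*) [CommRing k] {p : Bool} : List ℕ × Spine p → (Spine p →₀ k)
  | ([], _) => 0
  | (b :: bs, u) => Finsupp.single (.node b bs u) 1

/-- Linear extension of `join`. -/
def joinL : (List ℕ × Spine p →₀ k) →ₗ[k] (Spine p →₀ k) :=
  Finsupp.linearCombination k (join k)

/-- The vertex `f` with given branches. -/
def halfL : (List ℕ × Spine false →₀ k) →ₗ[k] (Spine true →₀ k) :=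
  Finsupp.lmapDomain k k fun y => .half y.1 y.2

/-- The sum over all ways to paint an initial part of the branches. -/
def paint (k : Type*) [CommRing k] (u : Spine false) : List ℕ → (List ℕ × Spine true →₀ k)
  | [] => Finsupp.single ([], .half [] u) 1
  | b :: bs => Finsupp.single ([], .half (b :: bs) u) 1 + consL b (paint k u bs)

/-- Merging a branch with the next one. -/
def merge (k : Type*) [CommRing k] {p : Bool} (b : ℕ) (u : Spine p) :
    List ℕ → (List ℕ × Spine p →₀ k)
  | [] => 0
  | b' :: bs => Finsupp.single ((b + b') :: bs, u) 1

/-- The differential of a word of branches on the spine `u`, in terms of the differential of `u`. -/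
def wordD (k : Type*) [CommRing k] {p : Bool} (du : Spine p →₀ k) (u : Spine p) :
    List ℕ → (List ℕ × Spine p →₀ k)
  | [] => lastL du
  | b :: bs => - consL b (wordD k du u bs) + merge k b u bs + Finsupp.single ([], .node b bs u) 1

/-- The differential of `T`, in terms of spines. -/
def D (k : Type*) [CommRing k] {p : Bool} : Spine p → (Spine p →₀ k)
  | .leaf => 0
  | .node b bs u => - joinL (wordD k (u.D k) u (b :: bs))
  | .half bs u => halfL (wordD k (u.D k) u bs) - joinL (paint k u bs)

/-- The differential of `T`, as a linear map. -/
def DL : (Spine p →₀ k) →ₗ[k] (Spine p →₀ k) := Finsupp.linearCombination k (D k)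

end Spine

theorem redW_consL_single (t : CTree p .a) (v : CTensor k p c) :
    redW (consL (Finsupp.single t (1 : k)) v) =
      atZero t.dim (Spine.consL t.leaves (redW v)) := by
  have h : ∀ w : CForest p c, redW (consL (Finsupp.single t (1 : k)) (Finsupp.single w 1)) =
      atZero t.dim (Spine.consL t.leaves (redW (Finsupp.single w 1))) := by
    intro w
    simp [redW_single, map_atZero, atZero_atZero, CForest.offDim, CForest.heads, CForest.spine,
      Spine.consL, Finsupp.mapDomain_single]
  rcases Nat.eq_zero_or_pos t.dim with h0 | h0
  · simp only [h0, atZero_zero] at h ⊢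
    exact LinearMap.congr_fun (M₃ := List ℕ × Spine p →₀ k)
      (f := redW.comp (consL (Finsupp.single t (1 : k))))
      (g := (Spine.consL t.leaves).comp redW) (LinearMap.ext_single_one h) v
  · simp only [atZero_pos h0] at h ⊢
    exact LinearMap.congr_fun (M₃ := List ℕ × Spine p →₀ k)
      (f := redW.comp (consL (Finsupp.single t (1 : k))))
      (g := 0) (LinearMap.ext_single_one h) v

theorem redW_lastL (x : CMod k p c) : redW (lastL x) = Spine.lastL (redT x) := by
  refine LinearMap.congr_fun (f := redW.comp lastL)
    (g := Spine.lastL.comp redT) (LinearMap.ext_single_one fun t => ?_) x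
  simp [redW_single, redT_single, CForest.offDim, CForest.heads, CForest.spine, map_atZero,
    Spine.lastL, Finsupp.mapDomain_single]

theorem redT_joinL (v : CTensor k p c) : redT (joinL v) = Spine.joinL (redW v) := by
  refine LinearMap.congr_fun (f := redT.comp joinL)
    (g := Spine.joinL.comp redW) (LinearMap.ext_single_one fun w => ?_) v
  cases w with
  | last t =>
    simp [redW_single, CForest.join, CForest.offDim, CForest.heads, map_atZero,
        Spine.joinL, Spine.join]
    cases t.offDim <;> rfl
  | cons t ts =>
    simp [CForest.join, redT_single, redW_single, CTree.offDim, CForest.offDim, map_atZero,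
      CForest.heads, CForest.spine, CTree.spine, Spine.joinL, Spine.join]

theorem redT_halfL (v : CTensor k false c) : redT (halfL v) = Spine.halfL (redW v) := by
  refine LinearMap.congr_fun (f := redT.comp halfL)
    (g := Spine.halfL.comp redW) (LinearMap.ext_single_one fun w => ?_) v
  simp [redW_single, redT_single, CTree.offDim, CTree.spine, map_atZero, Spine.halfL,
      Finsupp.mapDomain_single]

/-- The differentials of the branches do not contribute: a branch of dimension one gives the two
ends of an edge, with opposite signs. -/
theorem redW_consL_barD (t : CTree p .a) (w : CForest p c) :
    redW (consL (t.barD k) (Finsupp.single w 1)) = 0 := by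
  by_cases h : t.dim ≤ 1
  · have : redW (consL (t.barD k) (Finsupp.single w 1)) =
        coeffSum (t.barD k) • Spine.consL t.leaves (redW (Finsupp.single w 1)) := by
      refine LinearMap.eq_of_mem_supported
        (M := List ℕ × Spine p →₀ k) (f := redW.comp (consL.flip (Finsupp.single w (1 : k))))
        (g := coeffSum.smulRight (Spine.consL t.leaves (redW (Finsupp.single w (1 : k)))))
        (fun u hu => ?_) t.barD_mem
      have hu1 := hu.1
      simp only [LinearMap.comp_apply, LinearMap.flip_apply, redW_consL_single,
        LinearMap.smulRight_apply, coeffSum_single, one_smul, ← hu.2]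
      rw [show u.dim = 0 by omega, atZero_zero]
    rw [this, CTree.coeffSum_barD t h, zero_smul]
  · refine (LinearMap.eq_of_mem_supported
        (M := List ℕ × Spine p →₀ k) (f := redW.comp (consL.flip (Finsupp.single w (1 : k))))
        (g := 0) (fun u hu => ?_) t.barD_mem)
    have hu1 := hu.1
    simp only [LinearMap.comp_apply, LinearMap.flip_apply, redW_consL_single]
    rw [atZero_pos (by omega)]
    rfl

theorem cut_eq_zero {M : Type*} [AddCommMonoid M] {w : CForest p c}
    {f : CForest p .a → CForest p c → M} (h : ∀ a b, f a b = 0) : w.cut f = 0 := by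
  simp [CForest.cut, h]

theorem redW_nest (t : CTree p .a) (w : CForest p c) :
    redW (w.nest k t) = atZero (t.dim + w.offDim) (Spine.merge k t.leaves w.spine w.heads) := by
  cases w with
  | last u =>
    rw [CForest.nest_eq, CForest.cut_last, CForest.heads, Spine.merge, map_zero]
    cases t.dim + (CForest.last u).offDim <;> rfl
  | cons u us =>
    rw [CForest.nest_eq, CForest.cut_cons, map_add, CForest.cut_linearMap, cut_eq_zero, add_zero,
      redW_single]
    · simp only [CForest.offDim, CTree.dim, CForest.dim, CForest.length, CForest.heads,
        CTree.leaves, CForest.leaves, CForest.spine, Spine.merge]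
      rw [Nat.sub_self, zero_add, add_assoc]
    · intro a b
      have := a.length_pos
      rw [redW_single, atZero_pos]
      simp only [CForest.offDim, CTree.dim, CForest.length]
      omega

theorem redW_paint : (w : CForest false c) → redW (w.paint k) =
    atZero w.offDim (Spine.paint k w.spine w.heads)
  | .last t => by
    rw [CForest.paint_eq_cut, CForest.cut_last, add_zero, redW_lastL, redT_single, map_atZero]
    simp [CForest.heads, Spine.paint, CTree.spine, Spine.lastL, CForest.spine, CForest.offDim,
      CTree.offDim, Finsupp.mapDomain_single]
  | .cons t ts => by
    rw [CForest.paint_eq_cut, CForest.cut_cons, map_add, map_add, CForest.cut_linearMap, redW_lastL,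
      redT_single, cut_eq_zero, add_zero, redW_consL_single, redW_paint ts, map_atZero, map_atZero,
      atZero_atZero]
    · simp only [CForest.offDim, CTree.offDim, CTree.dim, CForest.dim, CForest.length, CTree.leaves,
        CForest.leaves, CForest.heads, Spine.paint, CTree.spine, CForest.spine, Nat.sub_self,
        zero_add]
      cases t.dim + ts.offDim <;> simp [Spine.lastL, Finsupp.mapDomain_single, atZero_pos]
    · intro a b
      have := a.length_pos
      rw [redW_consL_single, atZero_pos]
      simp only [CTree.dim, CForest.length]
      omega

theorem redW_barD_cons {t : CTree p .a} {ts : CForest p c}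
    (h : redW (ts.barD k) = atZero ts.offDim (Spine.wordD k (ts.spine.D k) ts.spine ts.heads)) :
    redW ((CForest.cons t ts).barD k) = atZero (CForest.cons t ts).offDim
      (Spine.wordD k ((CForest.cons t ts).spine.D k) (CForest.cons t ts).spine
        (CForest.cons t ts).heads) := by
  rw [CForest.barD_cons, map_add, map_add, map_add, map_smul, redW_consL_barD, redW_consL_single,
    redW_nest, redW_lastL, redT_single, h, map_atZero, map_atZero, atZero_atZero]
  simp only [CForest.offDim, CTree.offDim, CForest.heads, CForest.spine,
    CTree.spine, Spine.wordD]
  rcases Nat.eq_zero_or_pos (t.dim + ts.offDim) with h0 | h0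
  · rw [h0, show t.dim = 0 by omega]
    simp [Spine.lastL, Finsupp.mapDomain_single]
  · simp [atZero_pos h0]

mutual
  theorem CTree.redT_barD (k : Type*) [CommRing k] {p : Bool} {c : Color} : (t : CTree p c) →
      redT (t.barD k) = atZero t.offDim (t.spine.D k)
    | .leaf => by simp [CTree.barD_leaf, CTree.spine, Spine.D, CTree.offDim]
    | .node t ts => by
      rw [CTree.barD_node, map_neg, redT_joinL, redW_barD_cons (CForest.redW_barD k ts)]
      simp only [CTree.offDim, CForest.offDim, CForest.heads, CForest.spine, CTree.spine, Spine.D]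
      cases t.dim + ts.offDim <;> simp [atZero_pos]
    | .half ts => by
      rw [CTree.barD_half, map_sub, redT_halfL, redT_joinL, redW_paint, CForest.redW_barD k ts]
      simp only [CTree.offDim, CTree.spine, Spine.D]
      cases ts.offDim <;> simp [atZero_pos]
  theorem CForest.redW_barD (k : Type*) [CommRing k] {p : Bool} {c : Color} : (w : CForest p c) →
      redW (w.barD k) = atZero w.offDim (Spine.wordD k (w.spine.D k) w.spine w.heads)
    | .last t => by
      rw [CForest.barD_last, redW_lastL, CTree.redT_barD k t, map_atZero]
      simp only [CForest.offDim, CForest.spine, CForest.heads, Spine.wordD]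
    | .cons t ts => redW_barD_cons (CForest.redW_barD k ts)
end

theorem atZero_eps {M : Type*} [AddCommGroup M] [Module k M] (t : CTree p c) (x : M) :
    (-1 : k) ^ t.eps • atZero t.offDim x = atZero t.offDim x := by
  rcases Nat.eq_zero_or_pos t.offDim with h | h
  · simp [t.eps_eq_zero_of_offDim h]
  · simp [atZero_pos h]

theorem redT_signTwist (x : CMod k p c) : redT (signTwist CTree.eps x) = redT x := by
  refine LinearMap.congr_fun (f := redT.comp (signTwist CTree.eps)) (g := redT)
    (LinearMap.ext_single_one fun t => ?_) x
  rw [LinearMap.comp_apply, signTwist_single, map_smul, redT_single, atZero_eps]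

/-- The differential descends to spines. -/
theorem redT_d (t : CTree p c) : redT (t.d k) = atZero t.offDim (t.spine.D k) := by
  rw [CTree.d_eq_barD, map_smul, redT_signTwist, CTree.redT_barD, atZero_eps]

theorem redT_dL (x : CMod k p c) : redT (dL k p c x) = Spine.DL (redT x) := by
  refine LinearMap.congr_fun (f := redT.comp (dL k p c)) (g := Spine.DL.comp redT)
    (LinearMap.ext_single_one fun t => ?_) x
  simp [redT_single, dL, redT_d, Spine.DL, map_atZero]

end

/-! ### Faces of spines -/

mutual
  /-- Codimension one faces of spines. -/
  inductive Spine.Move : ∀ {p : Bool}, Spine p → Spine p → Prop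
    | node {p : Bool} (b b' : ℕ) (bs bs' : List ℕ) (u u' : Spine p)
        (h : WordMove (b' :: bs') u' (b :: bs) u) : Spine.Move (.node b' bs' u') (.node b bs u)
    | half (bs bs' : List ℕ) (u u' : Spine false) (h : WordMove bs' u' bs u) :
        Spine.Move (.half bs' u') (.half bs u)
    /-- Painting the first branches of the vertex `f`. -/
    | paint (b : ℕ) (l r : List ℕ) (u : Spine false) :
        Spine.Move (.node b l (.half r u)) (.half (b :: (l ++ r)) u)
  /-- Codimension one faces of words of branches on a spine. -/
  inductive WordMove : ∀ {p : Bool}, List ℕ → Spine p → List ℕ → Spine p → Prop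
    /-- Merge two adjacent branches. -/
    | merge {p : Bool} (l : List ℕ) (a b : ℕ) (r : List ℕ) (u : Spine p) :
        WordMove (l ++ (a + b) :: r) u (l ++ a :: b :: r) u
    /-- Collect the last branches at a new vertex `μ`. -/
    | nest {p : Bool} (l : List ℕ) (b : ℕ) (r : List ℕ) (u : Spine p) :
        WordMove l (.node b r u) (l ++ b :: r) u
    /-- Pass to a face of the spine. -/
    | inner {p : Bool} (l : List ℕ) (u u' : Spine p) (h : Spine.Move u' u) : WordMove l u' l u
end

theorem wordMove_nil_iff {p : Bool} {bs' : List ℕ} {u' u : Spine p} :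
    WordMove bs' u' [] u ↔ bs' = [] ∧ Spine.Move u' u := by
  constructor
  · intro h
    generalize hx : ([] : List ℕ) = x at h
    cases h with
    | merge l a b r u => simp at hx
    | nest l b r u => simp at hx
    | inner l u u' h =>
      subst hx
      exact ⟨rfl, h⟩
  · rintro ⟨rfl, h⟩
    exact .inner _ _ _ h

theorem WordMove.cons {p : Bool} (b : ℕ) {bs' bs : List ℕ} {u' u : Spine p}
    (h : WordMove bs' u' bs u) : WordMove (b :: bs') u' (b :: bs) u := by
  cases h with
  | merge l a b' r => exact .merge (b :: l) a b' r _
  | nest _ b' r => exact .nest (b :: bs') b' r _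
  | inner _ _ _ h => exact .inner (b :: bs') _ _ h

theorem wordMove_cons_iff {p : Bool} {b : ℕ} {bs' bs : List ℕ} {u' u : Spine p} :
    WordMove bs' u' (b :: bs) u ↔ ((∃ x, WordMove x u' bs u ∧ bs' = b :: x) ∨
      (∃ b₂ r, bs = b₂ :: r ∧ bs' = (b + b₂) :: r ∧ u' = u)) ∨
      bs' = [] ∧ u' = .node b bs u := by
  constructor
  · intro h
    generalize hx : b :: bs = x at h
    cases h with
    | merge l a b' r u =>
      cases l with
      | nil =>
        obtain ⟨rfl, rfl⟩ := by simpa using hx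
        exact .inl (.inr ⟨_, _, rfl, rfl, rfl⟩)
      | cons y l =>
        obtain ⟨rfl, rfl⟩ := by simpa using hx
        exact .inl (.inl ⟨_, .merge l a b' r _, rfl⟩)
    | nest _ b' r =>
      cases bs' with
      | nil =>
        obtain ⟨rfl, rfl⟩ := by simpa using hx
        exact .inr ⟨rfl, rfl⟩
      | cons y l =>
        obtain ⟨rfl, rfl⟩ := by simpa using hx
        exact .inl (.inl ⟨_, .nest l b' r _, rfl⟩)
    | inner l u u' h =>
      subst hx
      exact .inl (.inl ⟨_, .inner _ _ _ h, rfl⟩)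
  · rintro ((⟨x, h, rfl⟩ | ⟨b₂, r, rfl, rfl, rfl⟩) | ⟨rfl, rfl⟩)
    · exact h.cons b
    · exact .merge [] b b₂ r _
    · exact .nest [] b bs u

theorem Spine.move_node_iff {p : Bool} {x : Spine p} {b : ℕ} {bs : List ℕ} {u : Spine p} :
    Spine.Move x (.node b bs u) ↔
      ∃ b' bs' u', x = .node b' bs' u' ∧ WordMove (b' :: bs') u' (b :: bs) u := by
  constructor
  · intro h
    cases h with
    | node b b' bs bs' u u' h => exact ⟨_, _, _, rfl, h⟩
  · rintro ⟨b', bs', u', rfl, h⟩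
    exact .node _ _ _ _ _ _ h

theorem Spine.move_half_iff {x : Spine true} {bs : List ℕ} {u : Spine false} :
    Spine.Move x (.half bs u) ↔ (∃ bs' u', WordMove bs' u' bs u ∧ x = .half bs' u') ∨
      ∃ b l r, bs = b :: (l ++ r) ∧ x = .node b l (.half r u) := by
  constructor
  · intro h
    generalize hy : Spine.half bs u = y at h
    cases h with
    | node b b' bs bs' u u' h => simp at hy
    | half bs bs' u u' h =>
      obtain ⟨rfl, rfl⟩ := by simpa using hy
      exact .inl ⟨_, _, h, rfl⟩
    | paint b l r u =>
      obtain ⟨rfl, rfl⟩ := by simpa using hy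
      exact .inr ⟨_, _, _, rfl, rfl⟩
  · rintro (⟨bs', u', h, rfl⟩ | ⟨b, l, r, rfl, rfl⟩)
    · exact .half _ _ _ _ h
    · exact .paint _ _ _ _

theorem Spine.not_move_leaf {x : Spine false} : ¬ Spine.Move x .leaf := by
  intro h
  cases h

/-! #### The differential of spines as an incidence function -/

theorem Spine.joinL_apply_node {k : Type*} [CommRing k] {p : Bool} (v : List ℕ × Spine p →₀ k)
    (b : ℕ) (bs : List ℕ) (u : Spine p) : joinL v (.node b bs u) = v (b :: bs, u) := by
  classical
  refine LinearMap.congr_fun (f := (Finsupp.lapply (Spine.node b bs u)).comp joinL)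
    (g := Finsupp.lapply (b :: bs, u)) (LinearMap.ext_single_one fun w => ?_) v
  rcases w with ⟨_ | ⟨b', bs'⟩, u'⟩ <;> simp [joinL, join, Finsupp.single_apply, and_assoc]

theorem Spine.joinL_apply_of_ne {k : Type*} [CommRing k] {p : Bool} (v : List ℕ × Spine p →₀ k)
    {x : Spine p} (h : ∀ b bs u, x ≠ .node b bs u) : joinL v x = 0 := by
  classical
  refine LinearMap.congr_fun (f := (Finsupp.lapply x).comp joinL)
    (g := 0) (LinearMap.ext_single_one fun w => ?_) v
  rcases w with ⟨_ | ⟨b', bs'⟩, u'⟩ <;> simp [joinL, join, (h _ _ _).symm]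

theorem IsSignedIndicator.spineJoinL {p : Bool} {P : List ℕ × Spine p → Prop}
    {v : List ℕ × Spine p →₀ ℤ} (h : IsSignedIndicator P v) :
    IsSignedIndicator (fun x => ∃ b bs u, x = Spine.node b bs u ∧ P (b :: bs, u))
      (Spine.joinL v) := by
  intro x
  by_cases hx : ∃ b bs u, x = Spine.node b bs u
  · obtain ⟨b, bs, u, rfl⟩ := hx
    rw [Spine.joinL_apply_node]
    have := h (b :: bs, u)
    constructor
    · rintro ⟨b', bs', u', e, hP⟩
      obtain ⟨rfl, rfl, rfl⟩ := by simpa using e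
      exact this.1 hP
    · exact fun hn => this.2 fun hP => hn ⟨b, bs, u, rfl, hP⟩
  · refine ⟨fun ⟨b, bs, u, e, _⟩ => absurd ⟨b, bs, u, e⟩ hx, fun _ => ?_⟩
    exact Spine.joinL_apply_of_ne _ fun b bs u e => hx ⟨b, bs, u, e⟩

theorem Spine.isSignedIndicator_wordD {p : Bool} {u : Spine p}
    (hu : IsSignedIndicator (Spine.Move · u) (u.D ℤ)) : ∀ {bs : List ℕ}, (∀ x ∈ bs, 0 < x) →
    IsSignedIndicator (fun y => WordMove y.1 y.2 bs u) (wordD ℤ (u.D ℤ) u bs)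
  | [], _ => by
    refine (hu.mapDomain (f := fun u => (([] : List ℕ), u)) ?_).congr ?_
    · intro a b h; simpa using h
    · rintro ⟨bs', u'⟩
      rw [wordMove_nil_iff]
      simp [Prod.ext_iff, and_comm]
  | b :: bs, hpos => by
    have hm : IsSignedIndicator (fun y : List ℕ × Spine p => ∃ b₂ r, bs = b₂ :: r ∧
        y.1 = (b + b₂) :: r ∧ y.2 = u) (merge ℤ b u bs) := by
      cases bs with
      | nil => exact IsSignedIndicator.zero.congr (by simp)
      | cons b₂ r =>
        refine (IsSignedIndicator.single ((b + b₂) :: r, u)).congr fun y => ?_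
        simp [Prod.ext_iff]
    have ih := isSignedIndicator_wordD hu (bs := bs) fun x hx => hpos x (by simp [hx])
    refine ((((ih.mapDomain (f := fun y => (b :: y.1, y.2)) ?_).neg.add hm ?_).add
      (IsSignedIndicator.single ([], .node b bs u)) ?_).congr ?_)
    · rintro ⟨a, x⟩ ⟨a', x'⟩ h; simpa using h
    · rintro ⟨_, _⟩ ⟨⟨a, x⟩, _, e⟩ ⟨b₂, r, rfl, e', _⟩
      simp only [Prod.mk.injEq] at e e'
      have h1 := hpos b₂ (by simp)
      rw [e.1, List.cons.injEq] at e'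
      omega
    · rintro ⟨_, _⟩ (⟨⟨a, x⟩, _, e⟩ | ⟨b₂, r, rfl, e', _⟩) e''
      · simp only [Prod.mk.injEq] at e e''
        rw [e.1] at e''
        simp at e''
      · simp only [Prod.mk.injEq] at e' e''
        rw [e'] at e''
        simp at e''
    · rintro ⟨bs', u'⟩
      rw [wordMove_cons_iff]
      simp only [Prod.mk.injEq, Prod.exists]
      constructor
      · rintro ((⟨a, x, h, rfl, rfl⟩ | h) | h)
        · exact .inl (.inl ⟨_, h, rfl⟩)
        · exact .inl (.inr h)
        · exact .inr h
      · rintro ((⟨a, h, rfl⟩ | h) | h)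
        · exact .inl (.inl ⟨_, _, h, rfl, rfl⟩)
        · exact .inl (.inr h)
        · exact .inr h

theorem Spine.isSignedIndicator_paint (u : Spine false) : ∀ bs : List ℕ,
    IsSignedIndicator (fun y => ∃ l r, bs = l ++ r ∧ y = (l, .half r u)) (paint ℤ u bs)
  | [] => (IsSignedIndicator.single ([], Spine.half [] u)).congr fun y => by
      constructor
      · rintro rfl
        exact ⟨[], [], rfl, rfl⟩
      · rintro ⟨l, r, e, rfl⟩
        obtain ⟨rfl, rfl⟩ := by simpa using e
        rfl
  | b :: bs => by
    refine (((IsSignedIndicator.single ([], .half (b :: bs) u)).add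
      ((isSignedIndicator_paint u bs).mapDomain (f := fun y => (b :: y.1, y.2)) ?_) ?_).congr ?_)
    · rintro ⟨a, x⟩ ⟨a', x'⟩ h; simpa using h
    · rintro _ rfl ⟨⟨a, x⟩, _, e⟩
      simp at e
    · rintro ⟨bs', u'⟩
      constructor
      · rintro (h | ⟨y, ⟨l, r, rfl, rfl⟩, h⟩)
        · exact ⟨[], _, rfl, h⟩
        · exact ⟨b :: l, r, rfl, h⟩
      · rintro ⟨_ | ⟨x, l⟩, r, e, h⟩
        · simp only [List.nil_append] at e
          subst e
          exact .inl h
        · obtain ⟨rfl, rfl⟩ := by simpa using e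
          exact .inr ⟨_, ⟨l, r, rfl, rfl⟩, h⟩

/-- The incidence numbers of spines are `±1` between a face and its codimension one faces, and
vanish otherwise. -/
theorem Spine.isSignedIndicator_D {p : Bool} : (u : Spine p) → u.Pos →
    IsSignedIndicator (Spine.Move · u) (u.D ℤ)
  | .leaf, _ => IsSignedIndicator.zero.congr fun _ => (iff_false_intro not_move_leaf).symm
  | .node b bs u, h => by
    refine ((isSignedIndicator_wordD (u.isSignedIndicator_D h.2) (bs := b :: bs)
      ?_).spineJoinL.neg).congr fun _ => move_node_iff.symm
    simpa using h.1
  | .half bs u, h => by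
    rw [D, sub_eq_add_neg]
    refine (((isSignedIndicator_wordD (u.isSignedIndicator_D h.2) h.1).mapDomain
      (f := fun y => Spine.half y.1 y.2) ?_).add
      (isSignedIndicator_paint u bs).spineJoinL.neg ?_).congr fun x => ?_
    · rintro ⟨a, x⟩ ⟨a', x'⟩ h; simpa using h
    · rintro _ ⟨y, _, rfl⟩ ⟨_, _, _, e, _⟩
      simp at e
    · rw [move_half_iff]
      constructor
      · rintro (⟨⟨a, y⟩, h, rfl⟩ | ⟨b', bs', u', rfl, l, r, rfl, e⟩)
        · exact .inl ⟨_, _, h, rfl⟩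
        · obtain ⟨rfl, rfl⟩ := by simpa using e
          exact .inr ⟨b', bs', r, by simp, rfl⟩
      · rintro (⟨a, y, h, rfl⟩ | ⟨b, l, r, rfl, rfl⟩)
        · exact .inl ⟨(a, y), h, rfl⟩
        · exact .inr ⟨b, l, _, rfl, b :: l, r, by simp, rfl⟩

/-! #### Lifting faces of spines to trees -/

/-- A codimension one face of the spine of a tree all of whose branches have dimension zero is the
spine of a codimension one face of the tree, since it has a nonzero coefficient in the
differential. -/
theorem CTree.exists_contract_of_move {p : Bool} {c : Color} {t : CTree p c} (h : t.offDim = 0)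
    {x : Spine p} (hx : Spine.Move x t.spine) : ∃ u, Contract u t ∧ u.spine = x := by
  have h1 := (t.spine.isSignedIndicator_D t.spine_pos).ne_zero_iff.2 hx
  have h2 := redT_d (k := ℤ) t
  rw [h, atZero_zero] at h2
  rw [← h2] at h1
  by_contra hn
  push Not at hn
  refine h1 ?_
  refine LinearMap.eq_of_mem_supported (k := ℤ) (s := {u | Contract u t})
    (f := (Finsupp.lapply x).comp redT) (g := 0) (fun u hu => ?_) ?_
  · have := hn u hu
    simp only [LinearMap.comp_apply, redT_single]
    cases u.offDim <;> simp [atZero_pos, this]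
  · rw [Finsupp.mem_supported]
    intro u hu
    exact t.isSignedIndicator_d.ne_zero_iff.1 (Finsupp.mem_support_iff.1 hu)

/-- Every tree of positive dimension has a codimension one face. -/
theorem CTree.exists_contract {p : Bool} {c : Color} : (t : CTree p c) → 0 < t.dim →
      ∃ u, Contract u t
    | .leaf, h => by simp [CTree.dim] at h
    | .node t (.cons t₂ r), _ => ⟨_, contract_node_iff.2 ⟨_, _, rfl, .inl
        (flatten_iff.2 (.inr (.inl ⟨.last t₂, r, by simp [CForest.append], rfl⟩)))⟩⟩
    | .node t (.last u), h => by
      rcases Nat.eq_zero_or_pos t.dim with h0 | h0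
      · obtain ⟨u', hu⟩ := u.exists_contract (by
          simpa [CTree.dim, CForest.dim, CForest.length, h0] using h)
        exact ⟨_, contract_node_iff.2 ⟨_, _, rfl, .inr (.tail t _ _ (.last _ _ hu))⟩⟩
      · obtain ⟨t', ht⟩ := t.exists_contract h0
        exact ⟨_, contract_node_iff.2 ⟨_, _, rfl, .inr (.head _ _ (.last u) ht)⟩⟩
    | .half (.cons t r), _ => ⟨_, contract_half_iff.2 (.inr ⟨.half (.last t), .last (.half r), rfl,
        ([.last t], r), (CForest.mem_blocks _).2
          (by simp [CForest.flat_cons, CForest.flat_nil, CForest.append]), rfl⟩)⟩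
    | .half (.last u), h => by
      obtain ⟨u', hu⟩ := u.exists_contract (by
          simpa [CTree.dim, CForest.dim, CForest.length] using h)
      exact ⟨_, contract_half_iff.2 (.inl ⟨_, rfl, .inr (.last _ _ hu)⟩)⟩

mutual
  /-- A branch of positive dimension can be replaced by one of its faces. -/
  theorem CTree.exists_contract_offDim {p : Bool} {c : Color} : (t : CTree p c) → 0 < t.offDim →
      ∃ u, Contract u t ∧ u.spine = t.spine
    | .leaf, h => by simp [CTree.offDim] at h
    | .node t ts, h => by
      rcases Nat.eq_zero_or_pos t.dim with h0 | h0
      · obtain ⟨w, hw, h1, h2⟩ := CForest.exists_contract_offDim ts (by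
          simpa [CTree.offDim, h0] using h)
        exact ⟨.node t w, contract_node_iff.2 ⟨_, _, rfl, .inr (.tail _ _ _ hw)⟩, by
          simp [CTree.spine, h1, h2]⟩
      · obtain ⟨u, hu⟩ := t.exists_contract h0
        exact ⟨.node u ts, contract_node_iff.2 ⟨_, _, rfl, .inr (.head _ _ _ hu)⟩, by
          simp [CTree.spine, hu.leaves_eq]⟩
    | .half ts, h => by
      obtain ⟨w, hw, h1, h2⟩ := CForest.exists_contract_offDim ts h
      exact ⟨.half w, contract_half_iff.2 (.inl ⟨_, rfl, .inr hw⟩), by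
        simp [CTree.spine, h1, h2]⟩
  theorem CForest.exists_contract_offDim {p : Bool} {c : Color} : (w : CForest p c) →
      0 < w.offDim → ∃ v, ContractIn v w ∧ v.heads = w.heads ∧ v.spine = w.spine
    | .last t, h => by
      obtain ⟨u, hu, h1⟩ := CTree.exists_contract_offDim t h
      exact ⟨.last u, .last _ _ hu, rfl, h1⟩
    | .cons t ts, h => by
      rcases Nat.eq_zero_or_pos t.dim with h0 | h0
      · obtain ⟨w, hw, h1, h2⟩ := CForest.exists_contract_offDim ts (by
          simpa [CForest.offDim, h0] using h)
        exact ⟨.cons t w, .tail _ _ _ hw, by simp [CForest.heads, h1], h2⟩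
      · obtain ⟨u, hu⟩ := t.exists_contract h0
        exact ⟨.cons u ts, .head _ _ _ hu, by simp [CForest.heads, hu.leaves_eq], rfl⟩
end

theorem WordMove.spec_of {p : Bool} {l' l : List ℕ} {u' u : Spine p}
    (hu : Spine.Move u' u → u'.dim + 1 = u.dim ∧ u'.total = u.total ∧ (u.Pos → u'.Pos))
    (h : WordMove l' u' l u) :
    l'.length + u'.dim + 1 = l.length + u.dim ∧ l'.sum + u'.total = l.sum + u.total ∧
      ((∀ x ∈ l, 0 < x) ∧ u.Pos → (∀ x ∈ l', 0 < x) ∧ u'.Pos) := by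
  cases h with
  | merge l a b r u =>
    refine ⟨?_, ?_, ?_⟩
    · simp; omega
    · simp; omega
    · simp only [List.mem_append, List.mem_cons]
      rintro ⟨h1, h2⟩
      refine ⟨?_, h2⟩
      rintro x (hx | rfl | hx)
      · exact h1 x (.inl hx)
      · have := h1 a (by simp)
        omega
      · exact h1 x (by simp [hx])
  | nest _ b r =>
    refine ⟨?_, ?_, ?_⟩
    · simp [Spine.dim]; omega
    · simp [Spine.total]; omega
    · simp only [List.mem_append, List.mem_cons, Spine.Pos]
      rintro ⟨h1, h2⟩
      exact ⟨fun x hx => h1 x (.inl hx), ⟨h1 b (by simp), fun x hx => h1 x (by simp [hx])⟩, h2⟩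
  | inner _ _ _ h =>
    have := hu h
    exact ⟨by omega, by omega, fun h => ⟨h.1, this.2.2 h.2⟩⟩

theorem Spine.move_spec {p : Bool} : (u : Spine p) → ∀ u', Spine.Move u' u →
    u'.dim + 1 = u.dim ∧ u'.total = u.total ∧ (u.Pos → u'.Pos)
  | .leaf, u', h => absurd h Spine.not_move_leaf
  | .node b bs u, x, h => by
    obtain ⟨b', bs', u', rfl, hw⟩ := Spine.move_node_iff.1 h
    have := hw.spec_of (Spine.move_spec u u')
    simp only [List.length_cons, List.sum_cons, List.mem_cons, forall_eq_or_imp] at this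
    refine ⟨?_, ?_, ?_⟩
    · simp only [Spine.dim]; omega
    · simp only [Spine.total]; omega
    · simpa only [Spine.Pos, and_imp] using this.2.2
  | .half bs u, x, h => by
    rcases Spine.move_half_iff.1 h with ⟨bs', u', hw, rfl⟩ | ⟨b, l, r, rfl, rfl⟩
    · simpa only [Spine.dim, Spine.total, Spine.Pos, and_imp] using
        hw.spec_of (Spine.move_spec u u')
    · refine ⟨?_, ?_, ?_⟩
      · simp [Spine.dim]; omega
      · simp [Spine.total]; omega
      · simp only [Spine.Pos, List.mem_cons, List.mem_append, forall_eq_or_imp]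
        rintro ⟨⟨h1, h2⟩, h3⟩
        exact ⟨⟨h1, fun x hx => h2 x (.inl hx)⟩, fun x hx => h2 x (.inr hx), h3⟩

/-- The face relation of spines. -/
def Spine.IsFace {p : Bool} (u' u : Spine p) : Prop := Relation.ReflTransGen Spine.Move u' u

/-- The face relation of words of branches on a spine. -/
def WordFace {p : Bool} (y' y : List ℕ × Spine p) : Prop :=
  Relation.ReflTransGen (fun y' y : List ℕ × Spine p => WordMove y'.1 y'.2 y.1 y.2) y' y

theorem WordFace.refl {p : Bool} (y : List ℕ × Spine p) : WordFace y y := Relation.ReflTransGen.refl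

theorem WordFace.cons {p : Bool} (b : ℕ) {y' y : List ℕ × Spine p} (h : WordFace y' y) :
    WordFace (b :: y'.1, y'.2) (b :: y.1, y.2) :=
  Relation.ReflTransGen.lift (fun y : List ℕ × Spine p => (b :: y.1, y.2))
    (fun _ _ h => WordMove.cons b h) _ _ h

theorem WordFace.inner {p : Bool} (l : List ℕ) {u' u : Spine p} (h : Spine.IsFace u' u) :
    WordFace (l, u') (l, u) :=
  Relation.ReflTransGen.lift (fun u => (l, u)) (fun _ _ h => WordMove.inner l _ _ h) _ _ h

theorem WordFace.half {y' y : List ℕ × Spine false} (h : WordFace y' y) :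
    Spine.IsFace (.half y'.1 y'.2) (.half y.1 y.2) :=
  Relation.ReflTransGen.lift (fun y : List ℕ × Spine false => Spine.half y.1 y.2)
    (fun _ _ h => Spine.Move.half _ _ _ _ h) _ _ h

theorem WordFace.node {p : Bool} {b b' : ℕ} {bs bs' : List ℕ} {u u' : Spine p}
    (h : WordFace (b' :: bs', u') (b :: bs, u)) : Spine.IsFace (.node b' bs' u') (.node b bs u) := by
  -- A word that has a nonempty word as a face is nonempty.
  have key : ∀ y, WordFace (b' :: bs', u') y →
      ∃ b bs u, y = (b :: bs, u) ∧ Spine.IsFace (.node b' bs' u') (.node b bs u) := by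
    intro y hy
    induction hy with
    | refl => exact ⟨_, _, _, rfl, .refl⟩
    | tail _ hyz ih =>
      rename_i z _
      obtain ⟨b, bs, u, rfl, ih⟩ := ih
      rcases z with ⟨_ | ⟨b₂, bs₂⟩, u₂⟩
      · rw [wordMove_nil_iff] at hyz
        simp at hyz
      · exact ⟨_, _, _, rfl, ih.tail (.node _ _ _ _ _ _ hyz)⟩
  obtain ⟨_, _, _, e, h⟩ := key _ h
  obtain ⟨⟨rfl, rfl⟩, rfl⟩ := by simpa using e
  exact h

/-- Several adjacent branches can be merged. -/
theorem wordFace_sum {p : Bool} (u : Spine p) (r : List ℕ) : ∀ (l : List ℕ) (x : ℕ),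
    WordFace ((x + l.sum) :: r, u) (x :: (l ++ r), u)
  | [], x => .refl _
  | y :: l, x => by
    have h := wordFace_sum u r l (x + y)
    rw [add_assoc, ← List.sum_cons] at h
    exact h.tail (.merge [] x y (l ++ r) u)

/-- The numbers of leaves of the trees of a word. -/
def CForest.allLeaves {p : Bool} {c : Color} : CForest p c → List ℕ
  | .last t => [t.leaves]
  | .cons t ts => t.leaves :: ts.allLeaves

theorem CForest.sum_allLeaves {p : Bool} {c : Color} : (w : CForest p c) →
    w.allLeaves.sum = w.leaves
  | .last t => by simp [allLeaves, leaves]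
  | .cons t ts => by simp [allLeaves, leaves, ts.sum_allLeaves]

theorem CForest.heads_append {p : Bool} {c : Color} : (a : CForest p .a) → (b : CForest p c) →
    (a.append b).heads = a.allLeaves ++ b.heads ∧ (a.append b).spine = b.spine
  | .last t, b => by simp [append, heads, allLeaves, spine]
  | .cons t ts, b => by
    have := CForest.heads_append ts b
    simp [append, heads, allLeaves, spine, this]

theorem wordFace_leaves {p : Bool} {c : Color} (a : CForest p c) (r : List ℕ) {q : Bool}
    (u : Spine q) : WordFace (a.leaves :: r, u) (a.allLeaves ++ r, u) := by
  cases a with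
  | last t => exact .refl _
  | cons t ts =>
    have := wordFace_sum u r ts.allLeaves t.leaves
    rwa [ts.sum_allLeaves] at this

theorem wordFace_flat {c : Color} (b : CForest false c) : ∀ bs : List (CForest false .a),
    WordFace (bs.map CForest.leaves ++ b.heads, b.spine)
      ((CForest.flat bs b).heads, (CForest.flat bs b).spine)
  | [] => .refl _
  | x :: bs => by
    rw [CForest.flat_cons, (CForest.heads_append _ _).1, (CForest.heads_append _ _).2]
    exact Relation.ReflTransGen.trans ((wordFace_flat b bs).cons x.leaves) (wordFace_leaves x _ _)

theorem heads_paintBlocks {c : Color} (b : CForest false c) : ∀ bs : List (CForest false .a),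
    (paintBlocks bs b).heads = bs.map CForest.leaves ∧
      (paintBlocks bs b).spine = .half b.heads b.spine
  | [] => ⟨rfl, rfl⟩
  | x :: bs => by
    have := heads_paintBlocks b bs
    simp [paintBlocks_cons, CForest.heads, CForest.spine, this, CTree.leaves]

theorem Flatten.wordFace {p : Bool} {c : Color} {w' w : CForest p c} (h : Flatten w' w) :
    WordFace (w'.heads, w'.spine) (w.heads, w.spine) := by
  induction h with
  | last t ts => exact .single (.nest [] _ _ _)
  | head t ts r =>
    simp only [CForest.heads, CForest.spine, CTree.leaves]
    rw [(CForest.heads_append _ _).1, (CForest.heads_append _ _).2, ← ts.sum_allLeaves]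
    exact wordFace_sum _ _ _ _
  | tail t r r' h ih => exact ih.cons t.leaves

mutual
  theorem CTree.isFace_of_contract {p : Bool} {c : Color} : (t : CTree p c) → ∀ u, Contract u t →
      Spine.IsFace u.spine t.spine
    | .leaf, _, h => absurd h not_contract_leaf
    | .node t ts, u, h => by
      obtain ⟨t', ts', rfl, hw⟩ := contract_node_iff.1 h
      rcases hw with hw | hw
      · exact hw.wordFace.node
      · cases hw with
        | head _ _ _ ht =>
          simp only [CTree.spine, ht.leaves_eq]
          exact .refl
        | tail _ _ _ ht =>
          exact (WordFace.cons t.leaves (ts.wordFace_of_contract _ (.inr ht))).node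
    | .half ts, u, h => by
      rcases contract_half_iff.1 h with ⟨ts', rfl, hw⟩ | ⟨t, us, rfl, ⟨bs, b⟩, hy, e⟩
      · exact (ts.wordFace_of_contract _ hw).half
      · rw [CForest.mem_blocks] at hy
        subst hy
        cases bs with
        | nil => simp [paintBlocks_nil] at e
        | cons y bs =>
          obtain ⟨rfl, rfl⟩ := by simpa [paintBlocks_cons] using e
          simp only [CTree.spine, (heads_paintBlocks b bs).1, (heads_paintBlocks b bs).2,
            CTree.leaves]
          exact Relation.ReflTransGen.trans (.single (.paint _ _ _ _))
            (wordFace_flat b (y :: bs)).half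
  theorem CForest.wordFace_of_contract {p : Bool} {c : Color} : (w : CForest p c) → ∀ w',
      WordContract w' w → WordFace (w'.heads, w'.spine) (w.heads, w.spine)
    | _, w', .inl h => h.wordFace
    | .last t, w', .inr h => by
      obtain ⟨t', ht, rfl⟩ := wordContract_last_iff.1 (.inr h)
      exact .inner [] (t.isFace_of_contract _ ht)
    | .cons t ts, w', .inr h => by
      cases h with
      | head _ _ _ ht =>
        simp only [CForest.heads, CForest.spine, ht.leaves_eq]
        exact .refl _
      | tail _ _ _ ht =>
        exact WordFace.cons t.leaves (ts.wordFace_of_contract _ (.inr ht))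
end

/-- Contractions of trees are mapped to faces of spines. -/
theorem Contract.isFace {p : Bool} {c : Color} {u t : CTree p c} (h : Contract u t) :
    Spine.IsFace u.spine t.spine :=
  t.isFace_of_contract u h

/-! ### Composition of trees -/

namespace CForest

theorem append_inj {p : Bool} {c : Color} : (a a' : CForest p .a) → (b b' : CForest p c) →
    a.length = a'.length → a.append b = a'.append b' → a = a' ∧ b = b'
  | .last t, .last t', b, b', _, e => by simpa [append] using e
  | .last t, .cons t' ts', b, b', h, _ => by
    have := ts'.length_pos
    simp only [length] at h
    omega
  | .cons t ts, .last t', b, b', h, _ => by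
    have := ts.length_pos
    simp only [length] at h
    omega
  | .cons t ts, .cons t' ts', b, b', h, e => by
    simp only [length, Nat.add_right_cancel_iff] at h
    simp only [append, cons.injEq] at e
    obtain ⟨rfl, rfl⟩ := append_inj ts ts' b b' h e.2
    exact ⟨by rw [e.1], rfl⟩

theorem exists_append {p : Bool} {c : Color} : (w : CForest p c) → ∀ m, 0 < m → m < w.length →
    ∃ (a : CForest p .a) (b : CForest p c), a.append b = w ∧ a.length = m
  | .last t, m, h, h' => by simp only [length] at h'; omega
  | .cons t ts, m, h, h' => by
    simp only [length] at h'
    rcases Nat.lt_or_ge 1 m with h1 | h1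
    · obtain ⟨a, b, rfl, hm⟩ := exists_append ts (m - 1) (by omega) (by omega)
      exact ⟨.cons t a, b, by rw [append], by simp only [length]; omega⟩
    · exact ⟨.last t, ts, by rw [append], by simp only [length]; omega⟩

theorem find_splits {p : Bool} {c : Color} {g : CForest p c} {m : ℕ}
    {y : CForest p .a × CForest p c} :
    g.splits.find? (fun y => y.1.length == m) = some y ↔ y.1.append y.2 = g ∧ y.1.length = m := by
  constructor
  · intro h
    exact ⟨g.mem_splits.1 (List.mem_of_find?_eq_some h), by simpa using List.find?_some h⟩
  · rintro ⟨h, rfl⟩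
    cases h' : g.splits.find? (fun z => z.1.length == y.1.length) with
    | none =>
      rw [List.find?_eq_none] at h'
      simpa using h' y (g.mem_splits.2 h)
    | some z =>
      have h1 := g.mem_splits.1 (List.mem_of_find?_eq_some h')
      have h2 : z.1.length = y.1.length := by simpa using List.find?_some h'
      obtain ⟨h3, h4⟩ := append_inj _ _ _ _ h2 (h1.trans h.symm)
      rw [Prod.ext h3 h4]

end CForest

section

variable {p q : Bool} {c : Color}

theorem CTree.comp_node {t : CTree p .a} {ts : CForest p c} {g : CForest q c}
    {u : ℕ × CTree (p || q) c} : (CTree.node t ts).comp g = some u ↔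
      ∃ a b v w, a.append b = g ∧ a.length = t.leaves ∧ t.comp a = some v ∧ ts.comp b = some w ∧
        u = (v.1 + w.1 + ts.dim * a.dim, .node v.2 w.2) := by
  rw [CTree.comp]
  constructor
  · intro h
    split at h
    · cases h
    · rename_i y hy
      split at h
      · rename_i v w hv hw
        obtain ⟨h1, h2⟩ := CForest.find_splits.1 hy
        exact ⟨y.1, y.2, v, w, h1, h2, hv, hw, by simpa using h.symm⟩
      · cases h
  · rintro ⟨a, b, v, w, h1, h2, h3, h4, rfl⟩
    rw [(CForest.find_splits (y := (a, b))).2 ⟨h1, h2⟩]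
    simp only [h3, h4]

theorem CForest.comp_cons {t : CTree p .a} {ts : CForest p c} {g : CForest q c}
    {u : ℕ × CForest (p || q) c} : (CForest.cons t ts).comp g = some u ↔
      ∃ a b v w, a.append b = g ∧ a.length = t.leaves ∧ t.comp a = some v ∧ ts.comp b = some w ∧
        u = (v.1 + w.1 + ts.dim * a.dim, .cons v.2 w.2) := by
  rw [CForest.comp]
  constructor
  · intro h
    split at h
    · cases h
    · rename_i y hy
      split at h
      · rename_i v w hv hw
        obtain ⟨h1, h2⟩ := CForest.find_splits.1 hy
        exact ⟨y.1, y.2, v, w, h1, h2, hv, hw, by simpa using h.symm⟩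
      · cases h
  · rintro ⟨a, b, v, w, h1, h2, h3, h4, rfl⟩
    rw [(CForest.find_splits (y := (a, b))).2 ⟨h1, h2⟩]
    simp only [h3, h4]

theorem CForest.comp_last {t : CTree p c} {g : CForest q c}
    {u : ℕ × CForest (p || q) c} : (CForest.last t).comp g = some u ↔
      ∃ v, t.comp g = some v ∧ u = (v.1, .last v.2) := by
  rw [CForest.comp]
  split <;> rename_i h <;> simp [h, eq_comm]

theorem CTree.comp_half {ts : CForest false c} {g : CForest false c}
    {u : ℕ × CTree true c} : (CTree.half ts).comp g = some u ↔
      ∃ v, ts.comp g = some v ∧ u = (v.1, .half v.2) := by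
  rw [CTree.comp]
  split <;> rename_i h <;> simp [h, eq_comm]

theorem CTree.comp_leaf {g : CForest q c} {u : ℕ × CTree q c} :
    (CTree.leaf (c := c)).comp g = some u ↔ ∃ x, g = .last x ∧ u = (0, x) := by
  cases g <;> rw [CTree.comp] <;> simp [eq_comm]

end

mutual
  theorem CTree.comp_spec {p q : Bool} {c : Color} : (t : CTree p c) → (g : CForest q c) →
      (u : ℕ × CTree (p || q) c) → t.comp g = some u →
        g.length = t.leaves ∧ u.2.dim = t.dim + g.dim ∧ u.2.leaves = g.leaves ∧
          (t.dim = 0 → u.1 = 0)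
    | .leaf, g, u, h => by
      obtain ⟨x, rfl, rfl⟩ := CTree.comp_leaf.1 h
      simp [CForest.length, CTree.leaves, CTree.dim, CForest.dim, CForest.leaves]
    | .node t ts, g, u, h => by
      obtain ⟨a, b, v, w, rfl, h2, h3, h4, rfl⟩ := CTree.comp_node.1 h
      obtain ⟨t1, t2, t3, t4⟩ := t.comp_spec _ _ h3
      obtain ⟨s0, s1, s2, s3, s4⟩ := ts.comp_spec _ _ h4
      simp only [CForest.length_append, CTree.leaves, CTree.dim, CForest.dim_append,
        CForest.leaves_append]
      refine ⟨by omega, by omega, by omega, fun h => ?_⟩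
      rw [t4 (by omega), s4 (by omega), show ts.dim = 0 by omega]; simp
    | .half ts, g, u, h => by
      cases q with
      | true => rw [CTree.comp] at h; cases h
      | false =>
        obtain ⟨v, hv, rfl⟩ := CTree.comp_half.1 h
        obtain ⟨s0, s1, s2, s3, s4⟩ := ts.comp_spec _ _ hv
        simp only [CTree.leaves, CTree.dim]
        exact ⟨by omega, by omega, s3, fun h => s4 (by omega)⟩
  theorem CForest.comp_spec {p q : Bool} {c : Color} : (ts : CForest p c) → (g : CForest q c) →
      (u : ℕ × CForest (p || q) c) → ts.comp g = some u → u.2.length = ts.length ∧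
        g.length = ts.leaves ∧ u.2.dim = ts.dim + g.dim ∧ u.2.leaves = g.leaves ∧
          (ts.dim = 0 → u.1 = 0)
    | .last t, g, u, h => by
      obtain ⟨v, hv, rfl⟩ := CForest.comp_last.1 h
      exact ⟨rfl, t.comp_spec _ _ hv⟩
    | .cons t ts, g, u, h => by
      obtain ⟨a, b, v, w, rfl, h2, h3, h4, rfl⟩ := CForest.comp_cons.1 h
      obtain ⟨t1, t2, t3, t4⟩ := t.comp_spec _ _ h3
      obtain ⟨s0, s1, s2, s3, s4⟩ := ts.comp_spec _ _ h4
      simp only [CForest.length_append, CForest.leaves, CForest.dim, CForest.dim_append,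
        CForest.leaves_append, CForest.length]
      refine ⟨by omega, by omega, by omega, by omega, fun h => ?_⟩
      rw [t4 (by omega), s4 (by omega), show ts.dim = 0 by omega]; simp
end

mutual
  theorem CTree.exists_comp {p q : Bool} {c : Color} :
      (t : CTree p c) → (p = false ∨ q = false) → (g : CForest q c) → g.length = t.leaves → ∃ u, t.comp g = some u
    | .leaf, _, .last x, h => ⟨_, CTree.comp_leaf.2 ⟨x, rfl, rfl⟩⟩
    | .leaf, _, .cons x g, h => by
      have := g.length_pos
      simp only [CForest.length, CTree.leaves] at h
      omega
    | .node t ts, hpq, g, h => by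
      have h1 := t.leaves_pos
      have h2 := ts.leaves_pos
      simp only [CTree.leaves] at h
      obtain ⟨a, b, rfl, ha⟩ := g.exists_append t.leaves h1 (by omega)
      rw [CForest.length_append] at h
      obtain ⟨v, hv⟩ := t.exists_comp hpq a ha
      obtain ⟨w, hw⟩ := ts.exists_comp hpq b (by omega)
      exact ⟨_, CTree.comp_node.2 ⟨a, b, v, w, rfl, ha, hv, hw, rfl⟩⟩
    | .half ts, hpq, g, h => by
      obtain rfl : q = false := by simpa using hpq
      obtain ⟨w, hw⟩ := ts.exists_comp (.inl rfl) g h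
      exact ⟨_, CTree.comp_half.2 ⟨w, hw, rfl⟩⟩
  theorem CForest.exists_comp {p q : Bool} {c : Color} :
      (ts : CForest p c) → (p = false ∨ q = false) → (g : CForest q c) → g.length = ts.leaves → ∃ u, ts.comp g = some u
    | .last t, hpq, g, h => by
      obtain ⟨v, hv⟩ := t.exists_comp hpq g h
      exact ⟨_, CForest.comp_last.2 ⟨v, hv, rfl⟩⟩
    | .cons t ts, hpq, g, h => by
      have h1 := t.leaves_pos
      have h2 := ts.leaves_pos
      simp only [CForest.leaves] at h
      obtain ⟨a, b, rfl, ha⟩ := g.exists_append t.leaves h1 (by omega)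
      rw [CForest.length_append] at h
      obtain ⟨v, hv⟩ := t.exists_comp hpq a ha
      obtain ⟨w, hw⟩ := ts.exists_comp hpq b (by omega)
      exact ⟨_, CForest.comp_cons.2 ⟨a, b, v, w, rfl, ha, hv, hw, rfl⟩⟩
end

/-! #### Composition of spines -/

/-- The number of leaves of composites of branches with words: `b` consecutive entries of `l` are
added up for a branch with `b` leaves. The second component lists the remaining entries. -/
def graftHeads : List ℕ → List ℕ → List ℕ × List ℕ
  | [], l => ([], l)
  | b :: bs, l => ((l.take b).sum :: (graftHeads bs (l.drop b)).1, (graftHeads bs (l.drop b)).2)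

/-- The spine of a composite. -/
def Spine.graft {p q : Bool} : Spine p → List ℕ → Spine q → Spine (p || q)
  | .leaf, _, s => s
  | .node b bs u, l, s =>
      .node (l.take b).sum (graftHeads bs (l.drop b)).1 (u.graft (graftHeads bs (l.drop b)).2 s)
  | .half bs u, l, s =>
      match q, s with
      | true, _ => .half [] .leaf
      | false, s => .half (graftHeads bs l).1 (u.graft (graftHeads bs l).2 s)

/-- The total dimension of all trees of a word except the last. -/
def CForest.headDim {p : Bool} {c : Color} : CForest p c → ℕ
  | .last _ => 0
  | .cons t ts => t.dim + ts.headDim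

theorem CForest.offDim_eq {p : Bool} {c : Color} : (w : CForest p c) →
    w.offDim = w.headDim + w.lastTree.offDim
  | .last t => by simp [offDim, headDim, lastTree]
  | .cons t ts => by simp [offDim, headDim, lastTree, ts.offDim_eq, add_assoc]

theorem CForest.dim_eq {p : Bool} {c : Color} : (w : CForest p c) →
    w.dim = w.headDim + w.lastTree.dim
  | .last t => by simp [dim, headDim, lastTree]
  | .cons t ts => by simp [dim, headDim, lastTree, ts.dim_eq, add_assoc]

theorem CForest.spine_lastTree {p : Bool} {c : Color} : (w : CForest p c) →
    w.lastTree.spine = w.spine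
  | .last _ => rfl
  | .cons _ ts => ts.spine_lastTree

theorem CForest.leaves_eq {p : Bool} {c : Color} : (w : CForest p c) →
    w.leaves = w.heads.sum + w.lastTree.leaves
  | .last t => by simp [leaves, heads, lastTree]
  | .cons t ts => by simp [leaves, heads, lastTree, ts.leaves_eq, add_assoc]

theorem CForest.offDim_append {p : Bool} {c : Color} : (a : CForest p .a) → (b : CForest p c) →
    (a.append b).offDim = a.dim + b.offDim
  | .last t, b => by simp [append, offDim, dim]
  | .cons t ts, b => by simp [append, offDim, dim, ts.offDim_append b, add_assoc]

theorem CForest.length_allLeaves {p : Bool} {c : Color} : (w : CForest p c) →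
    w.allLeaves.length = w.length
  | .last t => rfl
  | .cons t ts => by simp [allLeaves, length, ts.length_allLeaves]

theorem CForest.take_heads_append {p : Bool} {c : Color} (a : CForest p .a) (b : CForest p c)
    {m : ℕ} (h : a.length = m) : ((a.append b).heads.take m).sum = a.leaves ∧
      (a.append b).heads.drop m = b.heads := by
  rw [(heads_append a b).1, ← h, ← a.length_allLeaves, List.take_left', List.drop_left',
    a.sum_allLeaves]
  · exact ⟨rfl, rfl⟩
  · rfl
  · rfl

mutual
  theorem CTree.comp_spine {p q : Bool} {c : Color} : (t : CTree p c) → (g : CForest q c) →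
      (u : ℕ × CTree (p || q) c) → t.comp g = some u →
        u.2.offDim = t.offDim + g.offDim ∧ u.2.spine = t.spine.graft g.heads g.spine ∧
          (t.offDim + g.offDim = 0 → u.1 = 0)
    | .leaf, g, u, h => by
      obtain ⟨x, rfl, rfl⟩ := CTree.comp_leaf.1 h
      simp [CTree.offDim, CTree.spine, CForest.offDim, CForest.spine, Spine.graft]
    | .node t ts, g, u, h => by
      obtain ⟨a, b, v, w, rfl, h2, h3, h4, rfl⟩ := CTree.comp_node.1 h
      obtain ⟨t1, t2, t3, t4⟩ := t.comp_spec _ _ h3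
      obtain ⟨s1, s2, s3, s4⟩ := ts.comp_spine _ _ h4
      obtain ⟨e1, e2⟩ := a.take_heads_append b h2
      simp only [CTree.offDim, CTree.spine, CForest.offDim_append, Spine.graft, e1, e2, t3, s2, s3,
        (CForest.heads_append a b).2]
      refine ⟨by omega, trivial, fun h => ?_⟩
      rw [t4 (by omega), s4 (by omega), show a.dim = 0 by omega]; simp
    | .half ts, g, u, h => by
      cases q with
      | true => rw [CTree.comp] at h; cases h
      | false =>
        obtain ⟨v, hv, rfl⟩ := CTree.comp_half.1 h
        obtain ⟨s1, s2, s3, s4⟩ := ts.comp_spine _ _ hv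
        simp only [CTree.offDim, CTree.spine, Spine.graft, s2, s3]
        exact ⟨s1, trivial, s4⟩
  theorem CForest.comp_spine {p q : Bool} {c : Color} : (ts : CForest p c) → (g : CForest q c) →
      (u : ℕ × CForest (p || q) c) → ts.comp g = some u →
        u.2.offDim = ts.offDim + g.offDim ∧ u.2.heads = (graftHeads ts.heads g.heads).1 ∧
          u.2.spine = ts.spine.graft (graftHeads ts.heads g.heads).2 g.spine ∧
          (ts.offDim + g.offDim = 0 → u.1 = 0)
    | .last t, g, u, h => by
      obtain ⟨v, hv, rfl⟩ := CForest.comp_last.1 h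
      obtain ⟨h1, h2, h3⟩ := t.comp_spine _ _ hv
      exact ⟨h1, rfl, h2, h3⟩
    | .cons t ts, g, u, h => by
      obtain ⟨a, b, v, w, rfl, h2, h3, h4, rfl⟩ := CForest.comp_cons.1 h
      obtain ⟨t1, t2, t3, t4⟩ := t.comp_spec _ _ h3
      obtain ⟨s1, s2, s3, s4⟩ := ts.comp_spine _ _ h4
      obtain ⟨e1, e2⟩ := a.take_heads_append b h2
      simp only [CForest.offDim, CForest.heads, CForest.spine, CForest.offDim_append, graftHeads,
        e1, e2, t3, s2, s3, (CForest.heads_append a b).2]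
      refine ⟨by omega, trivial, trivial, fun h => ?_⟩
      rw [t4 (by omega), s4 (by omega), show a.dim = 0 by omega]; simp
end

/-! ### The kernel of the reduction is a DG sub-bimodule -/

section

variable {k : Type*} [CommRing k] {p q : Bool} {c : Color}

theorem compL_eq_bilin (x : CMod k p c) (g : CTensor k q c) :
    compL x g = bilin (fun (t : CTree p c) (ts : CForest q c) =>
      match t.comp ts with
      | some u => Finsupp.single u.2 ((-1 : k) ^ u.1)
      | none => 0) x g := by
  simp only [compL, bilin, Finsupp.linearCombination_apply, Finsupp.sum, LinearMap.coe_sum,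
    Finset.sum_apply, LinearMap.smul_apply, Finset.smul_sum]
  refine Finset.sum_congr rfl fun t _ => Finset.sum_congr rfl fun ts _ => ?_
  generalize t.comp ts = o
  cases o with
  | none => simp
  | some u =>
    simp only [Finsupp.smul_single, smul_eq_mul]
    congr 1
    ring

theorem tensorCons_eq (x : CMod k p .a) (g : CTensor k p c) : tensorCons x g = consL x g := by
  simp only [tensorCons, consL, bilin, Finsupp.linearCombination_apply, Finsupp.sum,
    LinearMap.coe_sum, Finset.sum_apply, LinearMap.smul_apply, Finset.smul_sum]
  refine Finset.sum_congr rfl fun t _ => Finset.sum_congr rfl fun ts _ => ?_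
  simp

theorem tensorLast_eq (x : CMod k p c) : tensorLast x = lastL x := rfl

/-- The linear map that sends a basis element `x` to the basis element `κ x` if `δ x = 0`, and to
zero otherwise. -/
def keyL {X K : Type*} (δ : X → ℕ) (κ : X → K) : (X →₀ k) →ₗ[k] (K →₀ k) :=
  Finsupp.linearCombination k fun x => atZero (δ x) (Finsupp.single (κ x) 1)

theorem keyL_single {X K : Type*} (δ : X → ℕ) (κ : X → K) (x : X) (a : k) :
    keyL δ κ (Finsupp.single x a) = a • atZero (δ x) (Finsupp.single (κ x) 1) := by
  simp [keyL]

/-- The extension of `keyL` to words, all letters but the last being reduced to their numbers of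
leaves. -/
def wordKeyL {K : Type*} (δ : CTree p c → ℕ) (κ : CTree p c → K) :
    CTensor k p c →ₗ[k] (List ℕ × K →₀ k) :=
  keyL (fun w => w.headDim + δ w.lastTree) (fun w => (w.heads, κ w.lastTree))

theorem wordKeyL_lastL {K : Type*} (δ : CTree p c → ℕ) (κ : CTree p c → K) (x : CMod k p c) :
    wordKeyL δ κ (lastL x) = Finsupp.lmapDomain k k (fun u => ([], u)) (keyL δ κ x) := by
  refine LinearMap.congr_fun (f := (wordKeyL δ κ).comp lastL)
    (g := (Finsupp.lmapDomain k k fun u => (([] : List ℕ), u)).comp (keyL δ κ))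
    (LinearMap.ext_single_one fun t => ?_) x
  simp [wordKeyL, keyL_single, CForest.headDim, CForest.lastTree, CForest.heads, map_atZero,
    Finsupp.mapDomain_single]

theorem wordKeyL_consL {K : Type*} (δ : CTree p c → ℕ) (κ : CTree p c → K) (x : CMod k p .a)
    (g : CTensor k p c) : wordKeyL δ κ (consL x g) =
      bilin (fun (b : ℕ) (y : List ℕ × K) => Finsupp.single (b :: y.1, y.2) (1 : k))
        (keyL CTree.dim CTree.leaves x) (wordKeyL δ κ g) := by
  refine LinearMap.congr_fun₂ (f := consL.compr₂ (wordKeyL δ κ))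
    (g := (bilin (fun (b : ℕ) (y : List ℕ × K) => Finsupp.single (b :: y.1, y.2) (1 : k))).compl₁₂
      (keyL CTree.dim CTree.leaves) (wordKeyL δ κ))
    (LinearMap.ext_single_one fun t => LinearMap.ext_single_one fun w => ?_) x g
  simp only [LinearMap.compr₂_apply, LinearMap.compl₁₂_apply, consL_single, one_smul, wordKeyL,
    keyL_single, CForest.headDim, CForest.lastTree, CForest.heads]
  rcases Nat.eq_zero_or_pos t.dim with h | h
  · simp [h, map_atZero]
  · rw [atZero_pos (by omega), atZero_pos h]
    simp

theorem wordKeyL_eq_zero {N : ∀ c, Submodule k (CMod k p c)}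
    (ha : ∀ x ∈ N .a, keyL CTree.dim CTree.leaves x = 0) {g : CTensor k p c}
    (hg : HasEntryIn N g) : ∀ {K : Type} (δ : CTree p c → ℕ) (κ : CTree p c → K),
      (∀ x ∈ N c, keyL δ κ x = 0) → wordKeyL δ κ g = 0 := by
  induction hg with
  | last x hx =>
    intro K δ κ h
    rw [tensorLast_eq, wordKeyL_lastL, h x hx, map_zero]
  | head x g hx =>
    intro K δ κ h
    rw [tensorCons_eq, wordKeyL_consL, ha x hx, map_zero, LinearMap.zero_apply]
  | tail x g _ ih =>
    intro K δ κ h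
    rw [tensorCons_eq, wordKeyL_consL, ih δ κ h, map_zero]

/-- If the key of a composite of basis elements is determined by the keys of its factors, then
composition descends to the reductions. -/
theorem keyL_compL {K K' K'' : Type*} {δ : CTree p c → ℕ} {κ : CTree p c → K}
    {δ' : CTree q c → ℕ} {κ' : CTree q c → K'} {δ'' : CTree (p || q) c → ℕ}
    {κ'' : CTree (p || q) c → K''} (γ : K → List ℕ × K' → Option K'')
    (h : ∀ (t : CTree p c) (g : CForest q c) u, t.comp g = some u →
      δ'' u.2 = δ t + (g.headDim + δ' g.lastTree) ∧
      (δ t + (g.headDim + δ' g.lastTree) = 0 → u.1 = 0) ∧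
      γ (κ t) (g.heads, κ' g.lastTree) = some (κ'' u.2))
    (h' : ∀ (t : CTree p c) (g : CForest q c), t.comp g = none →
      γ (κ t) (g.heads, κ' g.lastTree) = none)
    (x : CMod k p c) (g : CTensor k q c) :
    keyL δ'' κ'' (compL x g) =
      bilin (fun a b => (γ a b).elim 0 fun z => Finsupp.single z (1 : k))
        (keyL δ κ x) (wordKeyL δ' κ' g) := by
  rw [compL_eq_bilin]
  refine LinearMap.congr_fun₂ (f := (bilin _).compr₂ (keyL δ'' κ''))
    (g := (bilin (fun a b => (γ a b).elim 0 fun z => Finsupp.single z (1 : k))).compl₁₂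
      (keyL δ κ) (wordKeyL δ' κ'))
    (LinearMap.ext_single_one fun t => LinearMap.ext_single_one fun w => ?_) x g
  simp only [LinearMap.compr₂_apply, LinearMap.compl₁₂_apply, bilin_single, one_smul, wordKeyL,
    keyL_single]
  cases hu : t.comp w with
  | none =>
    have h1 := h' t w hu
    rcases Nat.eq_zero_or_pos (δ t) with h2 | h2
    · rcases Nat.eq_zero_or_pos (w.headDim + δ' w.lastTree) with h3 | h3
      · simp [h2, h3, h1]
      · simp [h2, atZero_pos h3]
    · simp [atZero_pos h2]
  | some u =>
    obtain ⟨h1, h2, h3⟩ := h t w u hu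
    simp only [keyL_single, h1]
    rcases Nat.eq_zero_or_pos (δ t) with h4 | h4
    · rcases Nat.eq_zero_or_pos (w.headDim + δ' w.lastTree) with h5 | h5
      · simp [h4, h5, h3, h2 (by omega)]
      · simp [h4, atZero_pos h5]
    · rw [atZero_pos h4, atZero_pos (by omega)]
      simp

/-- Composition descends to spines. -/
theorem redT_compL (hpq : p = false ∨ q = false) (x : CMod k p c) (g : CTensor k q c) :
    redT (compL x g) = bilin (fun (a : Spine p) (b : List ℕ × Spine q) =>
      ((if b.1.length = a.total then some (a.graft b.1 b.2) else none).elim 0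
        fun z => Finsupp.single z (1 : k))) (redT x) (wordKeyL CTree.offDim CTree.spine g) := by
  refine keyL_compL (δ := CTree.offDim) (κ := CTree.spine) (δ' := CTree.offDim)
    (κ' := CTree.spine) (δ'' := CTree.offDim) (κ'' := CTree.spine)
    (fun (a : Spine p) (b : List ℕ × Spine q) =>
      if b.1.length = a.total then some (a.graft b.1 b.2) else none) ?_ ?_ x g
  · intro t g u hu
    obtain ⟨h1, h2, h3⟩ := t.comp_spine g u hu
    have h4 := (t.comp_spec g u hu).1
    have h5 := g.length_heads
    have h6 := t.leaves_eq_spine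
    rw [← g.offDim_eq, if_pos (by simp only; omega), g.spine_lastTree, h2]
    exact ⟨h1, h3, rfl⟩
  · intro t g hu
    refine if_neg fun h => ?_
    have h5 := g.length_heads
    have h6 := t.leaves_eq_spine
    obtain ⟨u, hu'⟩ := t.exists_comp hpq g (by simp only at h; omega)
    rw [hu] at hu'
    cases hu'

/-- Composition descends to numbers of leaves. -/
theorem keyL_dim_compL (hpq : p = false ∨ q = false) (x : CMod k p c) (g : CTensor k q c) :
    keyL CTree.dim CTree.leaves (compL x g) = bilin (fun (a : ℕ) (b : List ℕ × ℕ) =>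
      ((if b.1.length + 1 = a then some (b.1.sum + b.2) else none).elim 0
        fun z => Finsupp.single z (1 : k))) (keyL CTree.dim CTree.leaves x)
          (wordKeyL CTree.dim CTree.leaves g) := by
  refine keyL_compL (fun (a : ℕ) (b : List ℕ × ℕ) =>
    if b.1.length + 1 = a then some (b.1.sum + b.2) else none) ?_ ?_ x g
  · intro t g u hu
    obtain ⟨h1, h2, h3, h4⟩ := t.comp_spec g u hu
    have h5 := g.length_heads
    rw [← g.dim_eq, if_pos (by simp only; omega), ← g.leaves_eq, h3]
    exact ⟨h2, fun h => h4 (by omega), rfl⟩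
  · intro t g hu
    refine if_neg fun h => ?_
    have h5 := g.length_heads
    obtain ⟨u, hu'⟩ := t.exists_comp hpq g (by simp only at h; omega)
    rw [hu] at hu'
    cases hu'

/-- Boundaries vanish after reduction to the number of leaves. -/
theorem keyL_dim_dL (x : CMod k p c) : keyL CTree.dim CTree.leaves (dL k p c x) = 0 := by
  refine LinearMap.congr_fun (f := (keyL CTree.dim CTree.leaves).comp (dL k p c)) (g := 0)
    (LinearMap.ext_single_one fun t => ?_) x
  have hd : dL k p c (Finsupp.single t 1) = t.d k := by simp [dL]
  rw [LinearMap.comp_apply, hd, LinearMap.zero_apply]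
  by_cases h : t.dim ≤ 1
  · -- All terms have the same number of leaves, and their coefficients add up to zero.
    have := LinearMap.eq_of_mem_supported
      (f := keyL CTree.dim CTree.leaves)
      (g := (LinearMap.toSpanSingleton k (ℕ →₀ k) (Finsupp.single t.leaves 1)).comp coeffSum)
      (fun u hu => ?_) (CTree.d_mem k t)
    · rw [this, LinearMap.comp_apply, CTree.coeffSum_d h, map_zero]
    · obtain ⟨h1, h2⟩ := hu
      rw [keyL_single, show u.dim = 0 by omega, h2]
      simp
  · have := LinearMap.eq_of_mem_supported
      (f := keyL CTree.dim CTree.leaves) (g := (0 : CMod k p c →ₗ[k] (ℕ →₀ k)))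
      (fun u hu => ?_) (CTree.d_mem k t)
    · rw [this, LinearMap.zero_apply]
    · rw [keyL_single, atZero_pos (by have := hu.1; omega)]
      simp

end

/-- The kernels of the reductions. In colour `a`, trees of positive dimension are killed and the
others are reduced to their numbers of leaves. -/
def redKer (k : Type*) [CommRing k] (p : Bool) : ∀ c, Submodule k (CMod k p c)
  | .a => LinearMap.ker (keyL CTree.dim CTree.leaves)
  | .m => LinearMap.ker redT

section

variable {k : Type*} [CommRing k] {p q : Bool}

theorem dL_mem_redKer : ∀ c, ∀ x ∈ redKer k p c, dL k p c x ∈ redKer k p c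
  | .a, x, _ => keyL_dim_dL x
  | .m, x, hx => by
    have hx : redT x = 0 := hx
    change redT _ = 0
    rw [redT_dL, hx, map_zero]

theorem compL_mem_redKer_left (hpq : p = false ∨ q = false) : ∀ c, ∀ x ∈ redKer k p c,
    ∀ g : CTensor k q c, compL x g ∈ redKer k (p || q) c
  | .a, x, hx, g => by
    have hx : keyL CTree.dim CTree.leaves x = 0 := hx
    change keyL _ _ _ = 0
    rw [keyL_dim_compL hpq, hx, map_zero, LinearMap.zero_apply]
  | .m, x, hx, g => by
    have hx : redT x = 0 := hx
    change redT _ = 0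
    rw [redT_compL hpq, hx, map_zero, LinearMap.zero_apply]

theorem compL_mem_redKer_right (hpq : p = false ∨ q = false) : ∀ c, ∀ x : CMod k p c,
    ∀ g : CTensor k q c, HasEntryIn (redKer k q) g → compL x g ∈ redKer k (p || q) c
  | .a, x, g, hg => by
    change keyL _ _ _ = 0
    rw [keyL_dim_compL hpq, wordKeyL_eq_zero (fun _ h => h) hg _ _ fun _ h => h, map_zero]
  | .m, x, g, hg => by
    change redT _ = 0
    rw [redT_compL hpq, wordKeyL_eq_zero (fun _ h => h) hg _ _ fun _ h => h, map_zero]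

end

theorem isDGIdeal_redKer (k : Type*) [CommRing k] : IsDGIdeal (redKer k false) where
  d_mem := dL_mem_redKer
  comp_mem_left := compL_mem_redKer_left (.inl rfl)
  comp_mem_right := compL_mem_redKer_right (.inl rfl)

theorem isDGSubbimodule_redKer (k : Type*) [CommRing k] : IsDGSubbimodule (redKer k true) where
  d_mem := dL_mem_redKer
  right_mem := compL_mem_redKer_left (.inr rfl)
  left_mem := compL_mem_redKer_right (.inl rfl)

theorem length_leavesForest (c : Color) : ∀ n, (leavesForest c n).length = n + 1
  | 0 => rfl
  | n + 1 => by simp [leavesForest, CForest.length, length_leavesForest c n]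

theorem leaves_leavesForest (c : Color) : ∀ n, (leavesForest c n).leaves = n + 1
  | 0 => rfl
  | n + 1 => by
    simp [leavesForest, CForest.leaves, CTree.leaves, leaves_leavesForest c n, add_comm]

theorem dim_leavesForest (c : Color) : ∀ n, (leavesForest c n).dim = 0
  | 0 => rfl
  | n + 1 => by simp [leavesForest, CForest.dim, CTree.dim, dim_leavesForest c n]

theorem idealOmega_le_redKer (k : Type*) [CommRing k] (c : Color) :
    idealOmega k c ≤ redKer k false c := by
  intro x hx
  simp only [idealOmega, Submodule.mem_iInf] at hx
  refine hx (redKer k false) (isDGIdeal_redKer k) fun i hi => ?_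
  change keyL _ _ _ = 0
  rw [muGen, keyL_single, atZero_pos, smul_zero]
  simp only [CTree.dim, length_leavesForest]
  omega

theorem killsRelations_redKer (k : Type*) [CommRing k] : KillsRelations (redKer k true) where
  ideal_left c x hx g := compL_mem_redKer_left (q := true) (.inl rfl) c x
    (idealOmega_le_redKer k c hx) g
  ideal_right c x g hg := compL_mem_redKer_right (p := true) (.inr rfl) c x g
    (hg.mono (idealOmega_le_redKer k))
  fGen_mem i hi := by
    change keyL _ _ _ = 0
    rw [fGen, keyL_single, atZero_pos, smul_zero]
    simp only [CTree.dim, length_leavesForest]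
    omega

theorem relT_le_ker_redT (k : Type*) [CommRing k] : relT k .m ≤ LinearMap.ker redT :=
  relT_le (isDGSubbimodule_redKer k) (killsRelations_redKer k) .m

/-! ### Normal forms modulo the relations -/

/-- The product of `j + 1` inputs of colour `a`, followed by `f_1` in the painted case. -/
def leafComb : (p : Bool) → ℕ → CTree p .a
  | false, j => comb j
  | true, j => .half (.last (comb j))

/-- The word with branches `bs` and last letter `u`. -/
def combWord (p : Bool) (bs : List ℕ) (u : CTree p .m) : CForest p .m :=
  bs.foldr (fun b g => .cons (leafComb p (b - 1)) g) (.last u)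

/-- The standard tree with a given spine. -/
def Spine.toTree {p : Bool} : Spine p → CTree p .m
  | .leaf => .leaf
  | .node b bs u => .node (leafComb _ (b - 1)) (combWord _ bs u.toTree)
  | .half bs u => .half (combWord false bs u.toTree)

section

variable (k : Type*) [CommRing k]

theorem idealOmega_le {I : ∀ c, Submodule k (CMod k false c)} (hI : IsDGIdeal I)
    (h : ∀ i, 2 < i + 2 → muGen k .a i ∈ I .a) (c : Color) : idealOmega k c ≤ I c := by
  intro x hx
  simp only [idealOmega, Submodule.mem_iInf] at hx
  exact hx I hI h

theorem mem_idealOmega {c : Color} {x : CMod k false c}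
    (h : ∀ I : ∀ c, Submodule k (CMod k false c), IsDGIdeal I →
      (∀ i, 2 < i + 2 → muGen k .a i ∈ I .a) → x ∈ I c) : x ∈ idealOmega k c := by
  simpa only [idealOmega, Submodule.mem_iInf] using h

theorem idealOmega_isDGIdeal : IsDGIdeal (idealOmega k) where
  d_mem c x hx := mem_idealOmega k fun _ hI h => hI.d_mem c x (idealOmega_le k hI h c hx)
  comp_mem_left c x hx g :=
    mem_idealOmega k fun _ hI h => hI.comp_mem_left c x (idealOmega_le k hI h c hx) g
  comp_mem_right c x g hg :=
    mem_idealOmega k fun _ hI h => hI.comp_mem_right c x g (hg.mono (idealOmega_le k hI h))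

theorem muGen_mem_idealOmega {i : ℕ} (hi : 0 < i) : muGen k .a i ∈ idealOmega k .a :=
  mem_idealOmega k fun _ _ h => h i (by omega)

/-- The relations: the ideal that defines `Ω` for unpainted trees, and the sub-bimodule that
defines `T` for painted trees. -/
def relFam : (p : Bool) → ∀ c, Submodule k (CMod k p c)
  | false => idealOmega k
  | true => relT k

/-- The sub-space of tensors spanned by those with an entry in the relations. -/
def wordRel (p : Bool) (c : Color) : Submodule k (CTensor k p c) :=
  Submodule.span k {g | HasEntryIn (relFam k p) g}

end

section

variable {k : Type*} [CommRing k] {p : Bool} {c : Color}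

theorem compL_mem_relFam {x : CMod k false c} (hx : x ∈ idealOmega k c) (g : CTensor k p c) :
    (compL x g : CMod k p c) ∈ relFam k p c := by
  cases p with
  | false => exact (idealOmega_isDGIdeal k).comp_mem_left c x hx g
  | true => exact (relT_killsRelations k).ideal_left c x hx g

theorem compL_mem_relFam_of_hasEntryIn (x : CMod k false c) {g : CTensor k p c}
    (hg : HasEntryIn (relFam k p) g) : (compL x g : CMod k p c) ∈ relFam k p c := by
  cases p with
  | false => exact (idealOmega_isDGIdeal k).comp_mem_right c x g hg
  | true => exact (relT_isDGSubbimodule k).left_mem c x g hg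

theorem consL_mem_wordRel_left {x : CMod k p .a} (hx : x ∈ relFam k p .a) (g : CTensor k p c) :
    consL x g ∈ wordRel k p c :=
  Submodule.subset_span (tensorCons_eq x g ▸ .head x g hx)

theorem consL_mem_wordRel_right (x : CMod k p .a) {g : CTensor k p c} (hg : g ∈ wordRel k p c) :
    consL x g ∈ wordRel k p c := by
  induction hg using Submodule.span_induction with
  | mem g hg => exact Submodule.subset_span (tensorCons_eq x g ▸ .tail x g hg)
  | zero => rw [map_zero]; exact zero_mem _
  | add g g' _ _ h h' => rw [map_add]; exact add_mem h h'
  | smul a g _ h => rw [map_smul]; exact Submodule.smul_mem _ a h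

theorem lastL_mem_wordRel {x : CMod k p c} (hx : x ∈ relFam k p c) : lastL x ∈ wordRel k p c :=
  Submodule.subset_span (.last x hx)

theorem compL_single_of_some {p q : Bool} {t : CTree p c} {g : CForest q c}
    {u : CTree (p || q) c} (h : t.comp g = some (0, u)) :
    compL (Finsupp.single t (1 : k)) (Finsupp.single g 1) = Finsupp.single u 1 := by
  rw [compL_eq_bilin, bilin_single]
  simp [h]

theorem compL_single_of_length_ne {p q : Bool} {t : CTree p c} {g : CForest q c}
    (h : g.length ≠ t.leaves) :
    compL (Finsupp.single t (1 : k)) (Finsupp.single g 1) = 0 := by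
  have : t.comp g = none := by
    cases hu : t.comp g with
    | none => rfl
    | some u => exact absurd (t.comp_spec g u hu).1 h
  rw [compL_eq_bilin, bilin_single]
  simp [this]

theorem leavesForest_comp : ∀ (n : ℕ) (g : CForest p c), g.length = n + 1 →
    (leavesForest c n).comp g = some (0, g)
  | 0, .last t, _ => CForest.comp_last.2 ⟨(0, t), CTree.comp_leaf.2 ⟨t, rfl, rfl⟩, rfl⟩
  | 0, .cons t g, h => by
    have := g.length_pos
    simp only [CForest.length] at h
    omega
  | n + 1, .last t, h => by simp only [CForest.length] at h; omega
  | n + 1, .cons t g, h => by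
    simp only [CForest.length] at h
    refine CForest.comp_cons.2 ⟨.last t, g, (0, t), (0, g), by rw [CForest.append], rfl,
      CTree.comp_leaf.2 ⟨t, rfl, rfl⟩, leavesForest_comp n g (by omega), ?_⟩
    simp [dim_leavesForest]

theorem compL_muGen_single (t : CTree p .a) (g : CForest p c) {n : ℕ} (h : g.length = n + 1) :
    (compL (muGen k c n) (Finsupp.single (.cons t g) 1) : CMod k p c) =
      Finsupp.single (.node t g) 1 := by
  refine compL_single_of_some (p := false) (CTree.comp_node.2 ⟨.last t, g, (0, t), (0, g),
    by rw [CForest.append], rfl, CTree.comp_leaf.2 ⟨t, rfl, rfl⟩, leavesForest_comp n g h, ?_⟩)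
  simp [dim_leavesForest]

theorem compL_fGen_single (g : CForest false c) {n : ℕ} (h : g.length = n + 1) :
    (compL (fGen k c n) (Finsupp.single g 1) : CMod k true c) = Finsupp.single (.half g) 1 :=
  compL_single_of_some (p := true) (CTree.comp_half.2 ⟨(0, g), leavesForest_comp n g h, rfl⟩)

/-- The operation `joinL` on words of bounded length is composition with a sum of generators. -/
theorem joinL_eq_compL (g : CTensor k p c) : ∃ x : CMod k false c,
    joinL g = (compL x g : CMod k p c) := by
  obtain ⟨N, hN⟩ : ∃ N, ∀ w ∈ g.support, w.length ≤ N :=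
    ⟨g.support.sup CForest.length, fun w hw => Finset.le_sup (f := CForest.length) hw⟩
  refine ⟨∑ r ∈ Finset.range N, muGen k c r, ?_⟩
  rw [compL_eq_bilin]
  refine LinearMap.eq_of_mem_supported (s := {w : CForest p c | w.length ≤ N}) (fun w hw => ?_)
    ((Finsupp.mem_supported _ _).2 fun w hw => hN w hw)
  rw [map_sum, LinearMap.sum_apply]
  simp only [← compL_eq_bilin]
  cases w with
  | last t =>
    rw [joinL_single, CForest.join, smul_zero, Finset.sum_eq_zero fun r _ => ?_]
    refine compL_single_of_length_ne ?_
    simp [CForest.length, CTree.leaves, leaves_leavesForest]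
  | cons t w =>
    have hw' : w.length + 1 ≤ N := hw
    have := w.length_pos
    rw [Finset.sum_eq_single (w.length - 1)]
    · rw [compL_muGen_single t w (by omega), joinL_single, CForest.join, one_smul]
    · intro r _ hr
      refine compL_single_of_length_ne ?_
      simp [CForest.length, CTree.leaves, leaves_leavesForest]
      omega
    · intro h
      rw [Finset.mem_range] at h
      omega

theorem halfL_eq_compL (g : CTensor k false c) : ∃ x : CMod k true c,
    halfL g = (compL x g : CMod k true c) := by
  obtain ⟨N, hN⟩ : ∃ N, ∀ w ∈ g.support, w.length ≤ N :=
    ⟨g.support.sup CForest.length, fun w hw => Finset.le_sup (f := CForest.length) hw⟩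
  refine ⟨∑ r ∈ Finset.range N, fGen k c r, ?_⟩
  rw [compL_eq_bilin]
  refine LinearMap.eq_of_mem_supported (s := {w : CForest false c | w.length ≤ N}) (fun w hw => ?_)
    ((Finsupp.mem_supported _ _).2 fun w hw => hN w hw)
  rw [map_sum, LinearMap.sum_apply]
  simp only [← compL_eq_bilin]
  have hw' : w.length ≤ N := hw
  have := w.length_pos
  rw [Finset.sum_eq_single (w.length - 1)]
  · rw [compL_fGen_single w (by omega), halfL_single]
  · intro r _ hr
    refine compL_single_of_length_ne ?_
    simp [CTree.leaves, leaves_leavesForest]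
    omega
  · intro h
    rw [Finset.mem_range] at h
    omega

theorem joinL_mem_relFam {g : CTensor k p c} (hg : g ∈ wordRel k p c) :
    joinL g ∈ relFam k p c := by
  induction hg using Submodule.span_induction with
  | mem g hg =>
    obtain ⟨x, hx⟩ := joinL_eq_compL g
    rw [hx]
    exact compL_mem_relFam_of_hasEntryIn x hg
  | zero => rw [map_zero]; exact zero_mem _
  | add g g' _ _ h h' => rw [map_add]; exact add_mem h h'
  | smul a g _ h => rw [map_smul]; exact Submodule.smul_mem _ a h

theorem halfL_mem_relFam {g : CTensor k false c} (hg : g ∈ wordRel k false c) :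
    halfL g ∈ relFam k true c := by
  induction hg using Submodule.span_induction with
  | mem g hg =>
    obtain ⟨x, hx⟩ := halfL_eq_compL g
    rw [hx]
    exact (relT_killsRelations k).ideal_right c x g hg
  | zero => rw [map_zero]; exact zero_mem _
  | add g g' _ _ h h' => rw [map_add]; exact add_mem h h'
  | smul a g _ h => rw [map_smul]; exact Submodule.smul_mem _ a h

/-! #### Congruences between basis elements -/

theorem single_cons_mem_left {t : CTree p .a} (ht : Finsupp.single t (1 : k) ∈ relFam k p .a)
    (w : CForest p c) : Finsupp.single (CForest.cons t w) (1 : k) ∈ wordRel k p c := by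
  simpa using consL_mem_wordRel_left ht (Finsupp.single w 1)

theorem single_cons_mem_right (t : CTree p .a) {w : CForest p c}
    (hw : Finsupp.single w (1 : k) ∈ wordRel k p c) :
    Finsupp.single (CForest.cons t w) (1 : k) ∈ wordRel k p c := by
  simpa using consL_mem_wordRel_right (Finsupp.single t 1) hw

theorem single_last_mem {t : CTree p c} (ht : Finsupp.single t (1 : k) ∈ relFam k p c) :
    Finsupp.single (CForest.last t) (1 : k) ∈ wordRel k p c := by
  simpa using lastL_mem_wordRel ht

theorem single_node_mem {t : CTree p .a} {w : CForest p c}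
    (h : Finsupp.single (CForest.cons t w) (1 : k) ∈ wordRel k p c) :
    Finsupp.single (CTree.node t w) (1 : k) ∈ relFam k p c := by
  simpa [CForest.join] using joinL_mem_relFam h

theorem single_half_mem {w : CForest false c} (h : Finsupp.single w (1 : k) ∈ wordRel k false c) :
    Finsupp.single (CTree.half w) (1 : k) ∈ relFam k true c := by
  simpa using halfL_mem_relFam h

theorem single_last_sub_mem {t t' : CTree p c}
    (h : Finsupp.single t (1 : k) - Finsupp.single t' 1 ∈ relFam k p c) :
    Finsupp.single (CForest.last t) (1 : k) - Finsupp.single (.last t') 1 ∈ wordRel k p c := by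
  simpa using lastL_mem_wordRel h

theorem single_cons_sub_mem {t t' : CTree p .a} {w w' : CForest p c}
    (h : Finsupp.single t (1 : k) - Finsupp.single t' 1 ∈ relFam k p .a)
    (h' : Finsupp.single w (1 : k) - Finsupp.single w' 1 ∈ wordRel k p c) :
    Finsupp.single (CForest.cons t w) (1 : k) - Finsupp.single (.cons t' w') 1 ∈
      wordRel k p c := by
  have := add_mem (consL_mem_wordRel_left h (Finsupp.single w 1))
    (consL_mem_wordRel_right (Finsupp.single t' 1) h')
  simpa using this

theorem single_node_sub_mem {t t' : CTree p .a} {w w' : CForest p c}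
    (h : Finsupp.single (CForest.cons t w) (1 : k) - Finsupp.single (.cons t' w') 1 ∈
      wordRel k p c) :
    Finsupp.single (CTree.node t w) (1 : k) - Finsupp.single (.node t' w') 1 ∈ relFam k p c := by
  simpa [CForest.join] using joinL_mem_relFam h

theorem single_half_sub_mem {w w' : CForest false c}
    (h : Finsupp.single w (1 : k) - Finsupp.single w' 1 ∈ wordRel k false c) :
    Finsupp.single (CTree.half w) (1 : k) - Finsupp.single (.half w') 1 ∈ relFam k true c := by
  simpa using halfL_mem_relFam h

/-- The product `μ_2` in colour `a` is associative modulo the ideal, by the boundary of `μ_3`. -/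
theorem assoc_mem (t u v : CTree false .a) :
    Finsupp.single (CTree.node t (.last (.node u (.last v)))) (1 : k) -
      Finsupp.single (.node (.node t (.last u)) (.last v)) 1 ∈ relFam k false .a := by
  have hd := (idealOmega_isDGIdeal k).comp_mem_left .a _
    ((idealOmega_isDGIdeal k).d_mem .a _ (muGen_mem_idealOmega k one_pos))
    (Finsupp.single (.cons t (.cons u (.last v))) 1)
  have h1 : dL k false .a (muGen k .a 1) =
      Finsupp.single (.node .leaf (.last (.node .leaf (.last .leaf)))) 1 -
        Finsupp.single (.node (.node .leaf (.last .leaf)) (.last .leaf)) 1 := by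
    simp [dL, muGen, leavesForest, CTree.d, CForest.d, CForest.merges, CForest.splits,
      CForest.length, CForest.join, CTree.dim]
    abel
  have h2 : (CTree.node .leaf (.last (.node .leaf (.last .leaf))) : CTree false .a).comp
      (.cons t (.cons u (.last v))) = some (0, .node t (.last (.node u (.last v)))) := by
    simp [CTree.comp, CForest.comp, CForest.splits, CForest.length, CTree.leaves, CForest.dim,
      CTree.dim]
  have h3 : (CTree.node (.node .leaf (.last .leaf)) (.last .leaf) : CTree false .a).comp
      (.cons t (.cons u (.last v))) = some (0, .node (.node t (.last u)) (.last v)) := by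
    simp [CTree.comp, CForest.comp, CForest.splits, CForest.length, CTree.leaves, CForest.dim,
      CTree.dim, CForest.leaves]
  rw [h1, compL_eq_bilin, map_sub, LinearMap.sub_apply, ← compL_eq_bilin, ← compL_eq_bilin,
    compL_single_of_some h2, compL_single_of_some h3] at hd
  exact hd

/-- The map `f_1` in colour `a` is multiplicative modulo the relations, by the boundary of
`f_2`. -/
theorem mul_mem (t u : CTree false .a) :
    Finsupp.single (CTree.node (.half (.last t)) (.last (.half (.last u)))) (1 : k) -
      Finsupp.single (.half (.last (.node t (.last u)))) 1 ∈ relFam k true .a := by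
  have hd := (relT_isDGSubbimodule k).right_mem .a _
    ((relT_isDGSubbimodule k).d_mem .a _ ((relT_killsRelations k).fGen_mem 1 (by omega)))
    (Finsupp.single (.cons t (.last u)) 1)
  have h1 : dL k true .a (fGen k .a 1) =
      Finsupp.single (.half (.last (.node .leaf (.last .leaf)))) 1 -
        Finsupp.single (.node (.half (.last .leaf)) (.last (.half (.last .leaf)))) 1 := by
    simp [dL, fGen, leavesForest, CTree.d, CForest.d, CForest.merges, CForest.splits,
      CForest.length, CForest.join, CTree.dim, CForest.blocks, paintBlocks, blocksSign,
      CForest.dim]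
  have h2 : (CTree.half (.last (.node .leaf (.last .leaf))) : CTree true .a).comp
      (.cons t (.last u)) = some (0, .half (.last (.node t (.last u)))) := by
    simp [CTree.comp, CForest.comp, CForest.splits, CForest.length, CTree.leaves, CForest.dim,
      CTree.dim]
  have h3 : (CTree.node (.half (.last .leaf)) (.last (.half (.last .leaf))) : CTree true .a).comp
      (.cons t (.last u)) = some (0, .node (.half (.last t)) (.last (.half (.last u)))) := by
    simp [CTree.comp, CForest.comp, CForest.splits, CForest.length, CTree.leaves, CForest.dim,
      CTree.dim, CForest.leaves]
  rw [h1, compL_eq_bilin, map_sub, LinearMap.sub_apply, ← compL_eq_bilin, ← compL_eq_bilin,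
    compL_single_of_some h2, compL_single_of_some h3] at hd
  have hd' := neg_mem hd
  rw [neg_sub] at hd'
  exact hd'

theorem sub_mem_trans {M : Type*} [AddCommGroup M] [Module k M] {N : Submodule k M} {x y z : M}
    (h : x - y ∈ N) (h' : y - z ∈ N) : x - z ∈ N := by
  simpa using add_mem h h'

theorem node_comb_mem (i : ℕ) : ∀ j, Finsupp.single (CTree.node (comb i) (.last (comb j))) (1 : k) -
    Finsupp.single (comb (i + j + 1)) 1 ∈ relFam k false .a
  | 0 => by
    rw [show Finsupp.single (CTree.node (comb i) (.last (comb 0))) (1 : k) =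
      Finsupp.single (comb (i + 0 + 1)) 1 from rfl, sub_self]
    exact zero_mem _
  | j + 1 => sub_mem_trans (assoc_mem (comb i) (comb j) .leaf) (single_node_sub_mem
      (single_cons_sub_mem (node_comb_mem i j) (by rw [sub_self]; exact zero_mem _)))

theorem node_leafComb_mem (i j : ℕ) : ∀ p,
    Finsupp.single (CTree.node (leafComb p i) (.last (leafComb p j))) (1 : k) -
      Finsupp.single (leafComb p (i + j + 1)) 1 ∈ relFam k p .a
  | false => node_comb_mem i j
  | true => sub_mem_trans (mul_mem (comb i) (comb j))
      (single_half_sub_mem (single_last_sub_mem (node_comb_mem i j)))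

theorem single_node_mem_of_length {t : CTree p .a} {w : CForest p .a} (h : 1 < w.length) :
    Finsupp.single (CTree.node t w) (1 : k) ∈ relFam k p .a := by
  rw [← compL_muGen_single t w (n := w.length - 1) (by omega)]
  exact compL_mem_relFam (muGen_mem_idealOmega k (by omega)) _

theorem single_half_mem_of_length {w : CForest false .a} (h : 1 < w.length) :
    Finsupp.single (CTree.half w) (1 : k) ∈ relFam k true .a := by
  rw [← compL_fGen_single w (n := w.length - 1) (by omega)]
  exact (relT_isDGSubbimodule k).right_mem .a _
    ((relT_killsRelations k).fGen_mem _ (by omega)) _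

/-- In colour `a`, a tree is zero modulo the relations if its dimension is positive, and determined
by its number of leaves otherwise. -/
theorem CTree.normalForm_a (k : Type*) [CommRing k] {p : Bool} : (t : CTree p .a) →
    (0 < t.dim → Finsupp.single t (1 : k) ∈ relFam k p .a) ∧
      (t.dim = 0 → Finsupp.single t (1 : k) - Finsupp.single (leafComb p (t.leaves - 1)) 1 ∈
        relFam k p .a)
  | .leaf => by
    refine ⟨fun h => by simp [CTree.dim] at h, fun _ => ?_⟩
    simp [CTree.leaves, leafComb, comb]
  | .node t (.last u) => by
    have h1 := CTree.normalForm_a k t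
    have h2 := CTree.normalForm_a k u
    simp only [CTree.dim, CForest.dim, CForest.length, CTree.leaves, CForest.leaves]
    refine ⟨fun h => single_node_mem ?_, fun h => ?_⟩
    · rcases Nat.eq_zero_or_pos t.dim with h3 | h3
      · exact single_cons_mem_right _ (single_last_mem (h2.1 (by omega)))
      · exact single_cons_mem_left (h1.1 h3) _
    · refine sub_mem_trans (single_node_sub_mem (single_cons_sub_mem (h1.2 (by omega))
        (single_last_sub_mem (h2.2 (by omega))))) ?_
      have h3 := t.leaves_pos
      have h4 := u.leaves_pos
      rw [show t.leaves + u.leaves - 1 = (t.leaves - 1) + (u.leaves - 1) + 1 by omega]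
      exact node_leafComb_mem _ _ _
  | .node t (.cons u us) => by
    have := us.length_pos
    refine ⟨fun _ => single_node_mem_of_length (by simp only [CForest.length]; omega), fun h => ?_⟩
    simp only [CTree.dim, CForest.length] at h
    omega
  | .half (.last u) => by
    have h2 := CTree.normalForm_a k u
    simp only [CTree.dim, CForest.dim, CForest.length, CTree.leaves, CForest.leaves]
    exact ⟨fun h => single_half_mem (single_last_mem (h2.1 (by omega))),
      fun h => single_half_sub_mem (single_last_sub_mem (h2.2 (by omega)))⟩
  | .half (.cons u us) => by
    have := us.length_pos
    refine ⟨fun _ => single_half_mem_of_length (by simp only [CForest.length]; omega), fun h => ?_⟩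
    simp only [CTree.dim, CForest.length] at h
    omega

mutual
  /-- In colour `m`, a tree is zero modulo the relations if one of its branches has positive
  dimension, and determined by its spine otherwise. -/
  theorem CTree.normalForm_m (k : Type*) [CommRing k] {p : Bool} : (t : CTree p .m) →
      (0 < t.offDim → Finsupp.single t (1 : k) ∈ relFam k p .m) ∧
        (t.offDim = 0 → Finsupp.single t (1 : k) - Finsupp.single t.spine.toTree 1 ∈
          relFam k p .m)
    | .leaf => by
      refine ⟨fun h => by simp [CTree.offDim] at h, fun _ => ?_⟩
      simp [CTree.spine, Spine.toTree]
    | .node t ts => by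
      have h1 := CTree.normalForm_a k t
      have h2 := CForest.normalForm_m k ts
      simp only [CTree.offDim]
      refine ⟨fun h => single_node_mem ?_, fun h => single_node_sub_mem
        (single_cons_sub_mem (h1.2 (by omega)) (h2.2 (by omega)))⟩
      rcases Nat.eq_zero_or_pos t.dim with h3 | h3
      · exact single_cons_mem_right _ (h2.1 (by omega))
      · exact single_cons_mem_left (h1.1 h3) _
    | .half ts => by
      have h2 := CForest.normalForm_m k ts
      exact ⟨fun h => single_half_mem (h2.1 h), fun h => single_half_sub_mem (h2.2 h)⟩
  theorem CForest.normalForm_m (k : Type*) [CommRing k] {p : Bool} : (w : CForest p .m) →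
      (0 < w.offDim → Finsupp.single w (1 : k) ∈ wordRel k p .m) ∧
        (w.offDim = 0 → Finsupp.single w (1 : k) -
          Finsupp.single (combWord p w.heads w.spine.toTree) 1 ∈ wordRel k p .m)
    | .last t => by
      have h1 := CTree.normalForm_m k t
      exact ⟨fun h => single_last_mem (h1.1 h), fun h => single_last_sub_mem (h1.2 h)⟩
    | .cons t ts => by
      have h1 := CTree.normalForm_a k t
      have h2 := CForest.normalForm_m k ts
      simp only [CForest.offDim]
      refine ⟨fun h => ?_, fun h => single_cons_sub_mem (h1.2 (by omega)) (h2.2 (by omega))⟩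
      rcases Nat.eq_zero_or_pos t.dim with h3 | h3
      · exact single_cons_mem_right _ (h2.1 (by omega))
      · exact single_cons_mem_left (h1.1 h3) _
end

/-- Every element is congruent to a combination of standard trees with the same reduction. -/
theorem sub_toTree_redT_mem (x : CMod k true .m) :
    x - Finsupp.lmapDomain k k Spine.toTree (redT x) ∈ relT k .m := by
  induction x using Finsupp.induction_linear with
  | zero => simp
  | add x y hx hy =>
    have := add_mem hx hy
    rwa [sub_add_sub_comm, ← map_add, ← map_add] at this
  | single t a =>
    have h : Finsupp.single t (1 : k) -
        Finsupp.lmapDomain k k Spine.toTree (redT (Finsupp.single t 1)) ∈ relT k .m := by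
      rw [redT_single, map_atZero, Finsupp.lmapDomain_apply, Finsupp.mapDomain_single]
      rcases Nat.eq_zero_or_pos t.offDim with h0 | h0
      · rw [h0, atZero_zero]
        exact (CTree.normalForm_m k t).2 h0
      · rw [atZero_pos h0, sub_zero]
        exact (CTree.normalForm_m k t).1 h0
    have := Submodule.smul_mem _ a h
    rwa [smul_sub, ← map_smul, ← map_smul, Finsupp.smul_single_one] at this

end

/-- The reduction to spines is well defined and injective on `T`. -/
theorem relT_eq_ker_redT (k : Type*) [CommRing k] : relT k .m = LinearMap.ker redT := by
  refine le_antisymm (relT_le_ker_redT k) fun x hx => ?_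
  have := sub_toTree_redT_mem x
  rwa [LinearMap.mem_ker.1 hx, map_zero, sub_zero] at this

/-! ### Stretches -/

/-- The stretch with minimum `a` whose successive differences, from right to left, are `bs`. -/
def stretch (a : ℕ) : List ℕ → Finset ℕ
  | [] => {a}
  | b :: bs => insert (a + (b + bs.sum)) (stretch a bs)

theorem mem_stretch {a x : ℕ} : ∀ {bs : List ℕ},
    x ∈ stretch a bs ↔ ∃ l r, bs = l ++ r ∧ x = a + r.sum
  | [] => by simp [stretch]
  | b :: bs => by
    rw [stretch, Finset.mem_insert, mem_stretch]
    constructor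
    · rintro (rfl | ⟨l, r, rfl, rfl⟩)
      · exact ⟨[], b :: bs, rfl, by simp⟩
      · exact ⟨b :: l, r, rfl, rfl⟩
    · rintro ⟨_ | ⟨b', l⟩, r, h, rfl⟩
      · left
        obtain rfl : b :: bs = r := h
        simp
      · obtain ⟨rfl, rfl⟩ := by simpa using h
        exact .inr ⟨l, r, rfl, rfl⟩

theorem stretch_bounds {a x : ℕ} {bs : List ℕ} (h : x ∈ stretch a bs) :
    a ≤ x ∧ x ≤ a + bs.sum := by
  obtain ⟨l, r, rfl, rfl⟩ := mem_stretch.1 h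
  rw [List.sum_append]
  omega

theorem isLeast_stretch (a : ℕ) (bs : List ℕ) : IsLeast (stretch a bs : Set ℕ) a :=
  ⟨mem_stretch.2 ⟨bs, [], by simp, by simp⟩, fun _ h => (stretch_bounds h).1⟩

theorem isGreatest_stretch (a : ℕ) (bs : List ℕ) :
    IsGreatest (stretch a bs : Set ℕ) (a + bs.sum) :=
  ⟨mem_stretch.2 ⟨[], bs, rfl, rfl⟩, fun _ h => (stretch_bounds h).2⟩

theorem stretch_append (a : ℕ) (r : List ℕ) : ∀ l : List ℕ,
    stretch a (l ++ r) = stretch (a + r.sum) l ∪ stretch a r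
  | [] => by
    rw [List.nil_append, stretch, eq_comm, Finset.union_eq_right, Finset.singleton_subset_iff]
    exact (isGreatest_stretch a r).1
  | b :: l => by
    rw [List.cons_append, stretch, stretch_append a r l, stretch, Finset.insert_union,
      List.sum_append]
    congr 1
    omega

theorem lower_stretch {a : ℕ} {l r : List ℕ} :
    lower (stretch a (l ++ r)) (a + r.sum) = stretch a r := by
  ext x
  rw [lower, Finset.mem_filter, stretch_append, Finset.mem_union]
  constructor
  · rintro ⟨hx | hx, h'⟩
    · obtain rfl : x = a + r.sum := le_antisymm h' (stretch_bounds hx).1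
      exact (isGreatest_stretch a r).1
    · exact hx
  · exact fun hx => ⟨.inr hx, (stretch_bounds hx).2⟩

theorem upper_stretch {a : ℕ} {l r : List ℕ} :
    upper (stretch a (l ++ r)) (a + r.sum) = stretch (a + r.sum) l := by
  ext x
  rw [upper, Finset.mem_filter, stretch_append, Finset.mem_union]
  constructor
  · rintro ⟨hx | hx, h'⟩
    · exact hx
    · obtain rfl : x = a + r.sum := le_antisymm (stretch_bounds hx).2 h'
      exact (isLeast_stretch _ l).1
  · exact fun hx => ⟨.inl hx, (stretch_bounds hx).1⟩

theorem erase_stretch {a b c : ℕ} {l r : List ℕ} (hb : 0 < b) (hc : 0 < c) :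
    (stretch a (l ++ b :: c :: r)).erase (a + (c + r.sum)) = stretch a (l ++ (b + c) :: r) := by
  have h1 : ∀ x ∈ stretch (a + (b + (c + r.sum))) l, x ≠ a + (c + r.sum) := by
    intro x hx
    have := (stretch_bounds hx).1
    omega
  have h2 : ∀ x ∈ stretch a r, x ≠ a + (c + r.sum) := by
    intro x hx
    have := (stretch_bounds hx).2
    omega
  have h3 : a + (b + (c + r.sum)) ≠ a + (c + r.sum) := by omega
  ext x
  simp only [stretch_append, stretch, Finset.mem_erase, Finset.mem_union, Finset.mem_insert,
    List.sum_cons, add_assoc]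
  constructor
  · rintro ⟨h, h' | h' | h' | h'⟩
    · exact .inl h'
    · exact .inr (.inl h')
    · exact absurd h' h
    · exact .inr (.inr h')
  · rintro (h | h | h)
    · exact ⟨h1 x h, .inl h⟩
    · exact ⟨h ▸ h3, .inr (.inl h)⟩
    · exact ⟨h2 x h, .inr (.inr (.inr h))⟩

theorem isInner_stretch {a x : ℕ} {bs : List ℕ} (h : ∀ y ∈ bs, 0 < y) :
    IsInner x (stretch a bs) ↔ ∃ l b c r, bs = l ++ b :: c :: r ∧ x = a + (c + r.sum) := by
  constructor
  · rintro ⟨h1, ⟨y, hy, hyx⟩, z, hz, hxz⟩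
    have h2 := (stretch_bounds hy).1
    have h3 := (stretch_bounds hz).2
    obtain ⟨l, r, rfl, rfl⟩ := mem_stretch.1 h1
    cases r with
    | nil => simp at hyx; omega
    | cons c r =>
      rcases l.eq_nil_or_concat with rfl | ⟨l, b, rfl⟩
      · simp at h3 hxz; omega
      · exact ⟨l, b, c, r, by simp, by simp⟩
  · rintro ⟨l, b, c, r, rfl, rfl⟩
    have hb := h b (by simp)
    have hc := h c (by simp)
    refine ⟨mem_stretch.2 ⟨l ++ [b], c :: r, by simp, by simp⟩, ⟨a, (isLeast_stretch _ _).1, ?_⟩,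
      _, (isGreatest_stretch _ _).1, ?_⟩
    · omega
    · simp; omega

theorem exists_stretch (s : Finset ℕ) : ∀ a, IsLeast (s : Set ℕ) a →
    ∃ bs, (∀ x ∈ bs, 0 < x) ∧ s = stretch a bs := by
  induction s using Finset.induction_on_max with
  | empty => intro a h; simpa using h.1
  | insert M s hM ih =>
    intro a h
    rcases s.eq_empty_or_nonempty with rfl | hs
    · refine ⟨[], by simp, ?_⟩
      have : a = M := by simpa using h.1
      rw [this]
      rfl
    · have ha : a ∈ s := by
        obtain ⟨y, hy⟩ := hs
        have h1 := h.2 (Finset.mem_coe.2 (Finset.mem_insert_of_mem hy))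
        rcases Finset.mem_insert.1 (Finset.mem_coe.1 h.1) with rfl | h2
        · exact absurd (hM y hy) (by omega)
        · exact h2
      obtain ⟨bs, hbs, rfl⟩ := ih a ⟨ha, fun y hy => h.2 (by simp [Finset.mem_coe.1 hy])⟩
      have h1 := hM _ (isGreatest_stretch a bs).1
      refine ⟨(M - (a + bs.sum)) :: bs, ?_, ?_⟩
      · simp only [List.mem_cons, forall_eq_or_imp]
        exact ⟨by omega, hbs⟩
      · rw [stretch]
        congr 1
        omega

theorem card_union_stretch {a : ℕ} {U : Finset ℕ} (ha : a ∈ U) (hU : ∀ x ∈ U, x ≤ a) :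
    ∀ {bs : List ℕ}, (∀ x ∈ bs, 0 < x) → (U ∪ stretch a bs).card = U.card + bs.length
  | [], _ => by
    rw [stretch, Finset.union_eq_left.2 (by simpa using ha)]
    rfl
  | b :: bs, h => by
    have hb := h b (by simp)
    rw [stretch, Finset.union_insert, Finset.card_insert_of_notMem,
      card_union_stretch ha hU fun x hx => h x (by simp [hx]), List.length_cons]
    · rfl
    · rw [Finset.mem_union]
      rintro (hx | hx)
      · have := hU _ hx
        omega
      · have := (stretch_bounds hx).2
        omega

theorem card_stretch {a : ℕ} {bs : List ℕ} (h : ∀ x ∈ bs, 0 < x) :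
    (stretch a bs).card = bs.length + 1 := by
  have := card_union_stretch (Finset.mem_singleton_self a) (by simp) h
  rwa [Finset.union_eq_right.2 (by simpa using (isLeast_stretch a bs).1), Finset.card_singleton,
    add_comm] at this

/-- The elements of `stretch a bs` in increasing order. -/
def stretchList (a : ℕ) : List ℕ → List ℕ
  | [] => [a]
  | b :: bs => stretchList a bs ++ [a + (b + bs.sum)]

theorem toFinset_stretchList (a : ℕ) : ∀ bs, (stretchList a bs).toFinset = stretch a bs
  | [] => by simp [stretchList, stretch]
  | b :: bs => by
    rw [stretchList, stretch, List.toFinset_append, toFinset_stretchList a bs, Finset.union_comm]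
    rfl

theorem pairwise_stretchList (a : ℕ) : ∀ {bs}, (∀ x ∈ bs, 0 < x) →
    (stretchList a bs).Pairwise (· < ·)
  | [], _ => by simp [stretchList]
  | b :: bs, h => by
    have hb := h b (by simp)
    rw [stretchList, List.pairwise_append]
    refine ⟨pairwise_stretchList a fun x hx => h x (by simp [hx]), by simp, fun x hx y hy => ?_⟩
    rw [← List.mem_toFinset, toFinset_stretchList] at hx
    have := (stretch_bounds hx).2
    rw [List.mem_singleton] at hy
    omega

theorem gaps_append (x y : ℕ) : ∀ l : List ℕ, gaps (l ++ [x, y]) = gaps (l ++ [x]) ++ [y - x]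
  | [] => rfl
  | [z] => rfl
  | z :: w :: l => by
    have := gaps_append x y (w :: l)
    simp only [List.cons_append] at this
    simp only [List.cons_append, gaps, this]

theorem exists_stretchList (a : ℕ) : ∀ bs, ∃ l, stretchList a bs = l ++ [a + bs.sum]
  | [] => ⟨[], rfl⟩
  | b :: bs => ⟨stretchList a bs, by simp [stretchList]⟩

theorem gaps_stretchList (a : ℕ) : ∀ bs, (gaps (stretchList a bs)).reverse = bs
  | [] => rfl
  | b :: bs => by
    have ih := gaps_stretchList a bs
    obtain ⟨l, hl⟩ := exists_stretchList a bs
    rw [hl] at ih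
    rw [stretchList, hl, List.append_assoc, List.singleton_append, gaps_append,
      List.reverse_append, ih]
    simp only [List.reverse_cons, List.reverse_nil, List.nil_append, List.singleton_append]
    congr 1
    omega

theorem stretchTree_stretch {a : ℕ} {bs : List ℕ} (h : ∀ x ∈ bs, 0 < x) :
    stretchTree (stretch a bs) = bs := by
  have hp := pairwise_stretchList a h
  have h1 : (stretchList a bs).toFinset.sort (· ≤ ·) = stretchList a bs :=
    (List.toFinset_sort (· ≤ ·) (hp.imp ne_of_lt)).2 (hp.imp le_of_lt)
  rw [stretchTree, ← toFinset_stretchList, h1, gaps_stretchList]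

/-! ### Spines as expressions -/

namespace Spine

/-- The stretches `[s_0], …, [s_(l-1)]` of an unpainted spine. -/
def rightStretches : Spine false → List (Finset ℕ)
  | .leaf => []
  | .node b bs u => u.rightStretches ++ [stretch u.total (b :: bs)]

/-- The expression of a painted spine. Every vertex gives a stretch, whose minimum is the total
number of leaves that branch off above it. -/
def toExpr : Spine true → Expression
  | .node b bs u => ⟨u.toExpr.left ++ [stretch u.total (b :: bs)], u.toExpr.mid, u.toExpr.right⟩
  | .half bs u => ⟨[], stretch u.total bs, u.rightStretches⟩

/-- All stretches, from left to right. -/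
def stretches : {p : Bool} → Spine p → List (Finset ℕ)
  | false, u => u.rightStretches
  | true, u => u.toExpr.right ++ u.toExpr.mid :: u.toExpr.left

@[simp] theorem stretches_leaf : Spine.leaf.stretches = [] := by
  rw [stretches, rightStretches]

@[simp] theorem stretches_node {p : Bool} (b : ℕ) (bs : List ℕ) (u : Spine p) :
    (Spine.node b bs u).stretches = u.stretches ++ [stretch u.total (b :: bs)] := by
  cases p <;> simp [stretches, rightStretches, toExpr]

@[simp] theorem stretches_half (bs : List ℕ) (u : Spine false) :
    (Spine.half bs u).stretches = u.stretches ++ [stretch u.total bs] := by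
  simp [stretches, toExpr]

theorem stretches_bounds {p : Bool} : (u : Spine p) → ∀ s ∈ u.stretches,
    s.Nonempty ∧ ∀ x ∈ s, x ≤ u.total
  | .leaf => by simp
  | .node b bs u => by
    intro s hs
    simp only [stretches_node, List.mem_append, List.mem_singleton] at hs
    rcases hs with hs | rfl
    · refine ⟨(u.stretches_bounds s hs).1, fun x hx => ?_⟩
      have := (u.stretches_bounds s hs).2 x hx
      simp only [total]
      omega
    · refine ⟨⟨_, (isLeast_stretch _ _).1⟩, fun x hx => ?_⟩
      have := (stretch_bounds hx).2
      simp only [total, List.sum_cons] at this ⊢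
      omega
  | .half bs u => by
    intro s hs
    simp only [stretches_half, List.mem_append, List.mem_singleton] at hs
    rcases hs with hs | rfl
    · refine ⟨(u.stretches_bounds s hs).1, fun x hx => ?_⟩
      have := (u.stretches_bounds s hs).2 x hx
      simp only [total]
      omega
    · refine ⟨⟨_, (isLeast_stretch _ _).1⟩, fun x hx => ?_⟩
      have := (stretch_bounds hx).2
      simp only [total]
      omega

theorem stretches_last {p : Bool} : (u : Spine p) → ∀ s ∈ u.stretches.getLast?,
    IsGreatest (s : Set ℕ) u.total
  | .leaf => by simp
  | .node b bs u => by
    have := isGreatest_stretch u.total (b :: bs)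
    rw [List.sum_cons, add_comm] at this
    simpa [total]
  | .half bs u => by
    have := isGreatest_stretch u.total bs
    rw [add_comm] at this
    simpa [total]

theorem total_eq_zero_of_stretches {p : Bool} : (u : Spine p) → u.stretches = [] → u.total = 0
  | .leaf, _ => rfl
  | .node b bs u, h => by simp at h
  | .half bs u, h => by simp at h

theorem stretches_head_append {p : Bool} (u : Spine p) (bs : List ℕ)
    (h : ∀ s ∈ u.stretches.head?, IsLeast (s : Set ℕ) 0) :
    ∀ s ∈ (u.stretches ++ [stretch u.total bs]).head?, IsLeast (s : Set ℕ) 0 := by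
  cases h' : u.stretches with
  | nil =>
    simp only [List.nil_append, List.head?_cons, Option.mem_some_iff, forall_eq']
    rw [u.total_eq_zero_of_stretches h']
    exact isLeast_stretch 0 bs
  | cons s l => simpa [h'] using h

theorem stretches_head {p : Bool} : (u : Spine p) → ∀ s ∈ u.stretches.head?,
    IsLeast (s : Set ℕ) 0
  | .leaf => by simp
  | .node b bs u => by
    rw [stretches_node]
    exact u.stretches_head_append _ u.stretches_head
  | .half bs u => by
    rw [stretches_half]
    exact u.stretches_head_append _ u.stretches_head

theorem stretches_linked_append {p : Bool} (u : Spine p) (bs : List ℕ)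
    (h : List.IsChain Linked u.stretches) :
    List.IsChain Linked (u.stretches ++ [stretch u.total bs]) := by
  rw [List.isChain_append]
  refine ⟨h, List.isChain_singleton _, fun s hs t ht => ?_⟩
  obtain rfl : stretch u.total bs = t := by simpa using ht
  exact ⟨u.total, u.stretches_last s hs, isLeast_stretch _ _⟩

theorem stretches_linked {p : Bool} : (u : Spine p) → List.IsChain Linked u.stretches
  | .leaf => by
    rw [stretches_leaf]
    exact List.isChain_nil
  | .node b bs u => by
    rw [stretches_node]
    exact u.stretches_linked_append _ u.stretches_linked
  | .half bs u => by
    rw [stretches_half]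
    exact u.stretches_linked_append _ u.stretches_linked

theorem card_rightStretches : (u : Spine false) → u.Pos → ∀ s ∈ u.rightStretches, 2 ≤ s.card
  | .leaf, _ => by simp [rightStretches]
  | .node b bs u, h => by
    intro s hs
    simp only [rightStretches, List.mem_append, List.mem_singleton] at hs
    rcases hs with hs | rfl
    · exact u.card_rightStretches h.2 s hs
    · rw [card_stretch (by simpa using h.1), List.length_cons]
      omega

theorem card_toExpr : (u : Spine true) → u.Pos → ∀ s ∈ u.toExpr.right ++ u.toExpr.left, 2 ≤ s.card
  | .node b bs u, h => by
    intro s hs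
    simp only [toExpr, List.mem_append, List.mem_singleton] at hs
    have ih := u.card_toExpr h.2 s
    rw [List.mem_append] at ih
    rcases hs with hs | hs | rfl
    · exact ih (.inl hs)
    · exact ih (.inr hs)
    · rw [card_stretch (by simpa using h.1), List.length_cons]
      omega
  | .half bs u, h => by
    intro s hs
    simp only [toExpr, List.append_nil] at hs
    exact u.card_rightStretches h.2 s hs

theorem isNice_toExpr (u : Spine true) (hu : u.Pos) : u.toExpr.IsNice u.total where
  subset s hs x hx := by
    have := (u.stretches_bounds s hs).2 x hx
    rw [Finset.mem_range]
    omega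
  nonempty s hs := (u.stretches_bounds s hs).1
  linked := u.stretches_linked
  card := u.card_toExpr hu
  min_eq := u.stretches_head
  max_eq := u.stretches_last

/-! #### Every nice expression comes from a spine -/

theorem exists_branches {s : Finset ℕ} {a : ℕ} (h : IsLeast (s : Set ℕ) a) (hc : 2 ≤ s.card) :
    ∃ b bs, (0 < b ∧ ∀ x ∈ bs, 0 < x) ∧ s = stretch a (b :: bs) := by
  obtain ⟨bs, hbs, rfl⟩ := exists_stretch s a h
  cases bs with
  | nil => simp [stretch] at hc
  | cons b bs => exact ⟨b, bs, by simpa using hbs, rfl⟩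

/-- The minimum of the next stretch is the total of the preceding spine. -/
theorem isLeast_total {p : Bool} (u : Spine p) {t : Finset ℕ}
    (hh : ∀ s ∈ (u.stretches ++ [t]).head?, IsLeast (s : Set ℕ) 0)
    (hl : List.IsChain Linked (u.stretches ++ [t])) : IsLeast (t : Set ℕ) u.total := by
  rcases u.stretches.eq_nil_or_concat with h | ⟨l, s, h⟩
  · rw [u.total_eq_zero_of_stretches h]
    simpa [h] using hh
  · rw [List.isChain_append] at hl
    obtain ⟨x, h1, h2⟩ := hl.2.2 s (by simp [h]) t (by simp)
    have h3 := u.stretches_last s (by simp [h])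
    rwa [h3.unique h1]

theorem List.mem_head?_append_left {α : Type*} {l r : List α} {x : α} (h : x ∈ l.head?) :
    x ∈ (l ++ r).head? := by
  cases l with
  | nil => simp at h
  | cons y l => simpa using h

theorem exists_rightStretches (R : List (Finset ℕ)) : (∀ s ∈ R, 2 ≤ s.card) →
    List.IsChain Linked R → (∀ s ∈ R.head?, IsLeast (s : Set ℕ) 0) →
    ∃ u : Spine false, u.Pos ∧ u.rightStretches = R := by
  induction R using List.reverseRecOn with
  | nil => exact fun _ _ _ => ⟨.leaf, trivial, by rw [rightStretches]⟩
  | append_singleton R s ih =>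
    intro hc hl hh
    obtain ⟨u, hu, rfl⟩ := ih (fun s hs => hc s (by simp [hs])) (List.isChain_append.1 hl).1
      fun s hs => hh s (List.mem_head?_append_left hs)
    obtain ⟨b, bs, hb, rfl⟩ := exists_branches (u.isLeast_total hh hl) (hc s (by simp))
    exact ⟨.node b bs u, ⟨hb, hu⟩, by rw [rightStretches]⟩

theorem exists_toExpr (R : List (Finset ℕ)) (m : Finset ℕ) (L : List (Finset ℕ)) :
    (∀ s ∈ R ++ L, 2 ≤ s.card) → List.IsChain Linked (R ++ m :: L) →
    (∀ s ∈ (R ++ m :: L).head?, IsLeast (s : Set ℕ) 0) →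
    ∃ u : Spine true, u.Pos ∧ u.toExpr = ⟨L, m, R⟩ := by
  induction L using List.reverseRecOn with
  | nil =>
    intro hc hl hh
    obtain ⟨u, hu, rfl⟩ := exists_rightStretches R (fun s hs => hc s (by simp [hs]))
      (List.isChain_append.1 hl).1 fun s hs => hh s (List.mem_head?_append_left hs)
    obtain ⟨bs, hbs, rfl⟩ := exists_stretch m u.total (u.isLeast_total hh hl)
    exact ⟨.half bs u, ⟨hbs, hu⟩, by rw [toExpr]⟩
  | append_singleton L s ih =>
    intro hc hl hh
    rw [← List.cons_append, ← List.append_assoc] at hl hh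
    obtain ⟨u, hu, he⟩ := ih
      (fun s hs => hc s (by rw [← List.append_assoc]; exact List.mem_append_left _ hs))
      (List.isChain_append.1 hl).1 fun s hs => hh s (List.mem_head?_append_left hs)
    have h : u.stretches = R ++ m :: L := by simp [stretches, he]
    obtain ⟨b, bs, hb, rfl⟩ := exists_branches (u.isLeast_total (h ▸ hh) (h ▸ hl))
      (hc s (by simp))
    exact ⟨.node b bs u, ⟨hb, hu⟩, by simp [toExpr, he]⟩

theorem exists_toExpr_eq {n : ℕ} {e : Expression} (h : e.IsNice n) :
    ∃ u : Spine true, (u.Pos ∧ u.total = n) ∧ u.toExpr = e := by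
  obtain ⟨L, m, R⟩ := e
  obtain ⟨u, hu, he⟩ := exists_toExpr R m L h.card h.linked h.min_eq
  refine ⟨u, ⟨hu, ?_⟩, he⟩
  rcases u.stretches.eq_nil_or_concat with h' | ⟨l, s, h'⟩
  · simp [stretches] at h'
  · have h1 := u.stretches_last s (by simp [h'])
    have h2 := h.max_eq s (by
      have : R ++ m :: L = u.stretches := by simp [stretches, he]
      simp [this, h'])
    exact h1.unique h2

/-! #### The triple of a spine -/

/-- The branches at the vertices of an unpainted spine. -/
def rightTrees : Spine false → List (List ℕ)
  | .leaf => []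
  | .node b bs u => (b :: bs) :: u.rightTrees

/-- The forest-tree-forest triple of a painted spine. -/
def triple : Spine true → Triple
  | .node b bs u => ⟨(b :: bs) :: u.triple.left, u.triple.mid, u.triple.right⟩
  | .half bs u => ⟨[], bs, u.rightTrees⟩

theorem map_rightStretches : (u : Spine false) → u.Pos →
    (u.rightStretches.map stretchTree).reverse = u.rightTrees
  | .leaf, _ => by simp [rightStretches, rightTrees]
  | .node b bs u, h => by
    rw [rightStretches, List.map_append, List.reverse_append, u.map_rightStretches h.2, rightTrees,
      List.map_singleton, stretchTree_stretch (by simpa using h.1)]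
    rfl

theorem triple_eq : (u : Spine true) → u.Pos →
    (⟨(u.toExpr.left.map stretchTree).reverse, stretchTree u.toExpr.mid,
      (u.toExpr.right.map stretchTree).reverse⟩ : Triple) = u.triple
  | .node b bs u, h => by
    have := u.triple_eq h.2
    rw [triple, ← this, toExpr]
    simp only [List.map_append, List.reverse_append, List.map_singleton,
      stretchTree_stretch (show ∀ x ∈ b :: bs, 0 < x by simpa using h.1)]
    rfl
  | .half bs u, h => by
    rw [triple, toExpr]
    simp only [stretchTree_stretch h.1, u.map_rightStretches h.2]
    rfl

theorem rightTree_rightTrees : (u : Spine false) → rightTree u.rightTrees = u.toTree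
  | .leaf => by simp [rightTrees, rightTree, toTree]
  | .node b bs u => by
    rw [rightTrees, rightTree, u.rightTree_rightTrees]
    rfl

theorem triple_toTree : (u : Spine true) → u.triple.toTree = u.toTree
  | .node b bs u => by
    have := u.triple_toTree
    rw [Triple.toTree] at this
    rw [triple, Triple.toTree, leftTree, this]
    rfl
  | .half bs u => by
    rw [triple, Triple.toTree, leftTree, u.rightTree_rightTrees]
    rfl

/-! #### Spines of standard trees -/

theorem leaves_comb : ∀ j : ℕ, (comb j).leaves = j + 1 ∧ (comb j).dim = 0
  | 0 => ⟨rfl, rfl⟩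
  | j + 1 => by
    simp [comb, CTree.leaves, CTree.dim, CForest.leaves, CForest.dim, CForest.length,
      leaves_comb j]

theorem leaves_leafComb : ∀ (p : Bool) (j : ℕ), (leafComb p j).leaves = j + 1 ∧
    (leafComb p j).dim = 0
  | false, j => leaves_comb j
  | true, j => by
    simp [leafComb, CTree.leaves, CTree.dim, CForest.leaves, CForest.dim, CForest.length,
      leaves_comb j]

theorem combWord_spec {p : Bool} (u : CTree p .m) : ∀ bs : List ℕ, (∀ x ∈ bs, 0 < x) →
    (combWord p bs u).heads = bs ∧ (combWord p bs u).spine = u.spine ∧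
      (combWord p bs u).offDim = u.offDim
  | [], _ => ⟨rfl, rfl, rfl⟩
  | b :: bs, h => by
    have ih := combWord_spec u bs fun x hx => h x (by simp [hx])
    have hb := h b (by simp)
    have := leaves_leafComb p (b - 1)
    rw [combWord, List.foldr_cons, ← combWord]
    simp only [CForest.heads, CForest.spine, CForest.offDim, ih, this]
    exact ⟨by rw [Nat.sub_add_cancel hb], trivial, by omega⟩

theorem toTree_spec {p : Bool} : (u : Spine p) → u.Pos → u.toTree.spine = u ∧ u.toTree.offDim = 0
  | .leaf, _ => ⟨rfl, rfl⟩
  | .node b bs u, h => by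
    have ih := u.toTree_spec h.2
    have hb := leaves_leafComb p (b - 1)
    have hw := combWord_spec u.toTree bs h.1.2
    rw [toTree]
    simp only [CTree.spine, CTree.offDim, hw, ih, hb, Nat.sub_add_cancel h.1.1]
    trivial
  | .half bs u, h => by
    have ih := u.toTree_spec h.2
    have hw := combWord_spec u.toTree bs h.1
    rw [toTree]
    simp only [CTree.spine, CTree.offDim, hw, ih]
    trivial

/-! #### The triple of a vertex -/

end Spine

mutual
  theorem CTree.toForest_eq {c : Color} : (t : CTree false c) → t.toForest = t.spine.rightTrees
    | .leaf => by simp [CTree.toForest, CTree.spine, Spine.rightTrees]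
    | .node t ts => by
      rw [CTree.toForest, CTree.spine, Spine.rightTrees, ts.toForest_eq.1, ts.toForest_eq.2]
  theorem CForest.toForest_eq {c : Color} : (w : CForest false c) →
      w.toForest = w.spine.rightTrees ∧ w.branchLeaves = w.heads
    | .last t => by
      have := t.toForest_eq
      simpa only [CForest.toForest, CForest.spine, CForest.branchLeaves, CForest.heads, and_true]
    | .cons t ts => by
      rw [CForest.toForest, CForest.spine, CForest.branchLeaves, CForest.heads, ts.toForest_eq.1,
        ts.toForest_eq.2]
      exact ⟨rfl, rfl⟩
end

mutual
  theorem CTree.leaves_forget {c : Color} : (t : CTree true c) → t.forget.leaves = t.leaves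
    | .node t ts => by simp [CTree.forget, CTree.leaves, t.leaves_forget, ts.leaves_forget]
    | .half (.last t) => by simp [CTree.forget, CTree.leaves, CForest.leaves]
    | .half (.cons t ts) => by simp [CTree.forget, CTree.leaves, CForest.leaves]
  theorem CForest.leaves_forget {c : Color} : (w : CForest true c) → w.forget.leaves = w.leaves
    | .last t => by simp [CForest.forget, CForest.leaves, t.leaves_forget]
    | .cons t ts => by
      simp [CForest.forget, CForest.leaves, t.leaves_forget, ts.leaves_forget]
end

mutual
  theorem CTree.triple_vertex {c : Color} : (t : CTree true c) → t.dim = 0 →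
      t.spine.triple = ⟨t.complement.toForest, [], t.unpaintedPart.toForest⟩
    | .node t ts, h => by
      simp only [CTree.dim] at h
      obtain ⟨h1, h2⟩ := ts.triple_vertex (by omega)
      simp only [CTree.spine, Spine.triple, CTree.complement, CTree.unpaintedPart, CTree.toForest,
        h1, h2, t.leaves_forget]
    | .half (.last t), _ => by
      simp [CTree.spine, Spine.triple, CTree.complement, CTree.unpaintedPart, CTree.toForest,
        CForest.heads, CForest.spine, CForest.lastTree, t.toForest_eq]
    | .half (.cons t ts), h => by
      have := ts.length_pos
      simp only [CTree.dim, CForest.length] at h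
      omega
  theorem CForest.triple_vertex {c : Color} : (w : CForest true c) → w.dim = 0 →
      w.spine.triple = ⟨w.complement.toForest, [], w.unpaintedPart.toForest⟩ ∧
        w.heads = w.complement.branchLeaves
    | .last t, h => by
      have := t.triple_vertex h
      simpa only [CForest.spine, CForest.complement, CForest.toForest, CForest.unpaintedPart,
        CForest.heads, CForest.branchLeaves, and_true]
    | .cons t ts, h => by
      simp only [CForest.dim] at h
      obtain ⟨h1, h2⟩ := ts.triple_vertex (by omega)
      simp only [CForest.spine, CForest.complement, CForest.toForest, CForest.unpaintedPart, h1,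
        CForest.heads, CForest.branchLeaves, t.leaves_forget, h2]
      exact ⟨trivial, trivial⟩
end

/-! ### Dimensions of expressions -/

/-- The elements that occur in some stretch. -/
def unionAll (l : List (Finset ℕ)) : Finset ℕ := l.foldr (· ∪ ·) ∅

theorem mem_unionAll {x : ℕ} : ∀ {l : List (Finset ℕ)}, x ∈ unionAll l ↔ ∃ s ∈ l, x ∈ s
  | [] => by simp [unionAll]
  | s :: l => by
    have := mem_unionAll (x := x) (l := l)
    rw [unionAll] at this ⊢
    simp [this]

theorem unionAll_append_singleton (l : List (Finset ℕ)) (s : Finset ℕ) :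
    unionAll (l ++ [s]) = unionAll l ∪ s := by
  ext x
  simp only [Finset.mem_union, mem_unionAll, List.mem_append, List.mem_singleton, or_and_right,
    exists_or, exists_eq_left]

namespace Spine

theorem total_mem {p : Bool} (u : Spine p) : u.total ∈ insert 0 (unionAll u.stretches) := by
  rw [Finset.mem_insert]
  rcases u.stretches.eq_nil_or_concat with h | ⟨l, s, h⟩
  · exact .inl (u.total_eq_zero_of_stretches h)
  · exact .inr (mem_unionAll.2 ⟨s, by simp [h], (u.stretches_last s (by simp [h])).1⟩)

theorem le_total {p : Bool} (u : Spine p) : ∀ x ∈ insert 0 (unionAll u.stretches), x ≤ u.total := by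
  intro x hx
  rcases Finset.mem_insert.1 hx with rfl | hx
  · exact Nat.zero_le _
  · obtain ⟨s, hs, hx⟩ := mem_unionAll.1 hx
    exact (u.stretches_bounds s hs).2 x hx

theorem card_unionAll {p : Bool} : (u : Spine p) → u.Pos →
    (insert 0 (unionAll u.stretches)).card + p.toNat = u.dim + u.stretches.length + 1
  | .leaf, _ => by simp [unionAll, dim]
  | .node b bs u, h => by
    have ih := u.card_unionAll h.2
    have := card_union_stretch u.total_mem u.le_total (bs := b :: bs) (by simpa using h.1)
    simp only [stretches_node, unionAll_append_singleton, ← Finset.insert_union, this, dim,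
      List.length_append, List.length_cons, List.length_nil]
    omega
  | .half bs u, h => by
    have ih := u.card_unionAll h.2
    have := card_union_stretch u.total_mem u.le_total h.1
    simp only [stretches_half, unionAll_append_singleton, ← Finset.insert_union, this, dim,
      List.length_append, List.length_cons, List.length_nil, Bool.toNat_true, Bool.toNat_false]
      at ih ⊢
    omega

theorem zero_mem_stretches (u : Spine true) : 0 ∈ unionAll u.stretches := by
  cases h : u.stretches with
  | nil => simp [stretches] at h
  | cons s l =>
    exact mem_unionAll.2 ⟨s, by simp, (u.stretches_head s (by simp [h])).1⟩

theorem dim_toExpr (u : Spine true) (hu : u.Pos) :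
    u.total - (u.toExpr.left.length + u.toExpr.right.length +
      (Finset.range (u.total + 1) \ (u.toExpr.right ++ u.toExpr.mid :: u.toExpr.left).foldr
        (· ∪ ·) ∅).card) = u.dim := by
  have h1 := u.card_unionAll hu
  rw [Finset.insert_eq_self.2 u.zero_mem_stretches] at h1
  have h2 : unionAll u.stretches ⊆ Finset.range (u.total + 1) := by
    intro x hx
    have := u.le_total x (Finset.mem_insert_of_mem hx)
    rw [Finset.mem_range]
    omega
  have h3 := Finset.card_sdiff_of_subset h2
  have h4 := Finset.card_le_card h2
  rw [Finset.card_range] at h3 h4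
  have h5 : u.stretches.length = u.toExpr.left.length + u.toExpr.right.length + 1 := by
    simp only [stretches, List.length_append, List.length_cons]
    omega
  change u.total - (_ + _ + (Finset.range (u.total + 1) \ unionAll u.stretches).card) = _
  rw [h3]
  simp only [Bool.toNat_true] at h1
  omega

end Spine

/-! ### Face moves and moves of spines -/

/-- A stretch `s` is replaced by `s` without an inner element, or broken at an inner element. -/
def SplitStretch (s : Finset ℕ) (ss : List (Finset ℕ)) : Prop :=
  ∃ x, IsInner x s ∧ (ss = [s.erase x] ∨ ss = [lower s x, upper s x])

/-- One stretch of a list is thinned out or broken. -/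
def ListMove (R R' : List (Finset ℕ)) : Prop :=
  ∃ R₁ s R₂ ss, R = R₁ ++ s :: R₂ ∧ SplitStretch s ss ∧ R' = R₁ ++ ss ++ R₂

theorem not_listMove_nil {R' : List (Finset ℕ)} : ¬ ListMove [] R' := by
  rintro ⟨R₁, s, R₂, ss, h, _⟩
  simp at h

theorem listMove_append_singleton {R R' : List (Finset ℕ)} {t : Finset ℕ} :
    ListMove (R ++ [t]) R' ↔ (∃ R₁, ListMove R R₁ ∧ R' = R₁ ++ [t]) ∨
      ∃ ss, SplitStretch t ss ∧ R' = R ++ ss := by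
  constructor
  · rintro ⟨R₁, s, R₂, ss, h, hs, rfl⟩
    rcases R₂.eq_nil_or_concat with rfl | ⟨R₂, t', rfl⟩
    · obtain ⟨rfl, rfl⟩ := List.append_inj' h rfl |>.imp_right (fun h => by simpa using h)
      exact .inr ⟨ss, hs, by simp⟩
    · rw [List.concat_eq_append, ← List.cons_append, ← List.append_assoc] at h
      obtain ⟨rfl, h2⟩ := List.append_inj' h rfl
      obtain rfl : t = t' := by simpa using h2
      exact .inl ⟨_, ⟨R₁, s, R₂, ss, rfl, hs, rfl⟩, by simp⟩
  · rintro (⟨_, ⟨R₁, s, R₂, ss, rfl, hs, rfl⟩, rfl⟩ | ⟨ss, hs, rfl⟩)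
    · exact ⟨R₁, s, R₂ ++ [t], ss, by simp, hs, by simp⟩
    · exact ⟨R, t, [], ss, rfl, hs, by simp⟩

theorem faceMove_iff {L R : List (Finset ℕ)} {m : Finset ℕ} {e : Expression} :
    FaceMove ⟨L, m, R⟩ e ↔ (((∃ L', ListMove L L' ∧ e = ⟨L', m, R⟩) ∨
      (∃ R', ListMove R R' ∧ e = ⟨L, m, R'⟩)) ∨
      (∃ x, IsInner x m ∧ e = ⟨L, m.erase x, R⟩)) ∨
      (∃ x ∈ m, (∃ b ∈ m, x < b) ∧ e = ⟨upper m x :: L, lower m x, R⟩) ∨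
      ∃ x ∈ m, (∃ a ∈ m, a < x) ∧ e = ⟨L, upper m x, R ++ [lower m x]⟩ := by
  constructor
  · intro h
    cases h with
    | dropMid L R m x h => exact .inl (.inr ⟨x, h, rfl⟩)
    | dropLeft L₁ L₂ R m s x h =>
      exact .inl (.inl (.inl ⟨_, ⟨L₁, s, L₂, _, rfl, ⟨x, h, .inl rfl⟩, rfl⟩, by simp⟩))
    | dropRight L R₁ R₂ m s x h =>
      exact .inl (.inl (.inr ⟨_, ⟨R₁, s, R₂, _, rfl, ⟨x, h, .inl rfl⟩, rfl⟩, by simp⟩))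
    | breakLeft L₁ L₂ R m s x h =>
      exact .inl (.inl (.inl ⟨_, ⟨L₁, s, L₂, _, rfl, ⟨x, h, .inr rfl⟩, rfl⟩, by simp⟩))
    | breakRight L R₁ R₂ m s x h =>
      exact .inl (.inl (.inr ⟨_, ⟨R₁, s, R₂, _, rfl, ⟨x, h, .inr rfl⟩, rfl⟩, by simp⟩))
    | rightOuter L R m x hx h => exact .inr (.inl ⟨x, hx, h, rfl⟩)
    | leftOuter L R m x hx h => exact .inr (.inr ⟨x, hx, h, rfl⟩)
  · rintro (((⟨_, ⟨L₁, s, L₂, _, rfl, ⟨x, hx, rfl | rfl⟩, rfl⟩, rfl⟩ |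
      ⟨_, ⟨R₁, s, R₂, _, rfl, ⟨x, hx, rfl | rfl⟩, rfl⟩, rfl⟩) | ⟨x, hx, rfl⟩) |
      ⟨x, hx, h, rfl⟩ | ⟨x, hx, h, rfl⟩)
    · simpa using FaceMove.dropLeft L₁ L₂ R m s x hx
    · simpa using FaceMove.breakLeft L₁ L₂ R m s x hx
    · simpa using FaceMove.dropRight L R₁ R₂ m s x hx
    · simpa using FaceMove.breakRight L R₁ R₂ m s x hx
    · exact .dropMid L R m x hx
    · exact .rightOuter L R m x hx h
    · exact .leftOuter L R m x hx h

theorem splitStretch_iff {a : ℕ} {bs : List ℕ} (h : ∀ y ∈ bs, 0 < y) {ss : List (Finset ℕ)} :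
    SplitStretch (stretch a bs) ss ↔ ∃ l b c r, bs = l ++ b :: c :: r ∧
      (ss = [stretch a (l ++ (b + c) :: r)] ∨
        ss = [stretch a (c :: r), stretch (a + (c + r.sum)) (l ++ [b])]) := by
  have key : ∀ l b c r, bs = l ++ b :: c :: r →
      (stretch a bs).erase (a + (c + r.sum)) = stretch a (l ++ (b + c) :: r) ∧
      lower (stretch a bs) (a + (c + r.sum)) = stretch a (c :: r) ∧
      upper (stretch a bs) (a + (c + r.sum)) = stretch (a + (c + r.sum)) (l ++ [b]) := by
    rintro l b c r rfl
    refine ⟨erase_stretch (h b (by simp)) (h c (by simp)), ?_, ?_⟩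
    · simpa using lower_stretch (a := a) (l := l ++ [b]) (r := c :: r)
    · simpa using upper_stretch (a := a) (l := l ++ [b]) (r := c :: r)
  constructor
  · rintro ⟨x, hx, hss⟩
    obtain ⟨l, b, c, r, hbs, rfl⟩ := (isInner_stretch h).1 hx
    obtain ⟨h1, h2, h3⟩ := key l b c r hbs
    rw [h1, h2, h3] at hss
    exact ⟨l, b, c, r, hbs, hss⟩
  · rintro ⟨l, b, c, r, hbs, hss⟩
    obtain ⟨h1, h2, h3⟩ := key l b c r hbs
    rw [← h1, ← h2, ← h3] at hss
    exact ⟨_, (isInner_stretch h).2 ⟨l, b, c, r, hbs, rfl⟩, hss⟩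

/-- The moves of words: merge, nest, or move the spine. -/
theorem wordMove_iff {p : Bool} {l' l : List ℕ} {u' u : Spine p} :
    WordMove l' u' l u ↔ ((∃ x a b r, l = x ++ a :: b :: r ∧ l' = x ++ (a + b) :: r ∧ u' = u) ∨
      (∃ b r, l = l' ++ b :: r ∧ u' = .node b r u)) ∨ l' = l ∧ Spine.Move u' u := by
  constructor
  · intro h
    cases h with
    | merge x a b r u => exact .inl (.inl ⟨x, a, b, r, rfl, rfl, rfl⟩)
    | nest _ b r => exact .inl (.inr ⟨b, r, rfl, rfl⟩)
    | inner _ _ _ h => exact .inr ⟨rfl, h⟩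
  · rintro ((⟨x, a, b, r, rfl, rfl, rfl⟩ | ⟨b, r, rfl, rfl⟩) | ⟨rfl, h⟩)
    · exact .merge _ _ _ _ _
    · exact .nest _ _ _ _
    · exact .inner _ _ _ h

/-- A stretch of a vertex `μ` is thinned out or broken exactly by merging or nesting branches. -/
theorem splitStretch_node_iff {p : Bool} {b : ℕ} {bs : List ℕ} {u : Spine p}
    (h : 0 < b ∧ ∀ x ∈ bs, 0 < x) {ss : List (Finset ℕ)} :
    SplitStretch (stretch u.total (b :: bs)) ss ↔
      (∃ b' bs', (∃ x a c r, b :: bs = x ++ a :: c :: r ∧ b' :: bs' = x ++ (a + c) :: r) ∧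
        ss = [stretch u.total (b' :: bs')]) ∨
      ∃ b' bs' c r, b :: bs = (b' :: bs') ++ c :: r ∧
        ss = [stretch u.total (c :: r), stretch (Spine.node c r u).total (b' :: bs')] := by
  have ht : ∀ c r, (Spine.node c r u).total = u.total + (c + r.sum) := fun c r => by
    simp only [Spine.total]; omega
  rw [splitStretch_iff (by simpa using h)]
  simp only [ht]
  constructor
  · rintro ⟨l, a, c, r, e, rfl | rfl⟩
    · cases l with
      | nil => exact .inl ⟨_, _, ⟨[], a, c, r, e, rfl⟩, rfl⟩
      | cons y l => exact .inl ⟨_, _, ⟨y :: l, a, c, r, e, rfl⟩, rfl⟩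
    · cases l with
      | nil => exact .inr ⟨a, [], c, r, by simpa using e, rfl⟩
      | cons y l => exact .inr ⟨y, l ++ [a], c, r, by simpa using e, rfl⟩
  · rintro (⟨b', bs', ⟨x, a, c, r, e, e'⟩, rfl⟩ | ⟨b', bs', c, r, e, rfl⟩)
    · exact ⟨x, a, c, r, e, .inl (by rw [e'])⟩
    · rcases bs'.eq_nil_or_concat with rfl | ⟨l, a, rfl⟩
      · exact ⟨[], b', c, r, by simpa using e, .inr (by simp)⟩
      · exact ⟨b' :: l, a, c, r, by simpa using e, .inr (by simp)⟩

namespace Spine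

/-- Moves at a vertex `μ`, seen on the last stretch. -/
theorem move_node_iff_splitStretch {p : Bool} {b : ℕ} {bs : List ℕ} {u : Spine p}
    (h : 0 < b ∧ ∀ x ∈ bs, 0 < x) {Q : Spine p → Prop} {Q' : List (Finset ℕ) → Prop}
    (h1 : ∀ b' bs', Q (.node b' bs' u) ↔ Q' [stretch u.total (b' :: bs')])
    (h2 : ∀ b' bs' c r, Q (.node b' bs' (.node c r u)) ↔
      Q' [stretch u.total (c :: r), stretch (Spine.node c r u).total (b' :: bs')]) :
    (∃ u', Move u' (.node b bs u) ∧ Q u') ↔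
      (∃ u', Move u' u ∧ Q (.node b bs u')) ∨
        ∃ ss, SplitStretch (stretch u.total (b :: bs)) ss ∧ Q' ss := by
  simp only [move_node_iff, splitStretch_node_iff h]
  constructor
  · rintro ⟨_, ⟨b', bs', u', rfl, hw⟩, hQ⟩
    rcases wordMove_iff.1 hw with
      (⟨x, a, c, r, e, e', rfl⟩ | ⟨c, r, e, rfl⟩) | ⟨e, hu⟩
    · exact .inr ⟨_, .inl ⟨b', bs', ⟨x, a, c, r, e, e'⟩, rfl⟩, (h1 _ _).1 hQ⟩
    · exact .inr ⟨_, .inr ⟨b', bs', c, r, e, rfl⟩, (h2 _ _ _ _).1 hQ⟩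
    · obtain ⟨rfl, rfl⟩ := by simpa using e
      exact .inl ⟨u', hu, hQ⟩
  · rintro (⟨u', hu, hQ⟩ | ⟨_, ⟨b', bs', ⟨x, a, c, r, e, e'⟩, rfl⟩ | ⟨b', bs', c, r, e, rfl⟩, hQ⟩)
    · exact ⟨_, ⟨b, bs, u', rfl, .inner _ _ _ hu⟩, hQ⟩
    · exact ⟨_, ⟨b', bs', u, rfl, wordMove_iff.2 (.inl (.inl ⟨x, a, c, r, e, e', rfl⟩))⟩,
        (h1 _ _).2 hQ⟩
    · exact ⟨_, ⟨b', bs', _, rfl, wordMove_iff.2 (.inl (.inr ⟨c, r, e, rfl⟩))⟩,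
        (h2 _ _ _ _).2 hQ⟩

theorem listMove_iff : (u : Spine false) → u.Pos → ∀ R',
    ListMove u.rightStretches R' ↔ ∃ u', Move u' u ∧ u'.rightStretches = R'
  | .leaf, _, R' => by
    rw [rightStretches]
    exact iff_of_false not_listMove_nil fun ⟨_, h, _⟩ => not_move_leaf h
  | .node b bs u, h, R' => by
    rw [move_node_iff_splitStretch h.1 (Q' := fun ss => R' = u.rightStretches ++ ss)]
    · rw [rightStretches, listMove_append_singleton]
      refine or_congr ⟨?_, ?_⟩ Iff.rfl
      · rintro ⟨R₁, h1, rfl⟩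
        obtain ⟨u', hu, rfl⟩ := (u.listMove_iff h.2 R₁).1 h1
        exact ⟨u', hu, by rw [rightStretches, (u.move_spec u' hu).2.1]⟩
      · rintro ⟨u', hu, rfl⟩
        exact ⟨_, (u.listMove_iff h.2 _).2 ⟨u', hu, rfl⟩,
          by rw [rightStretches, (u.move_spec u' hu).2.1]⟩
    · intro b' bs'
      rw [rightStretches, eq_comm]
    · intro b' bs' c r
      rw [rightStretches, rightStretches, eq_comm]
      simp

theorem faceMove_toExpr_iff : (u : Spine true) → u.Pos → ∀ e,
    FaceMove u.toExpr e ↔ ∃ u', Move u' u ∧ u'.toExpr = e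
  | .node b bs u, h, e => by
    have ih := u.faceMove_toExpr_iff h.2
    rw [move_node_iff_splitStretch h.1
      (Q' := fun ss => e = ⟨u.toExpr.left ++ ss, u.toExpr.mid, u.toExpr.right⟩)]
    · have hE : ∀ u', Move u' u → (Spine.node b bs u').toExpr =
          ⟨u'.toExpr.left ++ [stretch u.total (b :: bs)], u'.toExpr.mid, u'.toExpr.right⟩ := by
        intro u' hu
        rw [toExpr, (u.move_spec u' hu).2.1]
      have h1 : (∃ u', Move u' u ∧ (Spine.node b bs u').toExpr = e) ↔
          ∃ e', FaceMove u.toExpr e' ∧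
            e = ⟨e'.left ++ [stretch u.total (b :: bs)], e'.mid, e'.right⟩ := by
        constructor
        · rintro ⟨u', hu, rfl⟩
          exact ⟨_, (ih _).2 ⟨u', hu, rfl⟩, hE u' hu⟩
        · rintro ⟨_, he, rfl⟩
          obtain ⟨u', hu, rfl⟩ := (ih _).1 he
          exact ⟨u', hu, hE u' hu⟩
      rw [h1, toExpr, faceMove_iff]
      generalize u.toExpr = e₀
      obtain ⟨L, m, R⟩ := e₀
      simp only [faceMove_iff, listMove_append_singleton]
      constructor
      · rintro (((⟨_, ⟨L', hL, rfl⟩ | ⟨ss, hs, rfl⟩, rfl⟩ | ⟨R', hR, rfl⟩) | ⟨x, hx, rfl⟩) |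
          ⟨x, hx, hx', rfl⟩ | ⟨x, hx, hx', rfl⟩)
        · exact .inl ⟨_, .inl (.inl (.inl ⟨L', hL, rfl⟩)), rfl⟩
        · exact .inr ⟨ss, hs, rfl⟩
        · exact .inl ⟨_, .inl (.inl (.inr ⟨R', hR, rfl⟩)), rfl⟩
        · exact .inl ⟨_, .inl (.inr ⟨x, hx, rfl⟩), rfl⟩
        · exact .inl ⟨_, .inr (.inl ⟨x, hx, hx', rfl⟩), rfl⟩
        · exact .inl ⟨_, .inr (.inr ⟨x, hx, hx', rfl⟩), rfl⟩
      · rintro (⟨_, (((⟨L', hL, rfl⟩ | ⟨R', hR, rfl⟩) | ⟨x, hx, rfl⟩) |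
          ⟨x, hx, hx', rfl⟩ | ⟨x, hx, hx', rfl⟩), rfl⟩ | ⟨ss, hs, rfl⟩)
        · exact .inl (.inl (.inl ⟨_, .inl ⟨L', hL, rfl⟩, rfl⟩))
        · exact .inl (.inl (.inr ⟨R', hR, rfl⟩))
        · exact .inl (.inr ⟨x, hx, rfl⟩)
        · exact .inr (.inl ⟨x, hx, hx', rfl⟩)
        · exact .inr (.inr ⟨x, hx, hx', rfl⟩)
        · exact .inl (.inl (.inl ⟨_, .inr ⟨ss, hs, rfl⟩, rfl⟩))
    · intro b' bs'
      rw [toExpr, eq_comm]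
    · intro b' bs' c r
      rw [toExpr, toExpr, eq_comm]
      simp
  | .half bs u, h, e => by
    have ih := u.listMove_iff h.2
    rw [toExpr, faceMove_iff]
    simp only [move_half_iff, wordMove_iff]
    constructor
    · rintro (((⟨L', hL, rfl⟩ | ⟨R', hR, rfl⟩) | ⟨x, hx, rfl⟩) |
          ⟨x, hx, ⟨y, hy, hxy⟩, rfl⟩ | ⟨x, hx, ⟨y, hy, hxy⟩, rfl⟩)
      · exact absurd hL not_listMove_nil
      · obtain ⟨u', hu, rfl⟩ := (ih _).1 hR
        exact ⟨.half bs u', .inl ⟨_, _, .inr ⟨rfl, hu⟩, rfl⟩,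
          by rw [toExpr, (u.move_spec u' hu).2.1]⟩
      · obtain ⟨l, b, c, r, rfl, rfl⟩ := (isInner_stretch h.1).1 hx
        refine ⟨.half (l ++ (b + c) :: r) u,
          .inl ⟨_, _, .inl (.inl ⟨l, b, c, r, rfl, rfl, rfl⟩), rfl⟩, ?_⟩
        rw [toExpr, erase_stretch (h.1 b (by simp)) (h.1 c (by simp))]
      · obtain ⟨l, r, rfl, rfl⟩ := mem_stretch.1 hx
        rw [lower_stretch, upper_stretch]
        cases l with
        | nil =>
          have := (stretch_bounds hy).2
          rw [List.nil_append] at this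
          omega
        | cons b l =>
          refine ⟨.node b l (.half r u), .inr ⟨b, l, r, rfl, rfl⟩, ?_⟩
          rw [toExpr, toExpr, total, add_comm]
          rfl
      · obtain ⟨l, r, rfl, rfl⟩ := mem_stretch.1 hx
        rw [lower_stretch, upper_stretch]
        cases r with
        | nil =>
          have := (stretch_bounds hy).1
          rw [List.sum_nil] at hxy
          omega
        | cons c r =>
          refine ⟨.half l (.node c r u), .inl ⟨_, _, .inl (.inr ⟨c, r, rfl, rfl⟩), rfl⟩, ?_⟩
          rw [toExpr, rightStretches, total, List.sum_cons, add_comm]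
    · rintro ⟨_, ⟨bs', u', (⟨l, b, c, r, rfl, rfl, rfl⟩ | ⟨c, r, rfl, rfl⟩) | ⟨rfl, hu⟩, rfl⟩ |
        ⟨b, l, r, rfl, rfl⟩, rfl⟩
      · refine .inl (.inr ⟨_, (isInner_stretch h.1).2 ⟨l, b, c, r, rfl, rfl⟩, ?_⟩)
        rw [toExpr, erase_stretch (h.1 b (by simp)) (h.1 c (by simp))]
      · refine .inr (.inr ⟨_, mem_stretch.2 ⟨bs', c :: r, rfl, rfl⟩,
          ⟨_, (isLeast_stretch _ _).1, ?_⟩, ?_⟩)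
        · have := h.1 c (by simp)
          rw [List.sum_cons]
          omega
        · rw [lower_stretch, upper_stretch, toExpr, rightStretches, total, List.sum_cons,
            add_comm]
      · exact .inl (.inl (.inr ⟨_, (ih _).2 ⟨u', hu, rfl⟩,
          by rw [toExpr, (u.move_spec u' hu).2.1]⟩))
      · refine .inr (.inl ⟨_, mem_stretch.2 ⟨b :: l, r, rfl, rfl⟩,
          ⟨_, (isGreatest_stretch _ _).1, ?_⟩, ?_⟩)
        · have := h.1 b (by simp)
          simp only [List.sum_cons, List.sum_append]
          omega
        · have h1 := lower_stretch (a := u.total) (l := b :: l) (r := r)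
          have h2 := upper_stretch (a := u.total) (l := b :: l) (r := r)
          rw [List.cons_append] at h1 h2
          rw [h1, h2, toExpr, toExpr, total, add_comm]
          rfl

end Spine

/-! ### Faces of the freehedron as spines -/

/-- Painted spines that describe faces of the freehedron `F_n`. -/
def SpineFace (n : ℕ) : Type := {u : Spine true // u.Pos ∧ u.total = n}

/-- The face of the freehedron given by a spine. -/
def SpineFace.toFace {n : ℕ} (u : SpineFace n) : Freehedron n :=
  ⟨u.1.toExpr, by
    have h := u.1.isNice_toExpr u.2.1
    rwa [u.2.2] at h⟩

theorem SpineFace.toTriple_toFace {n : ℕ} (u : SpineFace n) : u.toFace.toTriple = u.1.triple :=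
  u.1.triple_eq u.2.1

theorem SpineFace.ext_of_triple {n : ℕ} {u v : SpineFace n} (h : u.1.triple = v.1.triple) :
    u = v := by
  refine Subtype.ext ?_
  rw [← (u.1.toTree_spec u.2.1).1, ← (v.1.toTree_spec v.2.1).1, ← Spine.triple_toTree,
    ← Spine.triple_toTree, h]

theorem SpineFace.toFace_bijective (n : ℕ) : Function.Bijective (toFace (n := n)) := by
  constructor
  · intro u v h
    exact ext_of_triple (by rw [← toTriple_toFace, ← toTriple_toFace, h])
  · rintro ⟨e, he⟩
    obtain ⟨u, hu, rfl⟩ := Spine.exists_toExpr_eq he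
    exact ⟨⟨u, hu⟩, rfl⟩

/-- The faces of the freehedron are in bijection with spines. -/
def faceEquiv (n : ℕ) : SpineFace n ≃ Freehedron n :=
  Equiv.ofBijective _ (SpineFace.toFace_bijective n)

theorem dim_faceEquiv {n : ℕ} (u : SpineFace n) : FaceSystem.dim (faceEquiv n u) = u.1.dim := by
  obtain ⟨u, hu, rfl⟩ := u
  exact u.dim_toExpr hu

theorem facet_faceEquiv {n : ℕ} (u' u : SpineFace n) :
    FaceSystem.facet (faceEquiv n u') (faceEquiv n u) ↔ Spine.Move u'.1 u.1 := by
  refine (u.1.faceMove_toExpr_iff u.2.1 _).trans ⟨?_, fun h => ⟨_, h, rfl⟩⟩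
  rintro ⟨v, hv, e⟩
  have hs := u.1.move_spec v hv
  have : (⟨v, hs.2.2 u.2.1, hs.2.1.trans u.2.2⟩ : SpineFace n) = u' :=
    (SpineFace.toFace_bijective n).1 (Subtype.ext e)
  rwa [← this]

/-! ### The face poset of the freehedron -/

namespace Spine

/-- The elements that are present. -/
def present {p : Bool} : Spine p → Finset ℕ
  | .leaf => {0}
  | .node b bs u => u.present ∪ stretch u.total (b :: bs)
  | .half bs u => u.present ∪ stretch u.total bs

/-- The end points of the stretches. -/
def breaks {p : Bool} : Spine p → Finset ℕ
  | .leaf => {0}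
  | .node b bs u => insert (Spine.node b bs u).total u.breaks
  | .half bs u => insert (Spine.half bs u).total u.breaks

/-- The minimum of the distinguished stretch; zero for unpainted spines. -/
def lo {p : Bool} : Spine p → ℕ
  | .leaf => 0
  | .node _ _ u => u.lo
  | .half _ u => u.total

/-- The maximum of the distinguished stretch; zero for unpainted spines. -/
def hi {p : Bool} : Spine p → ℕ
  | .leaf => 0
  | .node _ _ u => u.hi
  | .half bs u => (Spine.half bs u).total

/-- The order of faces, in terms of elements and breaks. -/
structure Below {p : Bool} (u' u : Spine p) : Prop where
  present : u'.present ⊆ u.present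
  breaks : u.breaks ⊆ u'.breaks
  lo : u.lo ≤ u'.lo
  hi : u'.hi ≤ u.hi

theorem Below.refl {p : Bool} (u : Spine p) : Below u u :=
  ⟨Finset.Subset.refl _, Finset.Subset.refl _, le_refl _, le_refl _⟩

theorem Below.trans {p : Bool} {u v w : Spine p} (h : Below u v) (h' : Below v w) : Below u w :=
  ⟨h.1.trans h'.1, h'.2.trans h.2, h'.3.trans h.3, h.4.trans h'.4⟩

theorem total_mem_breaks {p : Bool} : (u : Spine p) → u.total ∈ u.breaks
  | .leaf => by simp [total, breaks]
  | .node b bs u => Finset.mem_insert_self _ _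
  | .half bs u => Finset.mem_insert_self _ _

theorem total_node {p : Bool} (b : ℕ) (bs : List ℕ) (u : Spine p) :
    (Spine.node b bs u).total = u.total + (b :: bs).sum := by
  rw [total, List.sum_cons, add_comm]

theorem total_half (bs : List ℕ) (u : Spine false) :
    (Spine.half bs u).total = u.total + bs.sum := by
  rw [total, add_comm]

theorem present_le {p : Bool} : (u : Spine p) → ∀ x ∈ u.present, x ≤ u.total
  | .leaf => by simp [total, present]
  | .node b bs u => by
    intro x hx
    rw [total_node]
    rcases Finset.mem_union.1 hx with hx | hx
    · exact (u.present_le x hx).trans (Nat.le_add_right _ _)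
    · exact (stretch_bounds hx).2
  | .half bs u => by
    intro x hx
    rw [total_half]
    rcases Finset.mem_union.1 hx with hx | hx
    · exact (u.present_le x hx).trans (Nat.le_add_right _ _)
    · exact (stretch_bounds hx).2

theorem breaks_subset {p : Bool} : (u : Spine p) → u.breaks ⊆ u.present
  | .leaf => Finset.Subset.refl _
  | .node b bs u => by
    rw [breaks, Finset.insert_subset_iff, total_node]
    exact ⟨Finset.mem_union_right _ (isGreatest_stretch _ _).1,
      u.breaks_subset.trans Finset.subset_union_left⟩
  | .half bs u => by
    rw [breaks, Finset.insert_subset_iff, total_half]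
    exact ⟨Finset.mem_union_right _ (isGreatest_stretch _ _).1,
      u.breaks_subset.trans Finset.subset_union_left⟩

theorem total_mem_present {p : Bool} (u : Spine p) : u.total ∈ u.present :=
  u.breaks_subset u.total_mem_breaks

theorem hi_eq_zero : (u : Spine false) → u.hi = 0
  | .leaf => rfl
  | .node _ _ u => u.hi_eq_zero

theorem lo_eq_zero : (u : Spine false) → u.lo = 0
  | .leaf => rfl
  | .node _ _ u => u.lo_eq_zero

theorem lo_le_hi {p : Bool} : (u : Spine p) → u.lo ≤ u.hi ∧ u.hi ≤ u.total
  | .leaf => ⟨le_refl _, le_refl _⟩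
  | .node b bs u => by
    have := u.lo_le_hi
    rw [total_node]
    exact ⟨this.1, this.2.trans (Nat.le_add_right _ _)⟩
  | .half bs u => ⟨by rw [lo, hi, total_half]; exact Nat.le_add_right _ _, le_refl _⟩

theorem lo_mem_breaks {p : Bool} : (u : Spine p) → (p = true → u.lo ∈ u.breaks ∧ u.hi ∈ u.breaks)
  | .leaf, h => by cases h
  | .node b bs u, h =>
    ⟨Finset.mem_insert_of_mem (u.lo_mem_breaks h).1, Finset.mem_insert_of_mem (u.lo_mem_breaks h).2⟩
  | .half bs u, _ => ⟨Finset.mem_insert_of_mem u.total_mem_breaks, Finset.mem_insert_self _ _⟩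

theorem breaks_outside {p : Bool} : (u : Spine p) → ∀ x ∈ u.breaks, x ≤ u.lo ∨ u.hi ≤ x
  | .leaf => fun _ _ => .inr (Nat.zero_le _)
  | .node b bs u => by
    intro x hx
    rcases Finset.mem_insert.1 hx with rfl | hx
    · exact .inr (Spine.node b bs u).lo_le_hi.2
    · exact u.breaks_outside x hx
  | .half bs u => by
    intro x hx
    rcases Finset.mem_insert.1 hx with rfl | hx
    · exact .inr (le_refl _)
    · exact .inl (u.present_le x (u.breaks_subset hx))

/-! #### Moves in terms of elements and breaks -/

theorem below_of_wordMove {p : Bool} {l l' : List ℕ} {u u' : Spine p}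
    (hu : Move u' u → Below u' u) (h : WordMove l' u' l u) :
    u'.present ∪ stretch u'.total l' ⊆ u.present ∪ stretch u.total l ∧ u.breaks ⊆ u'.breaks ∧
      (u.lo ≤ u'.lo ∧ u'.hi ≤ u.hi) ∧ u.total ≤ u'.total := by
  cases h with
  | merge l a b r =>
    refine ⟨Finset.union_subset_union (Finset.Subset.refl _) ?_, Finset.Subset.refl _,
      ⟨le_refl _, le_refl _⟩, le_refl _⟩
    rw [stretch_append, stretch_append, List.sum_cons, List.sum_cons, List.sum_cons, ← add_assoc a]
    refine Finset.union_subset_union (Finset.Subset.refl _) ?_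
    rw [stretch, stretch, stretch, List.sum_cons, ← add_assoc a]
    exact Finset.insert_subset_insert _ (Finset.subset_insert _ _)
  | nest _ b r =>
    refine ⟨?_, Finset.subset_insert _ _, ⟨le_refl _, le_refl _⟩, ?_⟩
    · rw [total_node, stretch_append, present, Finset.union_assoc, Finset.union_comm (stretch _ _)]
    · rw [total_node]
      exact Nat.le_add_right _ _
  | inner _ _ _ h =>
    have h1 := hu h
    have h2 := (u.move_spec u' h).2.1
    rw [h2]
    exact ⟨Finset.union_subset_union h1.1 (Finset.Subset.refl _), h1.2, ⟨h1.3, h1.4⟩, le_refl _⟩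

theorem below_of_move {p : Bool} : (u : Spine p) → ∀ u', Move u' u → Below u' u
  | .leaf, _, h => absurd h not_move_leaf
  | .node b bs u, x, h => by
    have ht := (Spine.move_spec _ _ h).2.1
    obtain ⟨b', bs', u', rfl, hw⟩ := move_node_iff.1 h
    obtain ⟨h1, h2, h3, h4⟩ := below_of_wordMove (u.below_of_move u') hw
    refine ⟨h1, ?_, h3.1, h3.2⟩
    rw [breaks, breaks, ht]
    exact Finset.insert_subset_insert _ h2
  | .half bs u, x, h => by
    have ht := (Spine.move_spec _ _ h).2.1
    rcases move_half_iff.1 h with ⟨bs', u', hw, rfl⟩ | ⟨b, l, r, rfl, rfl⟩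
    · obtain ⟨h1, h2, h3, h4⟩ := below_of_wordMove (u.below_of_move u') hw
      refine ⟨h1, ?_, h4, ht.le⟩
      rw [breaks, breaks, ht]
      exact Finset.insert_subset_insert _ h2
    · refine ⟨?_, ?_, le_refl _, ?_⟩
      · have := stretch_append u.total r (b :: l)
        rw [List.cons_append] at this
        rw [present, present, present, this, total_half, Finset.union_assoc,
          Finset.union_comm (stretch _ r)]
      · rw [breaks, breaks, breaks, ht]
        exact Finset.insert_subset_insert _ (Finset.subset_insert _ _)
      · change (Spine.half r u).total ≤ (Spine.half (b :: (l ++ r)) u).total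
        rw [← ht, total_node]
        exact Nat.le_add_right _ _

theorem IsFace.below {p : Bool} {u' u : Spine p} (h : IsFace u' u) : Below u' u := by
  induction h with
  | refl => exact .refl _
  | tail _ h ih => exact ih.trans (below_of_move _ _ h)

theorem IsFace.spec {p : Bool} {u' u : Spine p} (h : IsFace u' u) :
    u'.dim ≤ u.dim ∧ u'.total = u.total ∧ (u.Pos → u'.Pos) ∧ (u'.dim = u.dim → u' = u) := by
  induction h with
  | refl => exact ⟨le_refl _, rfl, id, fun _ => rfl⟩
  | tail _ h ih =>
    have := move_spec _ _ h
    exact ⟨by omega, by omega, fun hp => ih.2.2.1 (this.2.2 hp), fun h => by omega⟩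

/-- An element that is not a break is an inner element of the last stretch, or an element of the
remaining spine that is not a break. -/
theorem mem_present_cases {p : Bool} {u : Spine p} {l : List ℕ} (hl : ∀ y ∈ l, 0 < y) {x : ℕ}
    (hx : x ∈ u.present ∪ stretch u.total l) (hx' : x ∉ insert (u.total + l.sum) u.breaks) :
    (x ∈ u.present ∧ x ∉ u.breaks ∧ x < u.total) ∨
      ∃ l₁ b c r, l = l₁ ++ b :: c :: r ∧ x = u.total + (c + r.sum) := by
  rw [Finset.mem_insert, not_or] at hx'
  have h0 : x ≠ u.total := fun h => hx'.2 (h ▸ u.total_mem_breaks)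
  rcases Finset.mem_union.1 hx with hx | hx
  · exact .inl ⟨hx, hx'.2, lt_of_le_of_ne (u.present_le x hx) h0⟩
  · refine .inr ((isInner_stretch hl).1 ⟨hx, ⟨_, (isLeast_stretch _ _).1, ?_⟩, _,
      (isGreatest_stretch _ _).1, ?_⟩)
    · exact lt_of_le_of_ne (stretch_bounds hx).1 h0.symm
    · exact lt_of_le_of_ne (stretch_bounds hx).2 hx'.1

theorem present_erase_inner {p : Bool} {u : Spine p} {l : List ℕ} {b c : ℕ} {r : List ℕ}
    (hl : ∀ y ∈ l ++ b :: c :: r, 0 < y) :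
    u.present ∪ stretch u.total (l ++ (b + c) :: r) =
      (u.present ∪ stretch u.total (l ++ b :: c :: r)).erase (u.total + (c + r.sum)) := by
  have hc := hl c (by simp)
  rw [Finset.erase_union_distrib, erase_stretch (hl b (by simp)) hc, Finset.erase_eq_of_notMem]
  intro h
  have := u.present_le _ h
  omega

theorem present_erase_outer {p : Bool} {u u' : Spine p} {l : List ℕ} {x : ℕ} (hx : x < u.total)
    (ht : u'.total = u.total) (h : u'.present = u.present.erase x) :
    u'.present ∪ stretch u'.total l = (u.present ∪ stretch u.total l).erase x := by
  rw [Finset.erase_union_distrib, ht, h, Finset.erase_eq_of_notMem (s := stretch _ _)]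
  intro h
  have := (stretch_bounds h).1
  omega

/-- Any element that is not a break can be dropped. -/
theorem exists_drop {p : Bool} : (u : Spine p) → u.Pos → ∀ x ∈ u.present, x ∉ u.breaks →
    ∃ u', Move u' u ∧ u'.present = u.present.erase x ∧ u'.breaks = u.breaks ∧ u'.lo = u.lo ∧
      u'.hi = u.hi
  | .leaf, _, x, hx, hx' => absurd hx hx'
  | .node b bs u, h, x, hx, hx' => by
    have hb : ∀ y ∈ b :: bs, 0 < y := by simpa using h.1
    rw [breaks, total_node] at hx'
    rcases mem_present_cases hb hx hx' with ⟨h1, h2, h3⟩ | ⟨l, a, c, r, e, rfl⟩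
    · obtain ⟨u', hu, h4, h5, h6, h7⟩ := u.exists_drop h.2 x h1 h2
      have ht := (u.move_spec u' hu).2.1
      refine ⟨.node b bs u', .node _ _ _ _ _ _ (.inner _ _ _ hu), present_erase_outer h3 ht h4, ?_,
        h6, h7⟩
      rw [breaks, breaks, total_node, total_node, ht, h5]
    · obtain ⟨b', bs', e'⟩ : ∃ b' bs', l ++ (a + c) :: r = b' :: bs' := by
        cases l <;> exact ⟨_, _, rfl⟩
      have hm : Move (.node b' bs' u) (.node b bs u) := by
        refine .node _ _ _ _ _ _ ?_
        rw [e, ← e']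
        exact .merge _ _ _ _ _
      refine ⟨_, hm, ?_, ?_, rfl, rfl⟩
      · rw [present, present, ← e', e]
        exact present_erase_inner (e ▸ hb)
      · rw [breaks, breaks, (move_spec _ _ hm).2.1]
  | .half bs u, h, x, hx, hx' => by
    rw [breaks, total_half] at hx'
    rcases mem_present_cases h.1 hx hx' with ⟨h1, h2, h3⟩ | ⟨l, a, c, r, rfl, rfl⟩
    · obtain ⟨u', hu, h4, h5, h6, h7⟩ := u.exists_drop h.2 x h1 h2
      have ht := (u.move_spec u' hu).2.1
      refine ⟨.half bs u', .half _ _ _ _ (.inner _ _ _ hu), present_erase_outer h3 ht h4, ?_,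
        ht, ?_⟩
      · rw [breaks, breaks, total_half, total_half, ht, h5]
      · rw [hi, hi, total_half, total_half, ht]
    · have hm : Move (.half (l ++ (a + c) :: r) u) (.half (l ++ a :: c :: r) u) :=
        .half _ _ _ _ (.merge _ _ _ _ _)
      exact ⟨_, hm, present_erase_inner h.1, by rw [breaks, breaks, (move_spec _ _ hm).2.1], rfl,
        (move_spec _ _ hm).2.1⟩

/-- Any element outside the distinguished stretch can be made a break. -/
theorem exists_break {p : Bool} : (u : Spine p) → u.Pos → ∀ x ∈ u.present, x ∉ u.breaks →
    (x ≤ u.lo ∨ u.hi ≤ x) → ∃ u', Move u' u ∧ u'.present = u.present ∧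
      u'.breaks = insert x u.breaks ∧ u'.lo = u.lo ∧ u'.hi = u.hi
  | .leaf, _, x, hx, hx', _ => absurd hx hx'
  | .node b bs u, h, x, hx, hx', ho => by
    have hb : ∀ y ∈ b :: bs, 0 < y := by simpa using h.1
    rw [breaks, total_node] at hx'
    rcases mem_present_cases hb hx hx' with ⟨h1, h2, h3⟩ | ⟨l, a, c, r, e, rfl⟩
    · obtain ⟨u', hu, h4, h5, h6, h7⟩ := u.exists_break h.2 x h1 h2 ho
      have ht := (u.move_spec u' hu).2.1
      refine ⟨.node b bs u', .node _ _ _ _ _ _ (.inner _ _ _ hu), ?_, ?_, h6, h7⟩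
      · rw [present, present, h4, ht]
      · rw [breaks, breaks, total_node, total_node, ht, h5, Finset.insert_comm]
    · obtain ⟨b', bs', e'⟩ : ∃ b' bs', l ++ [a] = b' :: bs' := by
        cases l <;> exact ⟨_, _, rfl⟩
      have e₂ : b :: bs = (b' :: bs') ++ c :: r := by rw [e, ← e']; simp
      have hm : Move (.node b' bs' (.node c r u)) (.node b bs u) := by
        refine .node _ _ _ _ _ _ ?_
        rw [e₂]
        exact .nest _ _ _ _
      refine ⟨_, hm, ?_, ?_, rfl, rfl⟩
      · rw [present, present, present, e₂, stretch_append, total_node, Finset.union_assoc,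
          Finset.union_comm (stretch _ (c :: r))]
      · rw [breaks, breaks, breaks, (move_spec _ _ hm).2.1, total_node c, List.sum_cons]
        exact Finset.insert_comm _ _ _
  | .half bs u, h, x, hx, hx', ho => by
    rw [breaks, total_half] at hx'
    rcases mem_present_cases h.1 hx hx' with ⟨h1, h2, h3⟩ | ⟨l, a, c, r, rfl, rfl⟩
    · obtain ⟨u', hu, h4, h5, h6, h7⟩ := u.exists_break h.2 x h1 h2
        (.inr (u.hi_eq_zero ▸ Nat.zero_le _))
      have ht := (u.move_spec u' hu).2.1
      refine ⟨.half bs u', .half _ _ _ _ (.inner _ _ _ hu), ?_, ?_, ht, ?_⟩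
      · rw [present, present, h4, ht]
      · rw [breaks, breaks, total_half, total_half, ht, h5, Finset.insert_comm]
      · rw [hi, hi, total_half, total_half, ht]
    · have h1 := h.1 a (by simp)
      have h2 := h.1 c (by simp)
      rw [lo, hi, total_half, List.sum_append, List.sum_cons, List.sum_cons] at ho
      omega

/-- The minimum of the distinguished stretch can be moved to any of its elements. -/
theorem exists_leftOuter {p : Bool} : (u : Spine p) → ∀ x ∈ u.present, u.lo < x → x ≤ u.hi →
    ∃ u', Move u' u ∧ u'.present = u.present ∧ u'.breaks = insert x u.breaks ∧ u'.lo = x ∧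
      u'.hi = u.hi
  | .leaf, x, _, h, h' => absurd h (by rw [hi] at h'; rw [lo]; omega)
  | .node b bs u, x, hx, h, h' => by
    have hx : x ∈ u.present := by
      rcases Finset.mem_union.1 hx with hx | hx
      · exact hx
      · have h1 := (stretch_bounds hx).1
        have h2 := u.lo_le_hi.2
        rw [hi] at h'
        rw [show x = u.total by omega]
        exact u.total_mem_present
    obtain ⟨u', hu, h4, h5, h6, h7⟩ := u.exists_leftOuter x hx h h'
    have ht := (u.move_spec u' hu).2.1
    refine ⟨.node b bs u', .node _ _ _ _ _ _ (.inner _ _ _ hu), ?_, ?_, h6, h7⟩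
    · rw [present, present, h4, ht]
    · rw [breaks, breaks, total_node, total_node, ht, h5, Finset.insert_comm]
  | .half bs u, x, hx, h, h' => by
    rcases Finset.mem_union.1 hx with hx | hx
    · have := u.present_le x hx
      rw [lo] at h
      omega
    · obtain ⟨l, r, rfl, rfl⟩ := mem_stretch.1 hx
      cases r with
      | nil => rw [lo, List.sum_nil] at h; omega
      | cons c r =>
        have hm : Move (.half l (.node c r u)) (.half (l ++ c :: r) u) :=
          .half _ _ _ _ (.nest _ _ _ _)
        refine ⟨_, hm, ?_, ?_, total_node _ _ _, (move_spec _ _ hm).2.1⟩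
        · rw [present, present, present, stretch_append, total_node, Finset.union_assoc,
            Finset.union_comm (stretch _ (c :: r))]
        · rw [breaks, breaks, breaks, (move_spec _ _ hm).2.1, total_node]
          exact Finset.insert_comm _ _ _

/-- The maximum of the distinguished stretch can be moved to any of its elements. -/
theorem exists_rightOuter {p : Bool} : (u : Spine p) → ∀ x ∈ u.present, u.lo ≤ x → x < u.hi →
    ∃ u', Move u' u ∧ u'.present = u.present ∧ u'.breaks = insert x u.breaks ∧ u'.lo = u.lo ∧
      u'.hi = x
  | .leaf, x, _, _, h' => absurd h' (by rw [hi]; omega)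
  | .node b bs u, x, hx, h, h' => by
    have hx : x ∈ u.present := by
      rcases Finset.mem_union.1 hx with hx | hx
      · exact hx
      · have h1 := (stretch_bounds hx).1
        have h2 := u.lo_le_hi.2
        rw [hi] at h'
        omega
    obtain ⟨u', hu, h4, h5, h6, h7⟩ := u.exists_rightOuter x hx h h'
    have ht := (u.move_spec u' hu).2.1
    refine ⟨.node b bs u', .node _ _ _ _ _ _ (.inner _ _ _ hu), ?_, ?_, h6, h7⟩
    · rw [present, present, h4, ht]
    · rw [breaks, breaks, total_node, total_node, ht, h5, Finset.insert_comm]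
  | .half bs u, x, hx, h, h' => by
    have hx : x ∈ stretch u.total bs := by
      rcases Finset.mem_union.1 hx with hx | hx
      · have := u.present_le x hx
        rw [lo] at h
        rw [show x = u.total by omega]
        exact (isLeast_stretch _ _).1
      · exact hx
    obtain ⟨l, r, rfl, rfl⟩ := mem_stretch.1 hx
    cases l with
    | nil => rw [hi, total_half, List.nil_append] at h'; omega
    | cons b l =>
      have hm : Move (.node b l (.half r u)) (.half (b :: (l ++ r)) u) := .paint _ _ _ _
      refine ⟨_, hm, ?_, ?_, rfl, total_half _ _⟩
      · rw [present, present, present, stretch_append, total_half, Finset.union_assoc,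
          Finset.union_comm (stretch _ r)]
      · rw [breaks, breaks, breaks, (move_spec _ _ hm).2.1, total_half r]
        exact Finset.insert_comm _ _ _

/-- A spine of positive dimension has an element that is not a break, or a distinguished stretch
with more than one element. -/
theorem exists_of_dim_pos {p : Bool} : (u : Spine p) → u.Pos → 0 < u.dim →
    (∃ x ∈ u.present, x ∉ u.breaks) ∨ u.lo < u.hi
  | .leaf, _, h => by simp [dim] at h
  | .node b [] u, hp, h => by
    rw [dim, List.length_nil, zero_add] at h
    refine (u.exists_of_dim_pos hp.2 h).imp_left ?_
    rintro ⟨x, h1, h2⟩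
    refine ⟨x, Finset.mem_union_left _ h1, ?_⟩
    rw [breaks, total_node, Finset.mem_insert, not_or]
    have := u.present_le x h1
    have := hp.1.1
    exact ⟨by rw [List.sum_cons]; omega, h2⟩
  | .node b (c :: r) u, hp, _ => by
    refine .inl ⟨u.total + (c + r.sum), Finset.mem_union_right _
      (mem_stretch.2 ⟨[b], c :: r, rfl, rfl⟩), ?_⟩
    have h1 := hp.1.1
    have h2 := hp.1.2 c (by simp)
    rw [breaks, total_node, Finset.mem_insert, not_or, List.sum_cons, List.sum_cons]
    refine ⟨by omega, fun h => ?_⟩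
    have := u.present_le _ (u.breaks_subset h)
    omega
  | .half [] u, hp, h => by
    rw [dim, List.length_nil, zero_add] at h
    rcases u.exists_of_dim_pos hp.2 h with ⟨x, h1, h2⟩ | h
    · refine .inl ⟨x, Finset.mem_union_left _ h1, ?_⟩
      rw [breaks, total_half, Finset.mem_insert, not_or]
      refine ⟨?_, h2⟩
      rintro rfl
      exact h2 u.total_mem_breaks
    · rw [u.hi_eq_zero] at h
      omega
  | .half (b :: bs) u, hp, _ => by
    have := hp.1 b (by simp)
    refine .inr ?_
    rw [lo, hi, total_half, List.sum_cons]
    omega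

/-! #### The order criterion -/

theorem filter_le_present {p : Bool} (u : Spine p) (l : List ℕ) :
    (u.present ∪ stretch u.total l).filter (· ≤ u.total) = u.present ∧
      (u.present ∪ stretch u.total l).filter (u.total ≤ ·) = stretch u.total l := by
  constructor <;> ext x <;> rw [Finset.mem_filter, Finset.mem_union]
  · refine ⟨?_, fun h => ⟨.inl h, u.present_le x h⟩⟩
    rintro ⟨h | h, h'⟩
    · exact h
    · rw [le_antisymm h' (stretch_bounds h).1]
      exact u.total_mem_present
  · refine ⟨?_, fun h => ⟨.inr h, (stretch_bounds h).1⟩⟩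
    rintro ⟨h | h, h'⟩
    · rw [le_antisymm (u.present_le x h) h']
      exact (isLeast_stretch _ _).1
    · exact h

theorem breaks_erase_total {p : Bool} (u : Spine p) {x : ℕ} (hx : u.total < x) :
    (insert x u.breaks).erase x = u.breaks := by
  refine Finset.erase_insert fun h => ?_
  have := u.present_le _ (u.breaks_subset h)
  omega

/-- The data of the last stretch and of the remaining spine are determined by the elements. -/
theorem present_inj {p : Bool} {u u' : Spine p} {l l' : List ℕ} (hl : ∀ x ∈ l, 0 < x)
    (hl' : ∀ x ∈ l', 0 < x) (ht : u.total = u'.total)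
    (h : u.present ∪ stretch u.total l = u'.present ∪ stretch u'.total l') :
    u.present = u'.present ∧ l = l' := by
  obtain ⟨h1, h2⟩ := u.filter_le_present l
  obtain ⟨h1', h2'⟩ := u'.filter_le_present l'
  constructor
  · rw [← h1, ← h1', h, ht]
  · rw [← stretchTree_stretch (a := u.total) hl, ← stretchTree_stretch (a := u'.total) hl', ← h2,
      ← h2', h, ht]

theorem total_le_of_breaks {p : Bool} {u u' : Spine p} {x : ℕ} (hx : u.total < x)
    (h : insert x u.breaks = insert x u'.breaks) : u.total ≤ u'.total := by
  have h1 : u.total ∈ insert x u'.breaks := h ▸ Finset.mem_insert_of_mem u.total_mem_breaks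
  rcases Finset.mem_insert.1 h1 with h1 | h1
  · omega
  · exact u'.present_le _ (u'.breaks_subset h1)

/-- A spine is determined by its elements, its breaks and its distinguished stretch. -/
theorem ext_of_data {p : Bool} : (u u' : Spine p) → u.Pos → u'.Pos → u.total = u'.total →
    u.present = u'.present → u.breaks = u'.breaks → u.lo = u'.lo → u.hi = u'.hi → u = u'
  | .leaf, .leaf, _, _, _, _, _, _, _ => rfl
  | .leaf, .node b bs u, _, h, ht, _, _, _, _ => by
    have := h.1.1
    rw [total_node, total, List.sum_cons] at ht
    omega
  | .node b bs u, .leaf, h, _, ht, _, _, _, _ => by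
    have := h.1.1
    rw [total_node, total, List.sum_cons] at ht
    omega
  | .node b bs u, .node b' bs' u', hp, hp', ht, hP, hQ, hl, hh => by
    have h1 := hp.1.1
    have h2 := hp'.1.1
    have ht1 := total_node b bs u
    have ht2 := total_node b' bs' u'
    rw [List.sum_cons] at ht1 ht2
    rw [breaks, breaks, ht] at hQ
    have ht' : u.total = u'.total :=
      le_antisymm (total_le_of_breaks (by omega) hQ) (total_le_of_breaks (by omega) hQ.symm)
    obtain ⟨h3, h4⟩ := present_inj (by simpa using hp.1) (by simpa using hp'.1) ht' hP
    have h5 : u.breaks = u'.breaks := by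
      rw [← u.breaks_erase_total (x := (Spine.node b' bs' u').total) (by omega), hQ,
        u'.breaks_erase_total (by omega)]
    obtain ⟨rfl, rfl⟩ := by simpa using h4
    rw [u.ext_of_data u' hp.2 hp'.2 ht' h3 h5 hl hh]
  | .node b bs u, .half bs' u', hp, _, ht, _, _, _, hh => by
    have h1 := hp.1.1
    have h2 := u.lo_le_hi.2
    have ht1 := total_node b bs u
    rw [List.sum_cons] at ht1
    rw [hi, hi] at hh
    omega
  | .half bs u, .node b' bs' u', _, hp', ht, _, _, _, hh => by
    have h1 := hp'.1.1
    have h2 := u'.lo_le_hi.2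
    have ht1 := total_node b' bs' u'
    rw [List.sum_cons] at ht1
    rw [hi, hi] at hh
    omega
  | .half bs u, .half bs' u', hp, hp', ht, hP, hQ, hl, _ => by
    have ht' : u.total = u'.total := hl
    obtain ⟨h3, rfl⟩ := present_inj hp.1 hp'.1 ht' hP
    have h5 : u.breaks = u'.breaks := by
      rw [breaks, breaks, ht] at hQ
      rw [total_half] at hQ
      rcases Nat.eq_zero_or_pos bs.sum with h | h
      · rw [h, add_zero, ← ht', Finset.insert_eq_self.2 u.total_mem_breaks, ht',
          Finset.insert_eq_self.2 u'.total_mem_breaks] at hQ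
        exact hQ
      · rw [← u.breaks_erase_total (x := u'.total + bs.sum) (by omega), hQ,
          u'.breaks_erase_total (by omega)]
    rw [u.ext_of_data u' hp.2 hp'.2 ht' h3 h5 (by rw [u.lo_eq_zero, u'.lo_eq_zero])
      (by rw [u.hi_eq_zero, u'.hi_eq_zero])]

/-- A spine that is strictly below `t` is below a codimension one face of `t`: drop a superfluous
element if there is one; otherwise shrink the distinguished stretch; otherwise add a break, which
then lies outside the distinguished stretch. -/
theorem eq_or_exists_move {s t : Spine true} (hs : s.Pos) (ht : t.Pos) (hst : s.total = t.total)
    (h : Below s t) : s = t ∨ ∃ t', Move t' t ∧ Below s t' := by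
  obtain ⟨h1, h2, h3, h4⟩ := h
  have hlo := s.lo_mem_breaks rfl
  have hlh := s.lo_le_hi.1
  have h1' := s.breaks_subset
  by_cases hP : t.present ⊆ s.present
  · by_cases hl : t.lo < s.lo
    · obtain ⟨t', h, e1, e2, e3, e4⟩ := t.exists_leftOuter s.lo (h1 (h1' hlo.1)) hl (hlh.trans h4)
      exact .inr ⟨t', h, e1 ▸ h1, e2 ▸ Finset.insert_subset hlo.1 h2, e3.le, e4 ▸ h4⟩
    by_cases hh : s.hi < t.hi
    · obtain ⟨t', h, e1, e2, e3, e4⟩ :=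
        t.exists_rightOuter s.hi (h1 (h1' hlo.2)) (h3.trans hlh) hh
      exact .inr ⟨t', h, e1 ▸ h1, e2 ▸ Finset.insert_subset hlo.2 h2, e3 ▸ h3, e4.ge⟩
    have hl' : s.lo = t.lo := by omega
    have hh' : s.hi = t.hi := by omega
    by_cases hQ : s.breaks ⊆ t.breaks
    · exact .inl (ext_of_data s t hs ht hst (h1.antisymm hP) (hQ.antisymm h2) hl' hh')
    · obtain ⟨x, hx, hx'⟩ := Finset.not_subset.1 hQ
      obtain ⟨t', h, e1, e2, e3, e4⟩ := t.exists_break ht x (h1 (h1' hx)) hx'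
        (hl' ▸ hh' ▸ s.breaks_outside x hx)
      exact .inr ⟨t', h, e1 ▸ h1, e2 ▸ Finset.insert_subset hx h2, e3 ▸ h3, e4 ▸ h4⟩
  · obtain ⟨x, hx, hx'⟩ := Finset.not_subset.1 hP
    obtain ⟨t', h, e1, e2, e3, e4⟩ := t.exists_drop ht x hx fun hb => hx' (h1' (h2 hb))
    refine .inr ⟨t', h, e1 ▸ Finset.subset_erase.2 ⟨h1, hx'⟩, e2 ▸ h2, e3 ▸ h3, e4 ▸ h4⟩

/-- The combinatorial order `Below` is the face relation; the induction is on the dimension of the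
bigger face. -/
theorem isFace_of_below : ∀ (d : ℕ) {s t : Spine true}, t.dim = d → s.Pos → t.Pos →
    s.total = t.total → Below s t → IsFace s t := by
  intro d
  induction d with
  | zero =>
    intro s t hd hs ht hst h
    rcases eq_or_exists_move hs ht hst h with rfl | ⟨t', hm, _⟩
    · exact .refl
    · have := (t.move_spec t' hm).1
      omega
  | succ d ih =>
    intro s t hd hs ht hst h
    rcases eq_or_exists_move hs ht hst h with rfl | ⟨t', hm, h'⟩
    · exact .refl
    · obtain ⟨h1, h2, h3⟩ := t.move_spec t' hm
      exact (ih (by omega) hs (h3 ht) (by omega) h').tail hm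

/-- A property that passes to some codimension one face of every face of positive dimension passes
to some vertex. -/
theorem exists_vertex {P : Spine true → Prop}
    (hP : ∀ u : Spine true, u.Pos → P u → 0 < u.dim → ∃ u', Move u' u ∧ P u') :
    ∀ (d : ℕ) {s : Spine true}, s.dim = d → s.Pos → P s → ∃ v, v.dim = 0 ∧ IsFace v s ∧ P v := by
  intro d
  induction d with
  | zero => exact fun {s} hd _ h => ⟨s, hd, .refl, h⟩
  | succ d ih =>
    intro s hd hs h
    obtain ⟨u', hm, hu⟩ := hP s hs h (by omega)
    obtain ⟨h1, h2, h3⟩ := s.move_spec u' hm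
    obtain ⟨v, hv, hvu, hPv⟩ := ih (by omega) (h3 hs) hu
    exact ⟨v, hv, hvu.tail hm, hPv⟩

/-- Every face has a vertex with the same elements and the same minimum of the distinguished
stretch. -/
theorem exists_vertex_present (s : Spine true) (hs : s.Pos) :
    ∃ v, v.dim = 0 ∧ IsFace v s ∧ v.present = s.present ∧ v.lo = s.lo := by
  refine exists_vertex (P := fun v => v.present = s.present ∧ v.lo = s.lo) ?_ _ rfl hs ⟨rfl, rfl⟩
  rintro u hu ⟨h1, h2⟩ hd
  by_cases hlh : u.lo < u.hi
  · obtain ⟨u', hm, e1, _, e3, _⟩ := u.exists_rightOuter u.lo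
      (u.breaks_subset (u.lo_mem_breaks rfl).1) (le_refl _) hlh
    exact ⟨u', hm, e1.trans h1, e3.trans h2⟩
  · obtain ⟨x, hx, hx'⟩ := (u.exists_of_dim_pos hu hd).resolve_right hlh
    obtain ⟨u', hm, e1, _, e3, _⟩ := u.exists_break hu x hx hx' (by omega)
    exact ⟨u', hm, e1.trans h1, e3.trans h2⟩

/-- Every face has a vertex with the same breaks and the same maximum of the distinguished
stretch. -/
theorem exists_vertex_breaks (s : Spine true) (hs : s.Pos) :
    ∃ v, v.dim = 0 ∧ IsFace v s ∧ v.breaks = s.breaks ∧ v.hi = s.hi := by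
  refine exists_vertex (P := fun v => v.breaks = s.breaks ∧ v.hi = s.hi) ?_ _ rfl hs ⟨rfl, rfl⟩
  rintro u hu ⟨h1, h2⟩ hd
  rcases u.exists_of_dim_pos hu hd with ⟨x, hx, hx'⟩ | hlh
  · obtain ⟨u', hm, _, e2, _, e4⟩ := u.exists_drop hu x hx hx'
    exact ⟨u', hm, e2.trans h1, e4.trans h2⟩
  · have hb := (u.lo_mem_breaks rfl).2
    obtain ⟨u', hm, _, e2, _, e4⟩ := u.exists_leftOuter u.hi (u.breaks_subset hb) hlh (le_refl _)
    exact ⟨u', hm, by rw [e2, Finset.insert_eq_self.2 hb, h1], e4.trans h2⟩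

/-- A face is the smallest face that contains all of its vertices. Two vertices suffice: one bounds
the elements and the minimum of the distinguished stretch, the other one the breaks and the
maximum. -/
theorem isFace_of_vertices {s t : Spine true} (hs : s.Pos) (ht : t.Pos) (hst : s.total = t.total)
    (h : ∀ v, v.dim = 0 → IsFace v s → IsFace v t) : IsFace s t := by
  obtain ⟨v, hv, hvs, h1, h2⟩ := s.exists_vertex_present hs
  obtain ⟨w, hw, hws, h3, h4⟩ := s.exists_vertex_breaks hs
  have hvt := (h v hv hvs).below
  have hwt := (h w hw hws).below
  exact isFace_of_below _ rfl hs ht hst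
    ⟨h1 ▸ hvt.present, h3 ▸ hwt.breaks, h2 ▸ hvt.lo, h4 ▸ hwt.hi⟩

end Spine

/-! #### Faces of spines lift to faces of trees -/

theorem CTree.exists_offDim_eq_zero {p : Bool} {c : Color} : ∀ (d : ℕ) (t : CTree p c),
    t.offDim = d → ∃ u, Relation.ReflTransGen Contract u t ∧ u.spine = t.spine ∧ u.offDim = 0 := by
  intro d
  induction d with
  | zero => exact fun t h => ⟨t, .refl, rfl, h⟩
  | succ d ih =>
    intro t h
    obtain ⟨u, hu, hs⟩ := t.exists_contract_offDim (by omega)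
    have h1 := hu.dim_eq
    have h2 := t.dim_eq_spine
    have h3 := u.dim_eq_spine
    rw [hs] at h3
    obtain ⟨v, hv, hvs, hv0⟩ := ih u (by omega)
    exact ⟨v, hv.tail hu, hvs.trans hs, hv0⟩

theorem CTree.exists_contract_of_isFace {p : Bool} {c : Color} {x y : Spine p}
    (h : Spine.IsFace x y) : ∀ t : CTree p c, t.spine = y →
      ∃ u, Relation.ReflTransGen Contract u t ∧ u.spine = x ∧ u.offDim = 0 := by
  induction h with
  | refl =>
    rintro t rfl
    exact t.exists_offDim_eq_zero _ rfl
  | tail _ hm ih =>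
    rintro t rfl
    obtain ⟨t', ht', hs, h0⟩ := t.exists_offDim_eq_zero _ rfl
    obtain ⟨t'', hc, rfl⟩ := CTree.exists_contract_of_move h0 (hs ▸ hm)
    obtain ⟨u, hu, hux, hu0⟩ := ih t'' rfl
    exact ⟨u, (hu.tail hc).trans ht', hux, hu0⟩

/-! ### The projection -/

section

variable {n : ℕ}

theorem SpineFace.isFaceOf_iff (u v : SpineFace n) :
    IsFaceOf (faceEquiv n u) (faceEquiv n v) ↔ Spine.IsFace u.1 v.1 := by
  constructor
  · intro h
    have := Relation.ReflTransGen.lift (p := Spine.Move)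
      (fun s : Freehedron n => ((faceEquiv n).symm s).1) (fun a b h => by
        obtain ⟨a, rfl⟩ := (faceEquiv n).surjective a
        obtain ⟨b, rfl⟩ := (faceEquiv n).surjective b
        change Spine.Move ((faceEquiv n).symm _).1 ((faceEquiv n).symm _).1
        rw [Equiv.symm_apply_apply, Equiv.symm_apply_apply]
        exact (facet_faceEquiv a b).1 h) _ _ h
    change Spine.IsFace ((faceEquiv n).symm _).1 ((faceEquiv n).symm _).1 at this
    rw [Equiv.symm_apply_apply, Equiv.symm_apply_apply] at this
    exact this
  · obtain ⟨v, hv⟩ := v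
    intro h
    change Spine.IsFace u.1 v at h
    induction h with
    | refl => exact .refl
    | tail _ hm ih =>
      have h1 := Spine.move_spec _ _ hm
      exact (ih ⟨h1.2.2 hv.1, h1.2.1.trans hv.2⟩).tail ((facet_faceEquiv _ _).2 hm)

theorem Multiplihedron.isFaceOf_iff (σ τ : Multiplihedron n) :
    IsFaceOf σ τ ↔ Relation.ReflTransGen Contract σ.1 τ.1 := by
  constructor
  · exact fun h => Relation.ReflTransGen.lift (p := Contract) (fun σ : Multiplihedron n => σ.1)
      (fun _ _ h => h) _ _ h
  · obtain ⟨τ, hτ⟩ := τ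
    intro h
    change Relation.ReflTransGen Contract σ.1 τ at h
    induction h with
    | refl => exact .refl
    | @tail b c _ hm ih =>
      have hb := hm.leaves_eq.trans hτ
      exact (ih hb).tail (show FaceSystem.facet (P := Multiplihedron n) ⟨b, hb⟩ ⟨c, hτ⟩ from hm)

/-- The spine of a face of the multiplihedron. -/
def Multiplihedron.spineFace (σ : Multiplihedron (n + 1)) : SpineFace n :=
  ⟨σ.1.spine, σ.1.spine_pos, by
    have h1 := σ.1.leaves_eq_spine
    have h2 := σ.2
    omega⟩

/-- The projection of the multiplihedron onto the freehedron: a painted tree is sent to the face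
given by its spine. -/
def proj (σ : Multiplihedron (n + 1)) : Freehedron n := faceEquiv n σ.spineFace

theorem CTree.isFace_spine {p : Bool} {c : Color} {u t : CTree p c}
    (h : Relation.ReflTransGen Contract u t) : Spine.IsFace u.spine t.spine := by
  induction h with
  | refl => exact .refl
  | tail _ h ih => exact Relation.ReflTransGen.trans ih h.isFace

theorem proj_isFaceOf {σ τ : Multiplihedron (n + 1)} (h : IsFaceOf σ τ) :
    IsFaceOf (proj σ) (proj τ) :=
  (SpineFace.isFaceOf_iff _ _).2 (CTree.isFace_spine ((Multiplihedron.isFaceOf_iff _ _).1 h))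

/-- The standard tree of a spine, as a face of the multiplihedron. -/
def SpineFace.toMultiplihedron (u : SpineFace n) : Multiplihedron (n + 1) :=
  ⟨u.1.toTree, by rw [CTree.leaves_eq_spine, (u.1.toTree_spec u.2.1).1, u.2.2]⟩

theorem SpineFace.spineFace_toMultiplihedron (u : SpineFace n) :
    u.toMultiplihedron.spineFace = u := Subtype.ext (u.1.toTree_spec u.2.1).1

theorem proj_surjective : Function.Surjective (proj (n := n)) := by
  intro s
  obtain ⟨u, rfl⟩ := (faceEquiv n).surjective s
  exact ⟨u.toMultiplihedron, congrArg _ u.spineFace_toMultiplihedron⟩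

theorem Freehedron.isFaceOf_antisymm {s t : Freehedron n} (h : IsFaceOf s t) (h' : IsFaceOf t s) :
    s = t := by
  obtain ⟨u, rfl⟩ := (faceEquiv n).surjective s
  obtain ⟨v, rfl⟩ := (faceEquiv n).surjective t
  have h1 := ((SpineFace.isFaceOf_iff _ _).1 h).spec
  have h2 := ((SpineFace.isFaceOf_iff _ _).1 h').spec
  rw [Subtype.ext (h1.2.2.2 (le_antisymm h1.1 h2.1))]

theorem Freehedron.ext_of_toTriple {s t : Freehedron n} (h : s.toTriple = t.toTriple) : s = t := by
  obtain ⟨u, rfl⟩ := (faceEquiv n).surjective s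
  obtain ⟨v, rfl⟩ := (faceEquiv n).surjective t
  rw [SpineFace.ext_of_triple (u := u) (v := v)]
  exact u.toTriple_toFace.symm.trans (h.trans v.toTriple_toFace)

theorem isProjection_proj : IsProjection (proj (n := n)) where
  vertex v hv := (SpineFace.toTriple_toFace v.spineFace).trans (v.1.triple_vertex hv)
  contains _ _ _ h := proj_isFaceOf h
  smallest σ τ h := by
    obtain ⟨u, rfl⟩ := (faceEquiv n).surjective τ
    refine (SpineFace.isFaceOf_iff _ _).2 (Spine.isFace_of_vertices σ.spineFace.2.1 u.2.1
      (σ.spineFace.2.2.trans u.2.2.symm) fun x hx hxs => ?_)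
    -- Every vertex of the face `proj σ` is the image of a vertex of `σ`.
    obtain ⟨w, hw, rfl, hw0⟩ := CTree.exists_contract_of_isFace hxs σ.1 rfl
    have hl : w.leaves = n + 1 := by
      have h1 := w.leaves_eq_spine
      have h2 := hxs.spec.2.1
      have h3 := σ.spineFace.2.2
      omega
    have hd : w.dim = 0 := by
      have := w.dim_eq_spine
      omega
    exact (SpineFace.isFaceOf_iff (Multiplihedron.spineFace ⟨w, hl⟩) u).1
      (h ⟨w, hl⟩ hd ((Multiplihedron.isFaceOf_iff _ _).2 hw))

theorem IsProjection.eq_proj {π : Multiplihedron (n + 1) → Freehedron n} (h : IsProjection π) :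
    π = proj := by
  have hv : ∀ v : Multiplihedron (n + 1), FaceSystem.dim v = 0 → π v = proj v := fun v hv =>
    Freehedron.ext_of_toTriple ((h.vertex v hv).trans (isProjection_proj.vertex v hv).symm)
  funext σ
  refine Freehedron.isFaceOf_antisymm (h.smallest σ _ fun v hv' hvσ => ?_)
    (isProjection_proj.smallest σ _ fun v hv' hvσ => ?_)
  · exact hv v hv' ▸ isProjection_proj.contains v σ hv' hvσ
  · exact hv v hv' ▸ h.contains v σ hv' hvσ

end

/-! ### Cellular chains -/

section

variable {X Y : Type*} {k : Type*} [CommRing k] {e : X → Y}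

theorem exists_lmapDomain_eq (he : Function.Injective e) {v : Y →₀ k}
    (hv : ∀ y ∈ v.support, y ∈ Set.range e) :
    Finsupp.lmapDomain k k e (Finsupp.lcomapDomain (R := k) e he v) = v :=
  Finsupp.mapDomain_comapDomain e he v fun y hy => hv y hy

theorem lmapDomain_injective (k : Type*) [CommRing k] (he : Function.Injective e) :
    Function.Injective (Finsupp.lmapDomain k k e) :=
  Finsupp.mapDomain_injective he

end

/-- The orientation of the cells labelled by the basis of a complex, where the incidence numbers are
the coefficients of the differential. -/
def CellOrientation.ofDifferential {P : Type} [FaceSystem P] {Y : Type} (e : P → Y)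
    (he : Function.Injective e) (D : Y → Y →₀ ℤ)
    (hrange : ∀ σ, ∀ y ∈ (D (e σ)).support, y ∈ Set.range e)
    (hD : ∀ σ τ, (FaceSystem.facet τ σ → D (e σ) (e τ) = 1 ∨ D (e σ) (e τ) = -1) ∧
      (¬ FaceSystem.facet τ σ → D (e σ) (e τ) = 0))
    (hedge : ∀ σ, FaceSystem.dim σ = 1 → coeffSum (D (e σ)) = 0)
    (hsq : ∀ σ, Finsupp.linearCombination ℤ D (D (e σ)) = 0) : CellOrientation P where
  inc σ := Finsupp.lcomapDomain (R := ℤ) e he (D (e σ))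
  inc_facet σ τ h := (hD σ τ).1 h
  inc_of_not_facet σ τ h := (hD σ τ).2 h
  edge σ h := by
    have h1 := hedge σ h
    rw [← exists_lmapDomain_eq he (hrange σ), Finsupp.lmapDomain_apply, coeffSum_mapDomain] at h1
    simpa [coeffSum, Finsupp.linearCombination_apply] using h1
  sq_zero σ := by
    refine lmapDomain_injective ℤ he ?_
    have h1 := hsq σ
    rw [← exists_lmapDomain_eq he (hrange σ), Finsupp.lmapDomain_apply,
      Finsupp.linearCombination_mapDomain, Finsupp.linearCombination_apply] at h1
    rw [map_finsuppSum, map_zero, ← h1]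
    refine Finsupp.sum_congr fun τ _ => ?_
    rw [map_smul, exists_lmapDomain_eq he (hrange τ)]
    rfl

theorem CellOrientation.lmapDomain_boundary {P : Type} [FaceSystem P] {Y : Type} {e : P → Y}
    {he : Function.Injective e} {D : Y → Y →₀ ℤ}
    {hrange : ∀ σ, ∀ y ∈ (D (e σ)).support, y ∈ Set.range e}
    {hD : ∀ σ τ, (FaceSystem.facet τ σ → D (e σ) (e τ) = 1 ∨ D (e σ) (e τ) = -1) ∧
      (¬ FaceSystem.facet τ σ → D (e σ) (e τ) = 0)}
    {hedge : ∀ σ, FaceSystem.dim σ = 1 → coeffSum (D (e σ)) = 0}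
    {hsq : ∀ σ, Finsupp.linearCombination ℤ D (D (e σ)) = 0}
    {k : Type*} [CommRing k] {D' : Y → Y →₀ k} (hD' : ∀ σ, castL k (D (e σ)) = D' (e σ))
    (x : P →₀ k) :
    Finsupp.lmapDomain k k e ((ofDifferential e he D hrange hD hedge hsq).boundary k x) =
      Finsupp.linearCombination k D' (Finsupp.lmapDomain k k e x) := by
  refine LinearMap.congr_fun (f := (Finsupp.lmapDomain k k e).comp
    ((ofDifferential e he D hrange hD hedge hsq).boundary k))
    (g := (Finsupp.linearCombination k D').comp (Finsupp.lmapDomain k k e))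
    (LinearMap.ext_single_one fun σ => ?_) x
  rw [LinearMap.comp_apply, LinearMap.comp_apply, Finsupp.lmapDomain_apply,
    Finsupp.lmapDomain_apply, Finsupp.mapDomain_single, Finsupp.linearCombination_single, one_smul,
    boundary, Finsupp.linearCombination_single, one_smul, ← hD',
    ← exists_lmapDomain_eq he (hrange σ), Finsupp.lmapDomain_apply, castL_mapDomain]
  rfl

/-! #### Change of rings and augmentation for spines -/

theorem castL_redT (k : Type*) [CommRing k] {p : Bool} {c : Color} (x : CMod ℤ p c) :
    castL k (redT x) = redT (castL k x) := by
  have : (castL k).comp (redT (k := ℤ) (p := p) (c := c)).toAddMonoidHom =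
      (redT (k := k) (p := p) (c := c)).toAddMonoidHom.comp (castL k) := by
    refine Finsupp.addHom_ext' fun t => AddMonoidHom.ext_int ?_
    simp only [AddMonoidHom.comp_apply, Finsupp.singleAddHom_apply, LinearMap.toAddMonoidHom_coe,
      castL_single, Int.cast_one, redT_single]
    rcases Nat.eq_zero_or_pos t.offDim with h | h
    · simp [h]
    · simp [atZero_pos h]
  exact DFunLike.congr_fun this x

namespace Spine

theorem redT_toTree_d (k : Type*) [CommRing k] {p : Bool} (u : Spine p) (hu : u.Pos) :
    redT (u.toTree.d k) = u.D k := by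
  obtain ⟨h1, h2⟩ := u.toTree_spec hu
  rw [redT_d, h1, h2, atZero_zero]

theorem castL_D (k : Type*) [CommRing k] {p : Bool} (u : Spine p) (hu : u.Pos) :
    castL k (u.D ℤ) = u.D k := by
  rw [← redT_toTree_d ℤ u hu, castL_redT, CTree.castL_d, redT_toTree_d k u hu]

theorem DL_D (k : Type*) [CommRing k] {p : Bool} (u : Spine p) (hu : u.Pos) :
    DL (u.D k) = 0 := by
  rw [← redT_toTree_d k u hu, ← redT_dL, dL_d, map_zero]

theorem coeffSum_D (k : Type*) [CommRing k] {p : Bool} (u : Spine p) (hu : u.Pos)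
    (hd : u.dim = 1) : coeffSum (u.D k) = 0 := by
  have h1 := u.toTree.dim_eq_spine
  rw [(u.toTree_spec hu).1, (u.toTree_spec hu).2] at h1
  have h2 := LinearMap.eq_of_mem_supported (f := coeffSum.comp redT) (g := coeffSum)
    (fun t ht => ?_) (CTree.d_mem k u.toTree)
  · rw [LinearMap.comp_apply, redT_toTree_d k u hu, CTree.coeffSum_d (by omega)] at h2
    exact h2
  · have h3 := t.dim_eq_spine
    have h4 := ht.1
    rw [LinearMap.comp_apply, redT_single, show t.offDim = 0 by omega]
    simp

theorem exists_move (u : Spine true) (hu : u.Pos) (hd : 0 < u.dim) : ∃ u', Move u' u := by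
  rcases u.exists_of_dim_pos hu hd with ⟨x, h1, h2⟩ | h
  · obtain ⟨u', h, _⟩ := u.exists_drop hu x h1 h2
    exact ⟨u', h⟩
  · obtain ⟨u', h, _⟩ := u.exists_leftOuter u.hi
      (u.breaks_subset (u.lo_mem_breaks rfl).2) h (le_refl _)
    exact ⟨u', h⟩

end Spine

/-! #### The two orientations -/

/-- The orientation of the multiplihedron by the differential of `M_∞`. -/
def orientJ (n : ℕ) : CellOrientation (Multiplihedron (n + 1)) :=
  .ofDifferential (fun σ => σ.1) Subtype.val_injective (CTree.d ℤ)
    (fun σ t ht => ⟨⟨t, (((Finsupp.mem_supported _ _).1 (CTree.d_mem ℤ σ.1)) ht).2.trans σ.2⟩, rfl⟩)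
    (fun σ τ => σ.1.isSignedIndicator_d τ.1)
    (fun _ h => CTree.coeffSum_d (le_of_eq h)) (fun σ => dL_d ℤ σ.1)

/-- The spine of a face of the freehedron. -/
def Freehedron.spine {n : ℕ} (s : Freehedron n) : Spine true := ((faceEquiv n).symm s).1

theorem Freehedron.spine_injective (n : ℕ) : Function.Injective (Freehedron.spine (n := n)) :=
  Subtype.val_injective.comp (faceEquiv n).symm.injective

theorem spine_faceEquiv {n : ℕ} (u : SpineFace n) : (faceEquiv n u).spine = u.1 := by
  rw [Freehedron.spine, Equiv.symm_apply_apply]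

theorem Freehedron.spine_pos {n : ℕ} (s : Freehedron n) : s.spine.Pos ∧ s.spine.total = n :=
  ((faceEquiv n).symm s).2

theorem Freehedron.mem_range_spine {n : ℕ} {u : Spine true} (hu : u.Pos ∧ u.total = n) :
    u ∈ Set.range (Freehedron.spine (n := n)) :=
  ⟨faceEquiv n ⟨u, hu⟩, spine_faceEquiv _⟩

theorem Freehedron.facet_iff {n : ℕ} (s t : Freehedron n) :
    FaceSystem.facet s t ↔ Spine.Move s.spine t.spine := by
  rw [spine, spine, ← facet_faceEquiv, Equiv.apply_symm_apply, Equiv.apply_symm_apply]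

theorem Freehedron.dim_eq {n : ℕ} (s : Freehedron n) : FaceSystem.dim s = s.spine.dim := by
  rw [spine, ← dim_faceEquiv, Equiv.apply_symm_apply]

theorem Freehedron.toTree_toTriple {n : ℕ} (s : Freehedron n) :
    s.toTriple.toTree = s.spine.toTree := by
  obtain ⟨u, rfl⟩ := (faceEquiv n).surjective s
  rw [spine_faceEquiv, ← Spine.triple_toTree]
  exact congrArg _ u.toTriple_toFace

/-- The orientation of the freehedron by the differential of `T`. -/
def orientF (n : ℕ) : CellOrientation (Freehedron n) :=
  .ofDifferential Freehedron.spine (Freehedron.spine_injective n) (Spine.D ℤ)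
    (fun s u hu => by
      have h := s.spine.move_spec u
        ((s.spine.isSignedIndicator_D s.spine_pos.1).ne_zero_iff.1 (Finsupp.mem_support_iff.1 hu))
      exact Freehedron.mem_range_spine ⟨h.2.2 s.spine_pos.1, h.2.1.trans s.spine_pos.2⟩)
    (fun s t => by
      rw [Freehedron.facet_iff]
      exact s.spine.isSignedIndicator_D s.spine_pos.1 t.spine)
    (fun s h => s.spine.coeffSum_D ℤ s.spine_pos.1 (s.dim_eq.symm.trans h))
    (fun s => s.spine.DL_D ℤ s.spine_pos.1)

section

variable {k : Type*} [CommRing k] {n : ℕ}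

/-- Cellular chains of the multiplihedron as elements of `M_∞`. -/
abbrev chainsJ : (Multiplihedron (n + 1) →₀ k) →ₗ[k] CMod k true .m :=
  Finsupp.lmapDomain k k fun σ => σ.1

/-- Cellular chains of the freehedron as combinations of spines. -/
abbrev chainsF : (Freehedron n →₀ k) →ₗ[k] (Spine true →₀ k) :=
  Finsupp.lmapDomain k k Freehedron.spine

theorem chainsF_injective : Function.Injective (chainsF (k := k) (n := n)) :=
  lmapDomain_injective k (Freehedron.spine_injective n)

theorem chainsJ_boundary (x : Multiplihedron (n + 1) →₀ k) :
    chainsJ ((orientJ n).boundary k x) = dL k true .m (chainsJ x) :=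
  CellOrientation.lmapDomain_boundary (fun σ => CTree.castL_d k σ.1) x

theorem chainsF_boundary (x : Freehedron n →₀ k) :
    chainsF ((orientF n).boundary k x) = Spine.DL (chainsF x) :=
  CellOrientation.lmapDomain_boundary (fun s => s.spine.castL_D k s.spine_pos.1) x

theorem chainsJ_mem (x : Multiplihedron (n + 1) →₀ k) : chainsJ x ∈ Mcomp k n := by
  classical
  refine (Finsupp.mem_supported _ _).2 fun t ht => ?_
  obtain ⟨σ, _, rfl⟩ := Finset.mem_image.1 (Finsupp.mapDomain_support (Finset.mem_coe.1 ht))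
  exact σ.2

/-- Reductions of elements of `M_∞(a^n, m; m)` are chains of the freehedron. -/
theorem redT_support {x : CMod k true .m} (hx : x ∈ Mcomp k n) :
    ∀ u ∈ (redT x).support, u ∈ Set.range (Freehedron.spine (n := n)) := by
  rw [Mcomp, Finsupp.supported_eq_span_single] at hx
  suffices redT x ∈ Finsupp.supported k k (Set.range (Freehedron.spine (n := n))) from
    fun u hu => (Finsupp.mem_supported k _).1 this hu
  induction hx using Submodule.span_induction with
  | mem x hx =>
    obtain ⟨t, ht, rfl⟩ := hx
    rw [redT_single]
    rcases Nat.eq_zero_or_pos t.offDim with h | h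
    · rw [h, atZero_zero]
      refine Finsupp.single_mem_supported k _ (Freehedron.mem_range_spine ⟨t.spine_pos, ?_⟩)
      have h1 := t.leaves_eq_spine
      have h2 : t.leaves = n + 1 := ht
      omega
    · rw [atZero_pos h]
      exact zero_mem _
  | zero => rw [map_zero]; exact zero_mem _
  | add x y _ _ hx hy => rw [map_add]; exact add_mem hx hy
  | smul a x _ hx => rw [map_smul]; exact Submodule.smul_mem _ a hx

end

/-! ### Uniqueness of the induced map -/

section

variable {k : Type*} [CommRing k] {P Q : Type} [FaceSystem P] [FaceSystem Q]

theorem CellOrientation.boundary_single_apply (o : CellOrientation P) (σ τ : P) (a : k) :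
    o.boundary k (Finsupp.single σ a) τ = a * (o.inc σ τ : k) := by
  simp [boundary]

/-- A chain map of degree zero that is carried by `π` is determined by its values on vertices: the
difference of two such maps on a cell `σ` is a cycle supported on the single cell `π σ`, and a
multiple of a cell of positive dimension is a cycle only if it vanishes. -/
theorem IsInducedMap.eq {oP : CellOrientation P} {oQ : CellOrientation Q} {π : P → Q}
    {φ φ' : (P →₀ k) →ₗ[k] (Q →₀ k)} (h : IsInducedMap oP oQ π φ) (h' : IsInducedMap oP oQ π φ')
    (hdim : ∀ σ τ : P, FaceSystem.facet σ τ → FaceSystem.dim σ < FaceSystem.dim τ)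
    (hface : ∀ s t : Q, IsFaceOf s t → FaceSystem.dim t ≤ FaceSystem.dim s → s = t)
    (hπ : ∀ σ, FaceSystem.dim (π σ) ≤ FaceSystem.dim σ)
    (hfacet : ∀ t : Q, 0 < FaceSystem.dim t → ∃ s, FaceSystem.facet s t) : φ' = φ := by
  suffices ∀ m, ∀ σ : P, FaceSystem.dim σ = m → φ' (Finsupp.single σ 1) = φ (Finsupp.single σ 1) from
    LinearMap.ext_single_one fun σ => this _ σ rfl
  intro m
  induction m using Nat.strong_induction_on with
  | _ m ih =>
  intro σ hσ
  rcases Nat.eq_zero_or_pos m with rfl | hm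
  · rw [h'.vertex σ hσ, h.vertex σ hσ]
  have hb : φ' (oP.boundary k (Finsupp.single σ 1)) = φ (oP.boundary k (Finsupp.single σ 1)) := by
    refine LinearMap.eq_of_mem_supported (s := {τ : P | FaceSystem.dim τ < m})
      (fun τ hτ => ih _ hτ τ rfl) ((Finsupp.mem_supported _ _).2 fun τ hτ => ?_)
    by_contra hn
    refine Finsupp.mem_support_iff.1 (Finset.mem_coe.1 hτ) ?_
    rw [CellOrientation.boundary_single_apply, oP.inc_of_not_facet σ τ fun hf =>
      hn ((hdim _ _ hf).trans_eq hσ), Int.cast_zero, mul_zero]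
  have hw : oQ.boundary k (φ' (Finsupp.single σ 1) - φ (Finsupp.single σ 1)) = 0 := by
    rw [map_sub, ← h'.chain_map, ← h.chain_map, hb, sub_self]
  have hs : ∀ τ, (φ' (Finsupp.single σ 1) - φ (Finsupp.single σ 1)) τ ≠ 0 →
      τ = π σ ∧ FaceSystem.dim τ = FaceSystem.dim σ := by
    intro τ hτ
    have hc : IsFaceOf τ (π σ) ∧ FaceSystem.dim τ = FaceSystem.dim σ := by
      by_cases h0 : φ (Finsupp.single σ 1) τ = 0
      · refine h'.carried σ τ fun h1 => hτ ?_
        rw [Finsupp.sub_apply, h0, h1, sub_zero]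
      · exact h.carried σ τ h0
    exact ⟨hface _ _ hc.1 ((hπ σ).trans_eq hc.2.symm), hc.2⟩
  rw [← sub_eq_zero]
  generalize φ' (Finsupp.single σ 1) - φ (Finsupp.single σ 1) = w at hw hs ⊢
  have hw' : w = Finsupp.single (π σ) (w (π σ)) := by
    ext τ
    by_cases hτ : τ = π σ
    · rw [hτ, Finsupp.single_eq_same]
    · rw [Finsupp.single_eq_of_ne hτ]
      by_contra h0
      exact hτ (hs τ h0).1
  by_contra hne
  have h0 : w (π σ) ≠ 0 := fun h0 => hne (by rw [hw', h0, Finsupp.single_zero])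
  obtain ⟨ρ, hρ⟩ := hfacet (π σ) (by have := (hs _ h0).2; omega)
  rw [hw'] at hw
  have h1 := DFunLike.congr_fun hw ρ
  rw [CellOrientation.boundary_single_apply] at h1
  rcases oQ.inc_facet _ _ hρ with h2 | h2 <;> rw [h2] at h1 <;> simp at h1 <;> exact h0 h1

end

/-! ### The isomorphisms and the induced map -/

section

variable (k : Type*) [CommRing k] (n : ℕ)

/-- The isomorphism of the cellular chains of the multiplihedron with `M_∞(a^n, m; m)`. -/
def isoJ : (Multiplihedron (n + 1) →₀ k) ≃ₗ[k] Mcomp k n :=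
  LinearEquiv.ofBijective (LinearMap.codRestrict _ chainsJ chainsJ_mem)
    ⟨(LinearMap.injective_codRestrict_iff _).2 (lmapDomain_injective k Subtype.val_injective),
      fun y => ⟨Finsupp.lcomapDomain (R := k) (fun σ : Multiplihedron (n + 1) => σ.1)
        Subtype.val_injective y.1, Subtype.ext (exists_lmapDomain_eq Subtype.val_injective
          fun t ht => ⟨⟨t, (Finsupp.mem_supported _ _).1 y.2 ht⟩, rfl⟩)⟩⟩

variable {k n}

theorem coe_isoJ (x : Multiplihedron (n + 1) →₀ k) : (isoJ k n x : CMod k true .m) = chainsJ x := rfl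

/-- Elements of `T` as combinations of spines. -/
def redQ : TQuot k .m →ₗ[k] (Spine true →₀ k) := (relT k .m).liftQ redT (relT_le_ker_redT k)

theorem redQ_quotT (x : CMod k true .m) : redQ (quotT k .m x) = redT x := rfl

theorem redQ_injective : Function.Injective (redQ (k := k)) :=
  LinearMap.ker_eq_bot.1 (Submodule.ker_liftQ_eq_bot' _ _ (relT_eq_ker_redT k))

theorem redQ_dT (x : TQuot k .m) : redQ (dT k .m x) = Spine.DL (redQ x) := by
  obtain ⟨x, rfl⟩ := (relT k .m).mkQ_surjective x
  exact redT_dL x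

/-- Cellular chains of the freehedron as elements of `M_∞`. -/
def treesF : (Freehedron n →₀ k) →ₗ[k] CMod k true .m :=
  Finsupp.lmapDomain k k fun s => s.toTriple.toTree

theorem redT_treesF (x : Freehedron n →₀ k) : redT (treesF x) = chainsF x := by
  refine LinearMap.congr_fun (f := redT.comp treesF) (LinearMap.ext_single_one fun s => ?_) x
  obtain ⟨h1, h2⟩ := s.spine.toTree_spec s.spine_pos.1
  rw [LinearMap.comp_apply, treesF, Finsupp.lmapDomain_apply, Finsupp.lmapDomain_apply,
    Finsupp.mapDomain_single, Finsupp.mapDomain_single, redT_single, s.toTree_toTriple, h1, h2,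
    atZero_zero]

theorem treesF_mem (x : Freehedron n →₀ k) : treesF x ∈ Mcomp k n := by
  classical
  refine (Finsupp.mem_supported _ _).2 fun t ht => ?_
  obtain ⟨s, _, rfl⟩ := Finset.mem_image.1 (Finsupp.mapDomain_support (Finset.mem_coe.1 ht))
  change s.toTriple.toTree.leaves = n + 1
  rw [s.toTree_toTriple, CTree.leaves_eq_spine, (s.spine.toTree_spec s.spine_pos.1).1, s.spine_pos.2]

variable (k n) in
/-- The isomorphism of the cellular chains of the freehedron with `T(a^n, m; m)`. -/
def isoF : (Freehedron n →₀ k) ≃ₗ[k] Tcomp k n :=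
  LinearEquiv.ofBijective (LinearMap.codRestrict (Tcomp k n) ((quotT k .m).comp treesF)
      fun x => Submodule.mem_map_of_mem (treesF_mem x))
    ⟨(LinearMap.injective_codRestrict_iff _).2 fun x y h => by
        have := congrArg redQ h
        rw [LinearMap.comp_apply, LinearMap.comp_apply, redQ_quotT, redQ_quotT, redT_treesF,
          redT_treesF] at this
        exact chainsF_injective this,
      fun ⟨y, hy⟩ => by
        obtain ⟨x, hx, rfl⟩ := hy
        refine ⟨Finsupp.lcomapDomain (R := k) _ (Freehedron.spine_injective n) (redT x),
          Subtype.ext (redQ_injective ?_)⟩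
        change redT (treesF _) = redT x
        rw [redT_treesF]
        exact exists_lmapDomain_eq _ (redT_support hx)⟩

theorem redQ_isoF (x : Freehedron n →₀ k) : redQ (isoF k n x : TQuot k .m) = chainsF x :=
  redT_treesF x

variable (k n) in
/-- The map of cellular chains induced by the projection: a cell goes to the cell of its spine if
the branches off the spine have dimension zero, and to zero otherwise. -/
def chainMap : (Multiplihedron (n + 1) →₀ k) →ₗ[k] (Freehedron n →₀ k) :=
  (Finsupp.lcomapDomain _ (Freehedron.spine_injective n)).comp (redT.comp chainsJ)

theorem chainsF_chainMap (x : Multiplihedron (n + 1) →₀ k) :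
    chainsF (chainMap k n x) = redT (chainsJ x) :=
  exists_lmapDomain_eq (Freehedron.spine_injective n) (redT_support (chainsJ_mem x))

theorem chainMap_single (σ : Multiplihedron (n + 1)) :
    chainMap k n (Finsupp.single σ 1) = atZero σ.1.offDim (Finsupp.single (proj σ) 1) := by
  refine chainsF_injective ?_
  rw [chainsF_chainMap, Finsupp.lmapDomain_apply, Finsupp.mapDomain_single, redT_single, map_atZero,
    Finsupp.lmapDomain_apply, Finsupp.mapDomain_single, proj, spine_faceEquiv]
  rfl

theorem dim_eq_proj (σ : Multiplihedron (n + 1)) :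
    FaceSystem.dim σ = FaceSystem.dim (proj σ) + σ.1.offDim := by
  rw [Freehedron.dim_eq, proj, spine_faceEquiv]
  have := σ.1.dim_eq_spine
  change σ.1.dim = σ.1.spine.dim + σ.1.offDim
  omega

theorem isInducedMap_chainMap : IsInducedMap (orientJ n) (orientF n) proj (chainMap k n) where
  chain_map x := chainsF_injective <| by
    rw [chainsF_chainMap, chainsJ_boundary, redT_dL, chainsF_boundary, chainsF_chainMap]
  vertex v hv := by
    rw [chainMap_single, show v.1.offDim = 0 by have := dim_eq_proj v; omega, atZero_zero]
  carried σ τ h := by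
    rw [chainMap_single] at h
    rcases Nat.eq_zero_or_pos σ.1.offDim with h0 | h0
    · rw [h0, atZero_zero] at h
      obtain rfl : τ = proj σ := by
        by_contra hn
        exact h (Finsupp.single_eq_of_ne hn)
      exact ⟨.refl, by rw [dim_eq_proj, h0, add_zero]⟩
    · rw [atZero_pos h0] at h
      exact absurd rfl h

theorem IsInducedMap.eq_chainMap {φ : (Multiplihedron (n + 1) →₀ k) →ₗ[k] (Freehedron n →₀ k)}
    (h : IsInducedMap (orientJ n) (orientF n) proj φ) : φ = chainMap k n := by
  refine isInducedMap_chainMap.eq h (fun σ τ hστ => ?_) (fun s t hst hd => ?_)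
    (fun σ => ?_) (fun t ht => ?_)
  · exact Nat.lt_of_succ_le (Contract.dim_eq hστ).le
  · obtain ⟨u, rfl⟩ := (faceEquiv n).surjective s
    obtain ⟨v, rfl⟩ := (faceEquiv n).surjective t
    have h1 := ((SpineFace.isFaceOf_iff _ _).1 hst).spec
    rw [Freehedron.dim_eq, Freehedron.dim_eq, spine_faceEquiv, spine_faceEquiv] at hd
    exact congrArg _ (Subtype.ext (h1.2.2.2 (le_antisymm h1.1 hd)))
  · rw [dim_eq_proj σ]
    exact Nat.le_add_right _ _
  · rw [Freehedron.dim_eq] at ht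
    obtain ⟨u, hu⟩ := t.spine.exists_move t.spine_pos.1 ht
    have h1 := Spine.move_spec _ _ hu
    obtain ⟨s, rfl⟩ := Freehedron.mem_range_spine
      ⟨h1.2.2 t.spine_pos.1, h1.2.1.trans t.spine_pos.2⟩
    exact ⟨s, (s.facet_iff t).2 hu⟩

end

end

theorem mainTheorem5 (k : Type*) [CommRing k] (n : ℕ) :
    ∃ π : Multiplihedron (n + 1) → Freehedron n,
      (IsProjection π ∧ ∀ π', IsProjection π' → π' = π) ∧
      Function.Surjective π ∧
      (∀ σ τ, IsFaceOf σ τ → IsFaceOf (π σ) (π τ)) ∧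
      ∃ (oJ : CellOrientation (Multiplihedron (n + 1))) (oF : CellOrientation (Freehedron n))
        (Φ : (Multiplihedron (n + 1) →₀ k) ≃ₗ[k] Mcomp k n)
        (Ψ : (Freehedron n →₀ k) ≃ₗ[k] Tcomp k n)
        (φ : (Multiplihedron (n + 1) →₀ k) →ₗ[k] (Freehedron n →₀ k)),
        (∀ σ, (Φ (Finsupp.single σ 1) : CMod k true .m) = Finsupp.single σ.1 1) ∧
        (∀ x, (Φ (oJ.boundary k x) : CMod k true .m) = dL k true .m (Φ x)) ∧
        (∀ s, (Ψ (Finsupp.single s 1) : TQuot k .m) =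
          quotT k .m (Finsupp.single s.toTriple.toTree 1)) ∧
        (∀ x, (Ψ (oF.boundary k x) : TQuot k .m) = dT k .m (Ψ x)) ∧
        (IsInducedMap oJ oF π φ ∧ ∀ φ', IsInducedMap oJ oF π φ' → φ' = φ) ∧
        ∀ x, (Ψ (φ x) : TQuot k .m) = quotT k .m (Φ x) := by
  refine ⟨proj, ⟨isProjection_proj, fun _ h => h.eq_proj⟩, proj_surjective,
    fun _ _ => proj_isFaceOf, orientJ n, orientF n, isoJ k n, isoF k n, chainMap k n,
    fun σ => ?_, fun x => ?_, fun s => ?_, fun x => ?_,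
    ⟨isInducedMap_chainMap, fun _ h => h.eq_chainMap⟩, fun x => ?_⟩
  · exact Finsupp.mapDomain_single
  · exact chainsJ_boundary x
  · exact congrArg (quotT k .m) Finsupp.mapDomain_single
  · refine redQ_injective ?_
    rw [redQ_isoF, redQ_dT, redQ_isoF, chainsF_boundary]
  · refine redQ_injective ?_
    rw [redQ_isoF, chainsF_chainMap, redQ_quotT, coe_isoJ]
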